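/- All manifolds are smooth, Hausdorff, second countable, and connected (and of pure finite dimension); all tensor fields, distributions and connections are smooth. **Definitions.** Let $\mathcal V$ be an integrable distribution on a manifold $M$ with a torsion-free connection $\nabla$. A *local leaf space* of $\mathcal V$ is a manifold $\Sigma$ with a (locally trivial) bundle projection $\pi:U\to\Sigma$, where $U\subseteq M$ is open, such that the fibres of $\pi$ are the leaves of $\mathcal V$ restricted to $U$. A vector field $w$ on an open set $U'\subseteq M$ is *$\mathcal V$-projectable* if, for every such $\pi:U\to\Sigma$ with $U\subseteq U'$, there is a vector field $u$ on $\Sigma$ with $d\pi_x w_x=u_{\pi(x)}$ for all $x\in U$. The connection $\nabla$ is *projectable along $\mathcal V$* if $\nabla_v w$ is $\mathcal V$-projectable for any $\mathcal V$-projectable vector fields $v,w$ on any open subset of $M$. The *projected connection* on a local leaf space $\Sigma$ is then the connection $D$ with $D_{v'}w'=d\pi(\nabla_v w)$ whenever $v,w$ on $U$ project onto $v',w'$ on $\Sigma$. A distribution $\mathcal V$ is *null* for a pseudo-Riemannian metric $g$ if $g(v,w)=0$ for all $v,w\in\mathcal V_x$, $x\in M$, and $\nabla$-*parallel* if $\nabla_u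 v$ is a section of $\mathcal V$ for all local sections $v$ of $\mathcal V$ and all vectors $u$. A *cotangent affine bundle* over a manifold $\Sigma$ is an affine bundle $\pi:M\to\Sigma$ with associated vector bundle $T^*\Sigma$: each fibre $M_y$ is an affine space with translation space $T_y^*\Sigma$, depending smoothly on $y$. Its vertical distribution is $\mathcal V=\operatorname{Ker}d\pi$, so that $\mathcal V_x=T_{\pi(x)}^*\Sigma$. Every $1$-form $\omega$ on $\Sigma$ acts as the diffeomorphism $\omega:M\to M$, $x\mapsto x+\omega_{\pi(x)}$. Given a torsion-free connection $D$ on $\Sigma$, a *Riemann extension metric* for $D$ is a pseudo-Riemannian metric $g$ on $M$ such that $g_x(\xi,w)=\xi(d\pi_x w)$ for all $x\in M$, $w\in T_xM$ and $\xi\in\mathcal V_x=T_{\pi(x)}^*\Sigma$, and $$\omega^*g=g+\pi^*\mathcal L\omega\quad\text{for every 1-form }\omega\text{ on }\Sigma,\qquad (\mathcal L\omega)(u,w)=(D_u\omega)(w)+(D_w\omega)(u).$$ **Theorem.** (1) Let $D$ be a torsion-free connection on a manifold $\Sigma$, and $g$ a Riemann extension metric for $D$ on the total space $M$ of a cotangent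 affine bundle $\pi:M\to\Sigma$ with the vertical distribution $\mathcal V$. Then $\mathcal V$ is $g$-null and parallel with respect to the Levi-Civita connection $\nabla$ of $g$, the connection $\nabla$ is projectable along $\mathcal V$, and the projected connection on the leaf space $\Sigma$ (with the projection $\pi$) is $D$. (2) Conversely, let $(M,g)$ be a pseudo-Riemannian manifold of dimension $2r$ whose Levi-Civita connection $\nabla$ is projectable along an $r$-dimensional null parallel distribution $\mathcal V$. Then, for every $x\in M$, there exist a manifold $\Sigma$ of dimension $r$, a torsion-free connection $D$ on $\Sigma$, a cotangent affine bundle over $\Sigma$ with a Riemann extension metric $g'$ for $D$ on its total space, and a diffeomorphism $\varphi$ of a neighborhood $U$ of $x$ onto an open subset of the total space, such that $\varphi^*g'=g$ on $U$, the differential of $\varphi$ sends $\mathcal V$ onto the vertical distribution, and the composite of $\varphi$ with the affine-bundle projection makes $\Sigma$ a local leaf space of $\mathcal V$ on $U$, the projected connection on which is $D$. -/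

import Mathlib

open Bundle Set
open scoped Manifold ContDiff Topology

universe u v w

noncomputable section

namespace RiemannExtension

/-- The model space of `n`-dimensional manifolds. -/
abbrev Eucl (n : ℕ) : Type := EuclideanSpace ℝ (Fin n)

/-- The cotangent space `T_y^*S`. -/
abbrev Cotangent (r : ℕ) {S : Type v} [TopologicalSpace S] [ChartedSpace (Eucl r) S] (y : S) :
    Type :=
  TangentSpace (𝓡 r) y →L[ℝ] ℝ

/-- The total space of the cotangent bundle `T^*S` (with the smooth structure of the bundle of
continuous linear maps from the tangent bundle to the trivial line bundle). -/
abbrev CotangentBundle (r : ℕ) (S : Type v) [TopologicalSpace S] [ChartedSpace (Eucl r) S] :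
    Type v :=
  TotalSpace (Eucl r →L[ℝ] ℝ) (fun y : S ↦ TangentSpace (𝓡 r) y →L[ℝ] ℝ)

section Metrics

variable (n : ℕ) (M : Type u) [TopologicalSpace M] [ChartedSpace (Eucl n) M]
  [IsManifold (𝓡 n) ∞ M]

/-- A (smooth) pseudo-Riemannian metric, of any signature. -/
structure PseudoRiemannianMetric where
  form : ∀ x : M, TangentSpace (𝓡 n) x →L[ℝ] TangentSpace (𝓡 n) x →L[ℝ] ℝ
  symm : ∀ x v w, form x v w = form x w v
  nondegenerate : ∀ x v, (∀ w, form x v w = 0) → v = 0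
  smooth : ContMDiff (𝓡 n) ((𝓡 n).prod 𝓘(ℝ, Eucl n →L[ℝ] Eucl n →L[ℝ] ℝ)) ∞
    (fun x ↦ TotalSpace.mk' (Eucl n →L[ℝ] Eucl n →L[ℝ] ℝ)
      (E := fun x : M ↦ TangentSpace (𝓡 n) x →L[ℝ] TangentSpace (𝓡 n) x →L[ℝ] ℝ) x (form x))

/-- Connections in the tangent bundle. For a connection `D`, the value `(D_u w)_x` is
`D w x u`. -/
abbrev Connection :=
  CovariantDerivative (𝓡 n) (Eucl n) (fun x : M ↦ TangentSpace (𝓡 n) x)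

end Metrics

section Basic

variable {n : ℕ} {M : Type u} [TopologicalSpace M] [ChartedSpace (Eucl n) M]
  [IsManifold (𝓡 n) ∞ M]

/-- The vector field `w` is smooth on `U`. -/
def SmoothFieldOn (U : Set M) (w : ∀ x : M, TangentSpace (𝓡 n) x) : Prop :=
  ContMDiffOn (𝓡 n) (𝓡 n).tangent ∞ (fun x ↦ (⟨x, w x⟩ : TangentBundle (𝓡 n) M)) U

/-- `V` is a smooth distribution of dimension `k`: near every point it is spanned by `k` smooth
linearly independent vector fields. -/
def IsDistribution (k : ℕ) (V : ∀ x : M, Submodule ℝ (TangentSpace (𝓡 n) x)) : Prop :=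
  ∀ x : M, ∃ U : Set M, IsOpen U ∧ x ∈ U ∧
    ∃ e : Fin k → ∀ x : M, TangentSpace (𝓡 n) x, (∀ i, SmoothFieldOn U (e i)) ∧
      ∀ y ∈ U, LinearIndependent ℝ (fun i ↦ e i y) ∧
        Submodule.span ℝ (Set.range fun i ↦ e i y) = V y

/-- A smooth torsion-free connection in the tangent bundle. -/
structure IsTorsionFreeConnection (D : Connection n M) : Prop where
  smooth : D.ContMDiffCovariantDerivative ∞
  torsion_free : D.torsion = 0

/-- `D` is the Levi-Civita connection of `g`: it is torsion-free and `g` is `D`-parallel. -/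
structure IsLeviCivita (g : PseudoRiemannianMetric n M) (D : Connection n M) : Prop where
  torsion_free : D.torsion = 0
  metric : ∀ (x : M) (X Y : ∀ x : M, TangentSpace (𝓡 n) x) (u : TangentSpace (𝓡 n) x),
    MDifferentiableAt (𝓡 n) (𝓡 n).tangent (fun y ↦ (⟨y, X y⟩ : TangentBundle (𝓡 n) M)) x →
    MDifferentiableAt (𝓡 n) (𝓡 n).tangent (fun y ↦ (⟨y, Y y⟩ : TangentBundle (𝓡 n) M)) x →
    mvfderiv (𝓡 n) (fun y ↦ g.form y (X y) (Y y)) x u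
      = g.form x (D X x u) (Y x) + g.form x (X x) (D Y x u)

/-- `V` is `g`-null: `g` vanishes on `V`. -/
def IsNull (g : PseudoRiemannianMetric n M)
    (V : ∀ x : M, Submodule ℝ (TangentSpace (𝓡 n) x)) : Prop :=
  ∀ x, ∀ v ∈ V x, ∀ w ∈ V x, g.form x v w = 0

/-- `V` is `D`-parallel: covariant derivatives, in all directions, of local sections of `V` are
again sections of `V`. -/
def IsParallel (D : Connection n M) (V : ∀ x : M, Submodule ℝ (TangentSpace (𝓡 n) x)) : Prop :=
  ∀ (U : Set M) (w : ∀ x : M, TangentSpace (𝓡 n) x), IsOpen U → SmoothFieldOn U w →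
    (∀ x ∈ U, w x ∈ V x) → ∀ x ∈ U, ∀ u : TangentSpace (𝓡 n) x, D w x u ∈ V x

/-- The covariant derivative `D_v w`. -/
def covDeriv (D : Connection n M) (v w : ∀ x : M, TangentSpace (𝓡 n) x) :
    ∀ x : M, TangentSpace (𝓡 n) x :=
  fun x ↦ D w x (v x)

end Basic

section Leaves

variable {n q : ℕ} {M : Type u} [TopologicalSpace M] [ChartedSpace (Eucl n) M]
  {S : Type v} [TopologicalSpace S] [ChartedSpace (Eucl q) S]

/-- The restriction of `pr` to the open set `U` is a bundle projection `U → S`, that is, a smooth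
surjection which is locally trivial in the smooth category. -/
structure IsBundleProjectionOn (U : Set M) (pr : M → S) : Prop where
  isOpen : IsOpen U
  surj : pr '' U = univ
  smooth : ContMDiffOn (𝓡 n) (𝓡 q) ∞ pr U
  locally_trivial : ∀ y : S, ∃ W : Set S, IsOpen W ∧ y ∈ W ∧
    ∃ (k : ℕ) (F : Type) (_ : TopologicalSpace F) (_ : ChartedSpace (Eucl k) F)
      (_ : IsManifold (𝓡 k) ∞ F) (Φ : OpenPartialHomeomorph M (S × F)),
      Φ.source = U ∩ pr ⁻¹' W ∧ Φ.target = W ×ˢ univ ∧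
      ContMDiffOn (𝓡 n) ((𝓡 q).prod (𝓡 k)) ∞ Φ Φ.source ∧
      ContMDiffOn ((𝓡 q).prod (𝓡 k)) (𝓡 n) ∞ Φ.symm Φ.target ∧
      ∀ x ∈ Φ.source, (Φ x).1 = pr x

/-- The leaves of `V` restricted to the open set `U` are the fibres of the bundle projection
`pr : U → S`, so that `S` is a local leaf space of `V`: the fibres are connected and tangent
to `V`. -/
structure IsLeafFibration (V : ∀ x : M, Submodule ℝ (TangentSpace (𝓡 n) x)) (U : Set M)
    (pr : M → S) : Prop where
  bundle : IsBundleProjectionOn (n := n) (q := q) U pr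
  ker_eq : ∀ x ∈ U, LinearMap.ker (mfderiv (𝓡 n) (𝓡 q) pr x).toLinearMap = V x
  fibre_connected : ∀ y : S, IsConnected (U ∩ pr ⁻¹' {y})

/-- On `U`, the vector field `w` is `pr`-projectable onto the vector field `w'` on `S`. -/
def ProjectsTo (U : Set M) (pr : M → S) (w : ∀ x : M, TangentSpace (𝓡 n) x)
    (w' : ∀ y : S, TangentSpace (𝓡 q) y) : Prop :=
  ∀ x ∈ U, mfderiv (𝓡 n) (𝓡 q) pr x (w x) = w' (pr x)

end Leaves

section Projectability

variable {n : ℕ} {M : Type u} [TopologicalSpace M] [ChartedSpace (Eucl n) M]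

/-- `V`-projectability of a vector field `w` on the open set `U'`, where `V` is a distribution of
codimension `q`: for every bundle projection `pr : U → S` onto a (`q`-dimensional) manifold, with
`U ⊆ U'`, having the leaves of `V` restricted to `U` as its fibres, `w` is `pr`-projectable onto
some vector field on `S`. (The leaf spaces `S` are taken in a universe `v`. Manifolds being second
countable, each of them has a diffeomorphic copy in every universe, so that the choice of `v` does
not matter.) -/
def IsProjectableField (q : ℕ) (V : ∀ x : M, Submodule ℝ (TangentSpace (𝓡 n) x)) (U' : Set M)
    (w : ∀ x : M, TangentSpace (𝓡 n) x) : Prop :=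
  ∀ (S : Type v) [TopologicalSpace S] [ChartedSpace (Eucl q) S] [IsManifold (𝓡 q) ∞ S]
    [T2Space S] [SecondCountableTopology S] [ConnectedSpace S] (U : Set M) (pr : M → S),
    U ⊆ U' → IsLeafFibration (q := q) V U pr →
      ∃ w' : ∀ y : S, TangentSpace (𝓡 q) y, SmoothFieldOn univ w' ∧ ProjectsTo U pr w w'

variable [IsManifold (𝓡 n) ∞ M]

/-- Projectability of a connection along a distribution `V` of codimension `q`: for `V`-projectable
vector fields `v, w` on an open set, `D_v w` is `V`-projectable as well. -/
def IsProjectable (q : ℕ) (D : Connection n M)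
    (V : ∀ x : M, Submodule ℝ (TangentSpace (𝓡 n) x)) : Prop :=
  ∀ (U' : Set M) (v w : ∀ x : M, TangentSpace (𝓡 n) x), IsOpen U' →
    SmoothFieldOn U' v → SmoothFieldOn U' w →
    IsProjectableField.{u, v} q V U' v → IsProjectableField.{u, v} q V U' w →
      IsProjectableField.{u, v} q V U' (covDeriv D v w)

/-- `S` is, via `pr : U → S`, a local leaf space of `V`, and `D'` is the connection on `S` obtained
by projecting `D`: the covariant derivative `D_v w` of `pr`-projectable vector fields projects onto
the `D'`-covariant derivative of their projections. -/
structure IsProjectedConnection {q : ℕ} {S : Type v} [TopologicalSpace S]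
    [ChartedSpace (Eucl q) S] [IsManifold (𝓡 q) ∞ S] (D : Connection n M)
    (V : ∀ x : M, Submodule ℝ (TangentSpace (𝓡 n) x)) (U : Set M) (pr : M → S)
    (D' : Connection q S) : Prop where
  leafSpace : IsLeafFibration (q := q) V U pr
  projects : ∀ (v w : ∀ x : M, TangentSpace (𝓡 n) x) (v' w' : ∀ y : S, TangentSpace (𝓡 q) y),
    SmoothFieldOn U v → SmoothFieldOn U w → SmoothFieldOn univ v' → SmoothFieldOn univ w' →
    ProjectsTo U pr v v' → ProjectsTo U pr w w' →
      ProjectsTo U pr (covDeriv D v w) (covDeriv D' v' w')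

end Projectability

section Affine

/-- A cotangent affine bundle over an `r`-dimensional manifold `S`, with total space `N`: each
fibre is an affine space with the translation space `T_y^*S`, and, locally, the choice of a
suitable section as the origin identifies `N` with `T^*S` diffeomorphically. -/
structure CotangentAffineBundle (r : ℕ) (S : Type v) [TopologicalSpace S] [ChartedSpace (Eucl r) S]
    [IsManifold (𝓡 r) ∞ S] (N : Type w) [TopologicalSpace N] [ChartedSpace (Eucl (2 * r)) N] where
  proj : N → S
  affine : ∀ y : S, AddTorsor (Cotangent r y) (proj ⁻¹' {y})
  locally_trivial : ∀ y₀ : S, ∃ W : Set S, IsOpen W ∧ y₀ ∈ W ∧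
    ∃ o : ∀ y : S, (proj ⁻¹' {y} : Set N),
      ContMDiffOn ((𝓡 r).prod 𝓘(ℝ, Eucl r →L[ℝ] ℝ)) (𝓡 (2 * r)) ∞
        (fun p : CotangentBundle r S ↦ (((p.2 : Cotangent r p.1) +ᵥ o p.1 : _) : N))
        (TotalSpace.proj ⁻¹' W) ∧
      ContMDiffOn (𝓡 (2 * r)) ((𝓡 r).prod 𝓘(ℝ, Eucl r →L[ℝ] ℝ)) ∞
        (fun x : N ↦ (⟨proj x, ((⟨x, rfl⟩ : proj ⁻¹' {proj x}) -ᵥ o (proj x) :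
          Cotangent r (proj x))⟩ : CotangentBundle r S))
        (proj ⁻¹' W)

attribute [instance] CotangentAffineBundle.affine

variable {r : ℕ} {S : Type v} [TopologicalSpace S] [ChartedSpace (Eucl r) S]
  [IsManifold (𝓡 r) ∞ S]

/-- The `1`-form `θ` is smooth. -/
def SmoothForm (θ : ∀ y : S, Cotangent r y) : Prop :=
  ContMDiff (𝓡 r) ((𝓡 r).prod 𝓘(ℝ, Eucl r →L[ℝ] ℝ)) ∞
    (fun y ↦ (⟨y, θ y⟩ : CotangentBundle r S))

/-- The covariant derivative of a `1`-form, `(D_u θ)(w) = d_u[θ(w)] - θ(D_u w)`, where the vector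
`w` at `y` is extended to a vector field near `y`. By `covDerivForm_apply`, the choice of the
extension is immaterial. -/
def covDerivForm (D : Connection r S) (θ : ∀ y : S, Cotangent r y) (y : S)
    (u w : TangentSpace (𝓡 r) y) : ℝ :=
  mvfderiv (𝓡 r) (fun z ↦ θ z (FiberBundle.extend (Eucl r) w z)) y u
    - θ y (D (FiberBundle.extend (Eucl r) w) y u)

theorem covDerivForm_apply (D : Connection r S) (θ : ∀ y : S, Cotangent r y) (hθ : SmoothForm θ)
    (y : S) (u : TangentSpace (𝓡 r) y) (W : ∀ y : S, TangentSpace (𝓡 r) y)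
    (hW : MDifferentiableAt (𝓡 r) (𝓡 r).tangent
      (fun z ↦ (⟨z, W z⟩ : TangentBundle (𝓡 r) S)) y) :
    covDerivForm D θ y u (W y) = mvfderiv (𝓡 r) (fun z ↦ θ z (W z)) y u - θ y (D W y u) := by
  have hdiff : ∀ {X : ∀ z : S, TangentSpace (𝓡 r) z},
      MDifferentiableAt (𝓡 r) (𝓡 r).tangent
        (fun z ↦ (⟨z, X z⟩ : TangentBundle (𝓡 r) S)) y →
      MDifferentiableAt (𝓡 r) 𝓘(ℝ, ℝ) (fun z ↦ θ z (X z)) y := by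
    intro X hX
    have h1 : MDifferentiableAt (𝓡 r) ((𝓡 r).prod 𝓘(ℝ, Eucl r →L[ℝ] ℝ))
        (fun z ↦ TotalSpace.mk' (Eucl r →L[ℝ] ℝ)
          (E := fun z : S ↦ TangentSpace (𝓡 r) z →L[ℝ] Bundle.Trivial S ℝ z) z (θ z)) y :=
      (hθ y).mdifferentiableAt (by simp)
    have h2 := h1.clm_bundle_apply (F₁ := Eucl r) (F₂ := ℝ) (v := X) hX
    rw [mdifferentiableAt_totalSpace] at h2
    exact h2.2
  have hT : TensorialAt (𝓡 r) (Eucl r)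
      (fun X : (∀ z : S, TangentSpace (𝓡 r) z) ↦
        mvfderiv (𝓡 r) (fun z ↦ θ z (X z)) y u - θ y (D X y u)) y :=
    { smul := by
        intro f X hf hX
        have h : (fun z ↦ θ z ((f • X) z)) = fun z ↦ f z * θ z (X z) := by
          funext z; simp
        rw [h, mvfderiv_fun_mul hf (hdiff hX), D.isCovariantDerivativeOn.leibniz hX hf]
        simp
        ring
      add := by
        intro X Y hX hY
        have h : (fun z ↦ θ z ((X + Y) z)) = fun z ↦ θ z (X z) + θ z (Y z) := by
          funext z; simp
        rw [h, mvfderiv_fun_add (hdiff hX) (hdiff hY), D.isCovariantDerivativeOn.add hX hY]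
        simp
        ring }
  exact hT.pointwise (FiberBundle.mdifferentiableAt_extend (𝓡 r) (Eucl r) (W y)) hW (by simp)

/-- The Killing operator `θ ↦ Dθ + (Dθ)^*`. -/
def killing (D : Connection r S) (θ : ∀ y : S, Cotangent r y) (y : S)
    (u w : TangentSpace (𝓡 r) y) : ℝ :=
  covDerivForm D θ y u w + covDerivForm D θ y w u

variable {N : Type w} [TopologicalSpace N] [ChartedSpace (Eucl (2 * r)) N]

namespace CotangentAffineBundle

variable (B : CotangentAffineBundle r S N)

/-- The translation of the point `x` by the covector `ξ ∈ T_y^*S`, `y = pr(x)`. -/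
def translate (x : N) (ξ : Cotangent r (B.proj x)) : N :=
  ((ξ +ᵥ (⟨x, rfl⟩ : B.proj ⁻¹' {B.proj x}) : B.proj ⁻¹' {B.proj x}) : N)

/-- The fibre-preserving diffeomorphism `N → N` given by a `1`-form on the base, acting in each
fibre as a translation. -/
def shift (θ : ∀ y : S, Cotangent r y) (x : N) : N :=
  B.translate x (θ (B.proj x))

/-- The vertical distribution of the bundle projection. -/
def vertical (x : N) : Submodule ℝ (TangentSpace (𝓡 (2 * r)) x) :=
  LinearMap.ker (mfderiv (𝓡 (2 * r)) (𝓡 r) B.proj x).toLinearMap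

/-- The identification of `T_y^*S` with the vertical space at `x`, where `y = pr(x)`: the covector
`ξ` is the velocity of the curve `t ↦ x + tξ` in the fibre through `x`. -/
def verticalVector (x : N) (ξ : Cotangent r (B.proj x)) : TangentSpace (𝓡 (2 * r)) x :=
  mfderiv 𝓘(ℝ, ℝ) (𝓡 (2 * r)) (fun t : ℝ ↦ B.translate x (t • ξ)) 0 (1 : ℝ)

variable [IsManifold (𝓡 (2 * r)) ∞ N]

/-- Standard-type metrics: `g(ξ, w) = ξ(dpr w)` for vertical vectors `ξ` and all vectors `w`. -/
def IsStandardType (g : PseudoRiemannianMetric (2 * r) N) : Prop :=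
  ∀ (x : N) (ξ : Cotangent r (B.proj x)) (w : TangentSpace (𝓡 (2 * r)) x),
    g.form x (B.verticalVector x ξ) w = ξ (mfderiv (𝓡 (2 * r)) (𝓡 r) B.proj x w)

/-- Riemann extension metrics for a torsion-free connection `D` on the base: the standard-type
metrics `g` such that the pullback of `g` under the shift by any `1`-form `θ` on the base equals
`g` plus the pullback, under the bundle projection, of the Killing operator applied to `θ`. -/
structure IsRiemannExtension (D : Connection r S) (g : PseudoRiemannianMetric (2 * r) N) :
    Prop where
  standard : B.IsStandardType g
  shift_rule : ∀ θ : (∀ y : S, Cotangent r y), SmoothForm θ →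
    ∀ (x : N) (v w : TangentSpace (𝓡 (2 * r)) x),
      g.form (B.shift θ x) (mfderiv (𝓡 (2 * r)) (𝓡 (2 * r)) (B.shift θ) x v)
          (mfderiv (𝓡 (2 * r)) (𝓡 (2 * r)) (B.shift θ) x w)
        = g.form x v w
          + killing D θ (B.proj x) (mfderiv (𝓡 (2 * r)) (𝓡 r) B.proj x v)
              (mfderiv (𝓡 (2 * r)) (𝓡 r) B.proj x w)

end CotangentAffineBundle

end Affine

end RiemannExtension

end

open RiemannExtension

/-!
# Riemann extension metrics and projectable Levi-Civita connections

Both parts are proved in coordinates `(q, p)` with values in `F × F*`, where the leaves of the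
distribution are the sets `q = const` and `g(∂_p, ·) = dq`. In such coordinates, the Koszul formula
for `g(D_a ∂_b, ∂_p)` has just one nonzero term, the derivative of `g(∂_a, ∂_b)` in the direction of
`∂_p`. So, when this derivative is `-2Γ(q)`, for a function `Γ` of `q` alone, the `q`-component of the
Levi-Civita connection is the connection with the Christoffel symbols `Γ(q)`
(`IsLeviCivita.fst_coord_eq`). A chart with these properties is called adapted (`IsAdaptedChart`). If
there are adapted charts near all points, then the distribution is null and parallel, the Levi-Civita
connection is projectable, and its projection onto a leaf space has the Christoffel symbols `Γ`.

For a Riemann extension metric, the bundle charts of the cotangent affine bundle are adapted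
(`CotangentAffineBundle.IsRiemannExtension.exists_isAdaptedChart`): the identity `g(∂_p, ·) = dq` is
part of the definition, and the rule for the translation by a form with constant coefficients `η`
says that `g(∂_a, ∂_b)` is shifted by `-2η(Γ(a, b))` when `p` is shifted by `η`. This proves the first
part.

In the second part, a parallel distribution is involutive, as the connection is torsion-free, so
that there are coordinates `(q, s)` whose level sets `q = const` are the leaves
(`IsDistribution.exists_flat_chart`). The underlying Frobenius theorem is proved for total
differential equations `∂y/∂s = A(y, s)` (`exists_totalDifferential`): the equation is solved along
rays, where the implicit function theorem in a space of continuous functions gives smooth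
dependence on the initial value and on the ray. Projectability, applied to the product of `∂_s` with
functions which are not constant on the leaves, shows that `D_{∂_s} ∂_q` is tangent to the leaves
(`IsProjectable.covDeriv_coordField_mem`). By the Koszul formula, the forms `g(∂_s, ∂_q) ds` on the
leaves are therefore closed (`IsLeviCivita.mixedCoeff_closed`), and replacing `s` by a potential `p`
of these forms leads to coordinates with `g(∂_p, ·) = dq` (`IsLeviCivita.exists_standard_chart`).
Projectability, applied to `∂_q`, provides Christoffel symbols `Γ(q)` on the leaf space, so that the
chart is adapted (`IsLeviCivita.exists_leaf_christoffel`), and integration along the leaves yields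
`g = 2 dp dq + (h₀(q) - 2p(Γ(q))) dq dq` (`IsAdaptedChart.exists_metric_eq`). This is a Riemann
extension metric on the cotangent bundle of `ℝ^r` for the connection with the Christoffel symbols `Γ`
(`isRiemannExtension_modelMetric`).
-/


noncomputable section

namespace RiemannExtension

/-! ### Derivatives of vector-valued functions -/

section VectorValued

variable {n : ℕ} {M : Type u} [TopologicalSpace M] [ChartedSpace (Eucl n) M]
  {k : ℕ} {M' : Type v} [TopologicalSpace M'] [ChartedSpace (Eucl k) M']
  {E : Type*} [NormedAddCommGroup E] [NormedSpace ℝ E]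
  {E' : Type*} [NormedAddCommGroup E'] [NormedSpace ℝ E']

theorem mvfderiv_comp_mfderiv {f : M → M'} {h : M' → E} {x : M}
    (hh : MDifferentiableAt (𝓡 k) 𝓘(ℝ, E) h (f x))
    (hf : MDifferentiableAt (𝓡 n) (𝓡 k) f x) (v : TangentSpace (𝓡 n) x) :
    mvfderiv (𝓡 n) (fun y ↦ h (f y)) x v = mvfderiv (𝓡 k) h (f x) (mfderiv (𝓡 n) (𝓡 k) f x v) :=
  mfderiv_comp_apply x hh hf v

theorem mvfderiv_fderiv_comp {f : M → E} {h : E → E'} {x : M}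
    (hh : DifferentiableAt ℝ h (f x))
    (hf : MDifferentiableAt (𝓡 n) 𝓘(ℝ, E) f x) (v : TangentSpace (𝓡 n) x) :
    mvfderiv (𝓡 n) (fun y ↦ h (f y)) x v = fderiv ℝ h (f x) (mvfderiv (𝓡 n) f x v) := by
  have := mfderiv_comp_apply x hh.mdifferentiableAt hf v
  rw [mfderiv_eq_fderiv] at this
  exact this

theorem mvfderiv_congr_of_eventuallyEq {f h : M → E} {x : M} (hfh : f =ᶠ[𝓝 x] h) :
    mvfderiv (𝓡 n) f x = mvfderiv (𝓡 n) h x := by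
  ext v
  have := hfh.mfderiv_eq (I := 𝓡 n) (I' := 𝓘(ℝ, E))
  have h2 : mfderiv (𝓡 n) 𝓘(ℝ, E) f x v = mfderiv (𝓡 n) 𝓘(ℝ, E) h x v := by rw [this]; rfl
  exact h2

variable [IsManifold (𝓡 n) ∞ M]

/-- The derivative of a smooth vector-valued function along a vector field. -/
theorem contMDiffOn_mvfderiv_apply {U : Set M} (hU : IsOpen U) {f : M → E}
    (hf : ContMDiffOn (𝓡 n) 𝓘(ℝ, E) ∞ f U) {w : ∀ x : M, TangentSpace (𝓡 n) x}
    (hw : SmoothFieldOn U w) :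
    ContMDiffOn (𝓡 n) 𝓘(ℝ, E) ∞ (fun y ↦ mvfderiv (𝓡 n) f y (w y)) U := by
  have h1 := hf.contMDiffOn_tangentMapWithin (m := ∞) (by simp) hU.uniqueMDiffOn
  have h2 := h1.comp hw (fun x hx ↦ hx)
  have h3 := (contMDiff_snd_tangentBundle_modelSpace (n := ∞) E 𝓘(ℝ, E)).comp_contMDiffOn h2
  refine h3.congr fun y hy ↦ ?_
  simp only [Function.comp, tangentMapWithin, mfderivWithin_of_isOpen hU hy]
  rfl

theorem mdifferentiableAt_mvfderiv_apply {U : Set M} (hU : IsOpen U) {f : M → E}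
    (hf : ContMDiffOn (𝓡 n) 𝓘(ℝ, E) ∞ f U) {w : ∀ x : M, TangentSpace (𝓡 n) x} {x : M}
    (hx : x ∈ U) (hw : MDifferentiableAt (𝓡 n) (𝓡 n).tangent
      (fun y ↦ (⟨y, w y⟩ : TangentBundle (𝓡 n) M)) x) :
    MDifferentiableAt (𝓡 n) 𝓘(ℝ, E) (fun y ↦ mvfderiv (𝓡 n) f y (w y)) x := by
  have h1 := hf.contMDiffOn_tangentMapWithin (m := ∞) (by simp) hU.uniqueMDiffOn
  have h2 : MDifferentiableAt (𝓡 n) 𝓘(ℝ, E).tangent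
      (fun y ↦ tangentMapWithin (𝓡 n) 𝓘(ℝ, E) f U (⟨y, w y⟩ : TangentBundle (𝓡 n) M)) x := by
    have h3 := (h1 ⟨x, w x⟩ hx).contMDiffAt
      ((hU.preimage (FiberBundle.continuous_proj (Eucl n) (TangentSpace (𝓡 n)))).mem_nhds hx)
    exact (h3.mdifferentiableAt (by simp)).comp x hw
  have h4 := (contMDiff_snd_tangentBundle_modelSpace (n := ∞) E 𝓘(ℝ, E)).contMDiffAt.mdifferentiableAt
    (by simp) |>.comp x h2
  refine h4.congr_of_eventuallyEq ?_
  filter_upwards [hU.mem_nhds hx] with y hy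
  simp only [Function.comp, tangentMapWithin, mfderivWithin_of_isOpen hU hy]
  rfl

end VectorValued

/-! ### Smooth charts and coordinate fields -/

section Charts

variable {n : ℕ} {M : Type u} [TopologicalSpace M] [ChartedSpace (Eucl n) M]
  {E : Type*} [NormedAddCommGroup E] [NormedSpace ℝ E]

/-- A smooth chart with values in a normed space: a partial homeomorphism which is smooth together
with its inverse. -/
structure IsSmoothChart (φ : OpenPartialHomeomorph M E) : Prop where
  smooth : ContMDiffOn (𝓡 n) 𝓘(ℝ, E) ∞ φ φ.source
  smooth_symm : ContMDiffOn 𝓘(ℝ, E) (𝓡 n) ∞ φ.symm φ.target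

/-- The vector field which the chart `φ` maps to the constant vector field `a`. -/
def coordField (φ : OpenPartialHomeomorph M E) (a : E) : ∀ x : M, TangentSpace (𝓡 n) x :=
  VectorField.mpullback (𝓡 n) 𝓘(ℝ, E) φ (fun _ ↦ a)

namespace IsSmoothChart

variable {φ : OpenPartialHomeomorph M E} (hφ : IsSmoothChart (n := n) φ) {x : M}
include hφ

theorem contMDiffAt (hx : x ∈ φ.source) : ContMDiffAt (𝓡 n) 𝓘(ℝ, E) ∞ φ x :=
  hφ.smooth.contMDiffAt (φ.open_source.mem_nhds hx)

theorem mdifferentiableAt (hx : x ∈ φ.source) : MDifferentiableAt (𝓡 n) 𝓘(ℝ, E) φ x :=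
  (hφ.contMDiffAt hx).mdifferentiableAt (by simp)

theorem contMDiffAt_symm {z : E} (hz : z ∈ φ.target) : ContMDiffAt 𝓘(ℝ, E) (𝓡 n) ∞ φ.symm z :=
  hφ.smooth_symm.contMDiffAt (φ.open_target.mem_nhds hz)

theorem mdifferentiableAt_symm {z : E} (hz : z ∈ φ.target) :
    MDifferentiableAt 𝓘(ℝ, E) (𝓡 n) φ.symm z :=
  (hφ.contMDiffAt_symm hz).mdifferentiableAt (by simp)

theorem mfderiv_symm_mfderiv (hx : x ∈ φ.source) (v : TangentSpace (𝓡 n) x) :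
    (mfderiv 𝓘(ℝ, E) (𝓡 n) φ.symm (φ x) (mfderiv (𝓡 n) 𝓘(ℝ, E) φ x v) : Eucl n) = v := by
  have h1 := hφ.mdifferentiableAt hx
  have h2 := hφ.mdifferentiableAt_symm (φ.map_source hx)
  have h3 := mfderiv_comp_apply x h2 h1 v
  have h4 : (φ.symm ∘ φ) =ᶠ[𝓝 x] id := by
    filter_upwards [φ.open_source.mem_nhds hx] with y hy using φ.left_inv hy
  have h5 := (hasMFDerivAt_id (I := 𝓡 n) x).congr_of_eventuallyEq h4
  have h6 : mfderiv (𝓡 n) (𝓡 n) (φ.symm ∘ φ) x v = v := by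
    rw [h5.mfderiv]; rfl
  exact h3.symm.trans h6

theorem mfderiv_mfderiv_symm {z : E} (hz : z ∈ φ.target) (a : E) :
    (mfderiv (𝓡 n) 𝓘(ℝ, E) φ (φ.symm z) (mfderiv 𝓘(ℝ, E) (𝓡 n) φ.symm z a) : E) = a := by
  have h2 := hφ.mdifferentiableAt_symm hz
  have h1 := hφ.mdifferentiableAt (φ.map_target hz)
  have h3 := mfderiv_comp_apply z h1 h2 a
  have h4 : (φ ∘ φ.symm) =ᶠ[𝓝 z] id := by
    filter_upwards [φ.open_target.mem_nhds hz] with y hy using φ.right_inv hy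
  have h5 := (hasMFDerivAt_id (I := 𝓘(ℝ, E)) z).congr_of_eventuallyEq h4
  have h6 : mfderiv 𝓘(ℝ, E) 𝓘(ℝ, E) (φ ∘ φ.symm) z a = a := by
    rw [h5.mfderiv]; rfl
  exact h3.symm.trans h6

theorem bijective (hx : x ∈ φ.source) : Function.Bijective (mvfderiv (𝓡 n) φ x) := by
  constructor
  · intro v w h
    have hv := hφ.mfderiv_symm_mfderiv hx v
    have hw := hφ.mfderiv_symm_mfderiv hx w
    have h' : mfderiv (𝓡 n) 𝓘(ℝ, E) φ x v = mfderiv (𝓡 n) 𝓘(ℝ, E) φ x w := h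
    rw [h'] at hv
    exact hv.symm.trans hw
  · intro a
    have := hφ.mfderiv_mfderiv_symm (φ.map_source hx) a
    rw [φ.left_inv hx] at this
    exact ⟨_, this⟩

theorem isInvertible [FiniteDimensional ℝ E] (hx : x ∈ φ.source) :
    (mfderiv (𝓡 n) 𝓘(ℝ, E) φ x).IsInvertible := by
  let e : Eucl n ≃ₗ[ℝ] E := LinearEquiv.ofBijective
    (mvfderiv (𝓡 n) φ x).toLinearMap (hφ.bijective hx)
  exact ⟨e.toContinuousLinearEquiv, by ext v; rfl⟩

variable [FiniteDimensional ℝ E]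

theorem mvfderiv_coordField (hx : x ∈ φ.source) (a : E) :
    mvfderiv (𝓡 n) φ x (coordField φ a x) = a := by
  have := (hφ.isInvertible hx).self_apply_inverse a
  exact this

theorem coordField_mvfderiv (hx : x ∈ φ.source) (v : TangentSpace (𝓡 n) x) :
    coordField φ (mvfderiv (𝓡 n) φ x v) x = v :=
  (hφ.bijective hx).1 (hφ.mvfderiv_coordField hx _)

variable [IsManifold (𝓡 n) ∞ M]

/-- The vector field which is the function `f` in the chart `φ` is smooth if `f` is. -/
theorem smoothFieldOn_of_coord {U : Set M} (hU : IsOpen U) (hUs : U ⊆ φ.source) {f : M → E}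
    (hf : ContMDiffOn (𝓡 n) 𝓘(ℝ, E) ∞ f U) : SmoothFieldOn U (fun x ↦ coordField (n := n) φ (f x) x) := by
  intro x hx
  have hxs := hUs hx
  have h1 : ContDiffAt ℝ ∞ (fun z ↦ f (φ.symm z)) (φ x) := by
    have h2 : ContMDiffAt (𝓡 n) 𝓘(ℝ, E) ∞ f (φ.symm (φ x)) := by
      rw [φ.left_inv hxs]; exact hf.contMDiffAt (hU.mem_nhds hx)
    exact (h2.comp (φ x) (hφ.contMDiffAt_symm (φ.map_source hxs))).contDiffAt
  have h3 := contMDiffAt_vectorSpace_iff_contDiffAt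
    (V := fun z ↦ (f (φ.symm z) : TangentSpace 𝓘(ℝ, E) z)).2 h1
  have h4 := ContMDiffAt.mpullback_vectorField_preimage (m := ∞) h3 (hφ.contMDiffAt hxs)
    (hφ.isInvertible hxs) (by simp)
  refine (h4.congr_of_eventuallyEq ?_).contMDiffWithinAt
  filter_upwards [φ.open_source.mem_nhds hxs] with y hy
  simp only [coordField, VectorField.mpullback, φ.left_inv hy]

theorem smoothFieldOn_coordField (a : E) : SmoothFieldOn φ.source (coordField (n := n) φ a) :=
  hφ.smoothFieldOn_of_coord φ.open_source subset_rfl (f := fun _ ↦ a) contMDiffOn_const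

theorem mdifferentiableAt_coordField (hx : x ∈ φ.source) (a : E) :
    MDifferentiableAt (𝓡 n) (𝓡 n).tangent
      (fun y ↦ (⟨y, coordField φ a y⟩ : TangentBundle (𝓡 n) M)) x :=
  ((hφ.smoothFieldOn_coordField a).contMDiffAt (φ.open_source.mem_nhds hx)).mdifferentiableAt
    (by simp)

omit [FiniteDimensional ℝ E] in
/-- Coordinate vector fields commute. -/
theorem mlieBracket_coordField (hx : x ∈ φ.source) (a b : E) :
    VectorField.mlieBracket (𝓡 n) (coordField φ a) (coordField φ b) x = 0 := by
  have hc : ∀ c : E, MDifferentiableAt 𝓘(ℝ, E) 𝓘(ℝ, E).tangent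
      (fun z ↦ (⟨z, c⟩ : TangentBundle 𝓘(ℝ, E) E)) (φ x) := fun c ↦
    (contMDiffAt_vectorSpace_iff_contDiffAt (n := ∞)
      (V := fun z ↦ (c : TangentSpace 𝓘(ℝ, E) z)).2 contDiffAt_const).mdifferentiableAt (by simp)
  have : IsManifold (𝓡 n) (minSmoothness ℝ 3) M := by
    rw [minSmoothness_of_isRCLikeNormedField]; infer_instance
  have h := VectorField.mpullback_mlieBracket (I := 𝓡 n) (f := φ) (x₀ := x) (n := ∞)
    (V := fun z : E ↦ (a : TangentSpace 𝓘(ℝ, E) z)) (W := fun z : E ↦ (b : TangentSpace 𝓘(ℝ, E) z))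
    (hc a) (hc b) (hφ.contMDiffAt hx) (by
      rw [minSmoothness_of_isRCLikeNormedField]
      exact ENat.LEInfty.out)
  refine h.symm.trans ?_
  have hvs : ∀ V W : (∀ z : E, TangentSpace 𝓘(ℝ, E) z),
      VectorField.mlieBracket 𝓘(ℝ, E) V W = VectorField.lieBracket ℝ V W := fun V W ↦ by
    rw [← VectorField.mlieBracketWithin_univ, VectorField.mlieBracketWithin_eq_lieBracketWithin]
    exact VectorField.lieBracketWithin_univ
  have hlie : VectorField.lieBracket ℝ (fun _ : E ↦ a) (fun _ ↦ b) = 0 := by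
    ext z
    simp [VectorField.lieBracket]
  have h0 := congrArg (fun Z : (∀ z : E, TangentSpace 𝓘(ℝ, E) z) ↦
    VectorField.mpullback (𝓡 n) 𝓘(ℝ, E) φ Z x) ((hvs (fun _ ↦ a) (fun _ ↦ b)).trans hlie)
  exact h0.trans (congrFun (VectorField.mpullback_zero (I := 𝓡 n) (I' := 𝓘(ℝ, E)) (f := φ)) x)

end IsSmoothChart

end Charts

/-! ### Connections in coordinates -/

section LocalConnection

variable {n : ℕ} {M : Type u} [TopologicalSpace M] [ChartedSpace (Eucl n) M]
  [IsManifold (𝓡 n) ∞ M]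

theorem mdifferentiableAt_metric (g : PseudoRiemannianMetric n M) {x : M}
    {X Y : ∀ x : M, TangentSpace (𝓡 n) x}
    (hX : MDifferentiableAt (𝓡 n) (𝓡 n).tangent
      (fun y ↦ (⟨y, X y⟩ : TangentBundle (𝓡 n) M)) x)
    (hY : MDifferentiableAt (𝓡 n) (𝓡 n).tangent
      (fun y ↦ (⟨y, Y y⟩ : TangentBundle (𝓡 n) M)) x) :
    MDifferentiableAt (𝓡 n) 𝓘(ℝ, ℝ) (fun y ↦ g.form y (X y) (Y y)) x := by
  have h := MDifferentiableAt.clm_bundle_apply₂ (F₁ := Eucl n) (F₂ := Eucl n) (F₃ := ℝ)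
    (E₃ := fun _ : M ↦ ℝ) (ψ := g.form) ((g.smooth x).mdifferentiableAt (by simp)) hX hY
  rw [mdifferentiableAt_totalSpace] at h
  exact h.2

variable
  {E : Type*} [NormedAddCommGroup E] [NormedSpace ℝ E] [FiniteDimensional ℝ E]
  {φ : OpenPartialHomeomorph M E} (hφ : IsSmoothChart (n := n) φ) {x : M}
include hφ

omit [IsManifold (𝓡 n) ∞ M] in
theorem IsSmoothChart.coord_coordField_eventuallyEq (hx : x ∈ φ.source) (a : E) :
    (fun y ↦ mvfderiv (𝓡 n) φ y (coordField φ a y)) =ᶠ[𝓝 x] fun _ ↦ a := by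
  filter_upwards [φ.open_source.mem_nhds hx] with y hy using hφ.mvfderiv_coordField hy a

/-- The coordinate expression of a connection: `D_u w = d_u w + Γ(u, w)`, where the Christoffel
term is the covariant derivative of the constant vector field with the same value. -/
theorem Connection.coord_eq (D : Connection n M) (hx : x ∈ φ.source)
    {w : ∀ x : M, TangentSpace (𝓡 n) x} (hw : MDifferentiableAt (𝓡 n) (𝓡 n).tangent
      (fun y ↦ (⟨y, w y⟩ : TangentBundle (𝓡 n) M)) x) (u : TangentSpace (𝓡 n) x) :
    mvfderiv (𝓡 n) φ x (D w x u) =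
      mvfderiv (𝓡 n) (fun y ↦ mvfderiv (𝓡 n) φ y (w y)) x u
        + mvfderiv (𝓡 n) φ x (D (coordField φ (mvfderiv (𝓡 n) φ x (w x))) x u) := by
  have hdiff : ∀ {X : ∀ z : M, TangentSpace (𝓡 n) z},
      MDifferentiableAt (𝓡 n) (𝓡 n).tangent
        (fun z ↦ (⟨z, X z⟩ : TangentBundle (𝓡 n) M)) x →
      MDifferentiableAt (𝓡 n) 𝓘(ℝ, E) (fun z ↦ mvfderiv (𝓡 n) φ z (X z)) x :=
    fun hX ↦ mdifferentiableAt_mvfderiv_apply φ.open_source hφ.smooth hx hX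
  have hT : TensorialAt (𝓡 n) (Eucl n)
      (fun X : (∀ z : M, TangentSpace (𝓡 n) z) ↦
        mvfderiv (𝓡 n) φ x (D X x u)
          - mvfderiv (𝓡 n) (fun z ↦ mvfderiv (𝓡 n) φ z (X z)) x u) x :=
    { smul := by
        intro f X hf hX
        have h : (fun z ↦ mvfderiv (𝓡 n) φ z ((f • X) z)) =
            f • fun z ↦ mvfderiv (𝓡 n) φ z (X z) := by
          funext z; simp
        rw [h, mvfderiv_smul hf (hdiff hX), D.isCovariantDerivativeOn.leibniz hX hf]
        simp [smul_sub]
      add := by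
        intro X Y hX hY
        have h : (fun z ↦ mvfderiv (𝓡 n) φ z ((X + Y) z)) =
            (fun z ↦ mvfderiv (𝓡 n) φ z (X z)) + fun z ↦ mvfderiv (𝓡 n) φ z (Y z) := by
          funext z; simp
        rw [h, mvfderiv_add (hdiff hX) (hdiff hY), D.isCovariantDerivativeOn.add hX hY]
        simp
        abel }
  have h := hT.pointwise hw
    (hφ.mdifferentiableAt_coordField hx (mvfderiv (𝓡 n) φ x (w x)))
    (hφ.coordField_mvfderiv hx (w x)).symm
  rw [mvfderiv_congr_of_eventuallyEq
    (hφ.coord_coordField_eventuallyEq hx (mvfderiv (𝓡 n) φ x (w x))), mvfderiv_const] at h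
  rw [sub_eq_iff_eq_add'] at h
  simpa using h

theorem Connection.coordField_symm {D : Connection n M} (hD : D.torsion = 0) (hx : x ∈ φ.source)
    (a b : E) :
    D (coordField φ a) x (coordField φ b x) = D (coordField φ b) x (coordField φ a x) := by
  have h := D.torsion_eq_zero_iff.1 hD (hφ.mdifferentiableAt_coordField hx b)
    (hφ.mdifferentiableAt_coordField hx a)
  rwa [hφ.mlieBracket_coordField hx, sub_eq_zero] at h

/-- The Koszul formula for coordinate vector fields. -/
theorem IsLeviCivita.koszul {g : PseudoRiemannianMetric n M} {D : Connection n M}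
    (hD : IsLeviCivita g D) (hx : x ∈ φ.source) (a b c : E) :
    2 * g.form x (D (coordField φ b) x (coordField φ a x)) (coordField φ c x) =
      mvfderiv (𝓡 n) (fun y ↦ g.form y (coordField φ b y) (coordField φ c y)) x (coordField φ a x)
      + mvfderiv (𝓡 n) (fun y ↦ g.form y (coordField φ a y) (coordField φ c y)) x
          (coordField φ b x)
      - mvfderiv (𝓡 n) (fun y ↦ g.form y (coordField φ a y) (coordField φ b y)) x
          (coordField φ c x) := by
  have hd := fun a ↦ hφ.mdifferentiableAt_coordField hx a
  rw [hD.metric x _ _ _ (hd b) (hd c), hD.metric x _ _ _ (hd a) (hd c),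
    hD.metric x _ _ _ (hd a) (hd b), Connection.coordField_symm hφ hD.torsion_free hx a b,
    Connection.coordField_symm hφ hD.torsion_free hx a c,
    Connection.coordField_symm hφ hD.torsion_free hx b c, g.symm x (coordField φ a x),
    g.symm x (coordField φ b x)]
  ring

end LocalConnection

section AdaptedChart

variable {n : ℕ} {M : Type u} [TopologicalSpace M] [ChartedSpace (Eucl n) M]
  [IsManifold (𝓡 n) ∞ M]
  {F : Type*} [NormedAddCommGroup F] [NormedSpace ℝ F] [FiniteDimensional ℝ F]
  {φ : OpenPartialHomeomorph M (F × (F →L[ℝ] ℝ))}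

/-- In coordinates `(q, p)` with values in `F × F*` such that `g(∂_p, ·) = dq` and the derivative
of the metric coefficients in the direction of `∂_p` is `-2Γ`, the `q`-component of the
Levi-Civita connection of `g` has the Christoffel symbols `Γ`. -/
theorem IsLeviCivita.fst_coord_eq (hφ : IsSmoothChart (n := n) φ)
    {g : PseudoRiemannianMetric n M} {D : Connection n M} (hD : IsLeviCivita g D)
    (hstd : ∀ y ∈ φ.source, ∀ (η : F →L[ℝ] ℝ) (w : TangentSpace (𝓡 n) y),
      g.form y (coordField φ (0, η) y) w = η (mvfderiv (𝓡 n) φ y w).1)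
    {x : M} (hx : x ∈ φ.source) {G : F → F → F}
    (hG : ∀ (η : F →L[ℝ] ℝ) (a b : F × (F →L[ℝ] ℝ)),
      mvfderiv (𝓡 n) (fun y ↦ g.form y (coordField φ a y) (coordField φ b y)) x
        (coordField φ (0, η) x) = -2 * η (G a.1 b.1))
    {w : ∀ x : M, TangentSpace (𝓡 n) x} (hw : MDifferentiableAt (𝓡 n) (𝓡 n).tangent
      (fun y ↦ (⟨y, w y⟩ : TangentBundle (𝓡 n) M)) x) (u : TangentSpace (𝓡 n) x) :
    (mvfderiv (𝓡 n) φ x (D w x u)).1 =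
      mvfderiv (𝓡 n) (fun y ↦ (mvfderiv (𝓡 n) φ y (w y)).1) x u
        + G (mvfderiv (𝓡 n) φ x u).1 (mvfderiv (𝓡 n) φ x (w x)).1 := by
  have hconst : ∀ (η : F →L[ℝ] ℝ) (b : F × (F →L[ℝ] ℝ)),
      mvfderiv (𝓡 n) (fun y ↦ g.form y (coordField φ b y) (coordField φ (0, η) y)) x = 0 := by
    intro η b
    have h : (fun y ↦ g.form y (coordField φ b y) (coordField φ (0, η) y)) =ᶠ[𝓝 x]
        fun _ ↦ η b.1 := by
      filter_upwards [φ.open_source.mem_nhds hx] with y hy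
      rw [g.symm, hstd y hy, hφ.mvfderiv_coordField hy]
    rw [mvfderiv_congr_of_eventuallyEq h, mvfderiv_const]
  -- in the Koszul formula for `g(D_a ∂_b, ∂_p)`, only the derivative in the direction of `∂_p` is left
  have key : ∀ a b : F × (F →L[ℝ] ℝ),
      (mvfderiv (𝓡 n) φ x (D (coordField φ b) x (coordField φ a x))).1 = G a.1 b.1 := by
    intro a b
    refine (SeparatingDual.eq_iff_forall_dual_eq (R := ℝ)).2 fun η ↦ ?_
    have h := hD.koszul hφ hx a b (0, η)
    rw [hconst, hconst, hG, g.symm, hstd x hx] at h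
    simp only [zero_apply] at h
    linarith
  rw [Connection.coord_eq hφ D hx hw u, Prod.fst_add]
  congr 1
  · have h := mdifferentiableAt_mvfderiv_apply φ.open_source hφ.smooth hx hw
    exact (mvfderiv_fderiv_comp (h := Prod.fst) differentiableAt_fst h u).symm ▸ by
      rw [fderiv_fst]; rfl
  · rw [← key, hφ.coordField_mvfderiv hx]

end AdaptedChart

/-! ### The inverse function theorem -/

section InverseFunction

variable {E : Type*} [NormedAddCommGroup E] [NormedSpace ℝ E] [FiniteDimensional ℝ E]
  {E' : Type*} [NormedAddCommGroup E'] [NormedSpace ℝ E'] [FiniteDimensional ℝ E']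

omit [FiniteDimensional ℝ E'] in
/-- The smooth inverse function theorem, with a smooth inverse on the whole target. -/
theorem exists_openPartialHomeomorph_of_bijective {f : E → E'} {O : Set E} (hO : IsOpen O)
    (hf : ContDiffOn ℝ ∞ f O) {x : E} (hx : x ∈ O) (hb : Function.Bijective (fderiv ℝ f x)) :
    ∃ ψ : OpenPartialHomeomorph E E', x ∈ ψ.source ∧ ψ.source ⊆ O ∧ (ψ : E → E') = f ∧
      ContDiffOn ℝ ∞ ψ.symm ψ.target := by
  have hfx : ContDiffAt ℝ ∞ f x := hf.contDiffAt (hO.mem_nhds hx)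
  let e : E ≃L[ℝ] E' :=
    (LinearEquiv.ofBijective (fderiv ℝ f x).toLinearMap hb).toContinuousLinearEquiv
  have he : (e : E →L[ℝ] E') = fderiv ℝ f x := by ext v; rfl
  have hd : HasFDerivAt f (e : E →L[ℝ] E') x := by
    rw [he]; exact (hfx.differentiableAt (by simp)).hasFDerivAt
  let ψ₀ := hfx.toOpenPartialHomeomorph f hd (by simp)
  have hcont : ContinuousOn (fderiv ℝ f) O := hf.continuousOn_fderiv_of_isOpen hO (by simp)
  let T : Set E := O ∩ fderiv ℝ f ⁻¹' range ((↑) : (E ≃L[ℝ] E') → E →L[ℝ] E')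
  have hT : IsOpen T := hcont.isOpen_inter_preimage hO ContinuousLinearEquiv.isOpen
  have hxT : x ∈ T := ⟨hx, e, he⟩
  refine ⟨ψ₀.restrOpen T hT, ⟨hfx.mem_toOpenPartialHomeomorph_source hd (by simp), hxT⟩,
    fun y hy ↦ hy.2.1, rfl, ?_⟩
  intro z hz
  have hz' := (ψ₀.restrOpen T hT).map_target hz
  obtain ⟨e', he'⟩ := hz'.2.2
  have h1 : ContDiffAt ℝ ∞ f ((ψ₀.restrOpen T hT).symm z) := hf.contDiffAt (hO.mem_nhds hz'.2.1)
  refine ((ψ₀.restrOpen T hT).contDiffAt_symm (f₀' := e') hz ?_ h1).contDiffWithinAt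
  rw [he']
  exact (h1.differentiableAt (by simp)).hasFDerivAt

variable {n : ℕ} {M : Type u} [TopologicalSpace M] [ChartedSpace (Eucl n) M]
  [IsManifold (𝓡 n) ∞ M]

omit [FiniteDimensional ℝ E] [FiniteDimensional ℝ E'] [IsManifold (𝓡 n) ∞ M] in
theorem IsSmoothChart.trans {φ : OpenPartialHomeomorph M E} (hφ : IsSmoothChart (n := n) φ)
    {ψ : OpenPartialHomeomorph E E'} (hψ : ContDiffOn ℝ ∞ ψ ψ.source)
    (hψ' : ContDiffOn ℝ ∞ ψ.symm ψ.target) : IsSmoothChart (n := n) (φ.trans ψ) where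
  smooth := hψ.contMDiffOn.comp (hφ.smooth.mono fun _ hy ↦ hy.1) fun _ hy ↦ hy.2
  smooth_symm := hφ.smooth_symm.comp (hψ'.contMDiffOn.mono fun _ hy ↦ hy.1) fun _ hy ↦ hy.2

theorem isSmoothChart_chartAt (x : M) : IsSmoothChart (n := n) (chartAt (Eucl n) x) where
  smooth := contMDiffOn_chart
  smooth_symm := contMDiffOn_chart_symm

omit [FiniteDimensional ℝ E] [IsManifold (𝓡 n) ∞ M] in
theorem IsSmoothChart.restrOpen {φ : OpenPartialHomeomorph M E} (hφ : IsSmoothChart (n := n) φ)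
    {O : Set M} (hO : IsOpen O) : IsSmoothChart (n := n) (φ.restrOpen O hO) where
  smooth := hφ.smooth.mono fun y hy ↦ hy.1
  smooth_symm := hφ.smooth_symm.mono fun y hy ↦ by
    simp only [OpenPartialHomeomorph.restrOpen] at hy
    exact hy.1

omit [FiniteDimensional ℝ E'] in
/-- A smooth map to a vector space with bijective derivative is locally a smooth chart. -/
theorem exists_isSmoothChart_of_bijective {f : M → E'} {O : Set M} (hO : IsOpen O)
    (hf : ContMDiffOn (𝓡 n) 𝓘(ℝ, E') ∞ f O) {x : M} (hx : x ∈ O)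
    (hb : Function.Bijective (mvfderiv (𝓡 n) f x)) :
    ∃ φ : OpenPartialHomeomorph M E', IsSmoothChart (n := n) φ ∧ x ∈ φ.source ∧ φ.source ⊆ O ∧
      EqOn φ f φ.source := by
  set c := chartAt (Eucl n) x
  have hc : IsSmoothChart (n := n) c := isSmoothChart_chartAt x
  have hxc : x ∈ c.source := mem_chart_source _ x
  have hO' : IsOpen (c.target ∩ c.symm ⁻¹' O) := c.isOpen_inter_preimage_symm hO
  have hf' : ContDiffOn ℝ ∞ (fun z ↦ f (c.symm z)) (c.target ∩ c.symm ⁻¹' O) :=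
    (hf.comp (hc.smooth_symm.mono inter_subset_left) fun z hz ↦ hz.2).contDiffOn
  have hx' : c x ∈ c.target ∩ c.symm ⁻¹' O := ⟨c.map_source hxc, by simpa [c.left_inv hxc]⟩
  have hcomp : ∀ v, fderiv ℝ (fun z ↦ f (c.symm z)) (c x) (mvfderiv (𝓡 n) c x v)
      = mvfderiv (𝓡 n) f x v := by
    intro v
    rw [← mvfderiv_fderiv_comp (h := fun z ↦ f (c.symm z))
      ((hf'.contDiffAt (hO'.mem_nhds hx')).differentiableAt (by simp)) (hc.mdifferentiableAt hxc)]
    congr 1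
    apply mvfderiv_congr_of_eventuallyEq
    filter_upwards [c.open_source.mem_nhds hxc] with y hy
    rw [c.left_inv hy]
  have hb' : Function.Bijective (fderiv ℝ (fun z ↦ f (c.symm z)) (c x)) := by
    refine (Function.Bijective.of_comp_iff _ (hc.bijective hxc)).1 ?_
    convert hb using 1
    exact funext hcomp
  obtain ⟨ψ, hxψ, hψO, hψf, hψs⟩ := exists_openPartialHomeomorph_of_bijective hO' hf' hx' hb'
  refine ⟨c.trans ψ, hc.trans (hψf ▸ hf'.mono hψO) hψs, ?_, ?_, ?_⟩
  · exact ⟨hxc, hxψ⟩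
  · intro y hy
    have := (hψO hy.2).2
    simpa [c.left_inv hy.1] using this
  · intro y hy
    simp [hψf, c.left_inv hy.1]

end InverseFunction

/-! ### Fields projectable onto a leaf space -/

section LeafSpaces

variable {n q : ℕ} {M : Type u} [TopologicalSpace M] [ChartedSpace (Eucl n) M]
  {S : Type v} [TopologicalSpace S] [ChartedSpace (Eucl q) S]
  {F : Type*} [NormedAddCommGroup F] [NormedSpace ℝ F]

/-- A function which is constant along the fibres of a bundle projection `pr` to first order
factors locally through `pr`: it is obtained from its restriction to a local section `σ`. -/
theorem IsBundleProjectionOn.exists_factor {U : Set M} {pr : M → S}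
    (hpr : IsBundleProjectionOn (n := n) (q := q) U pr) {O : Set M} (hO : IsOpen O)
    (hOU : O ⊆ U) {ρ : M → F} (hρ : ContMDiffOn (𝓡 n) 𝓘(ℝ, F) ∞ ρ O)
    (hker : ∀ y ∈ O, ∀ v : TangentSpace (𝓡 n) y, mfderiv (𝓡 n) (𝓡 q) pr y v = 0 →
      mvfderiv (𝓡 n) ρ y v = 0) {x : M} (hx : x ∈ O) :
    ∃ (O' : Set M) (W : Set S) (σ : S → M), IsOpen O' ∧ x ∈ O' ∧ O' ⊆ O ∧ IsOpen W ∧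
      MapsTo pr O' W ∧ ContMDiffOn (𝓡 q) (𝓡 n) ∞ σ W ∧ MapsTo σ W O' ∧
      (∀ y ∈ W, pr (σ y) = y) ∧ ∀ z ∈ O', ρ z = ρ (σ (pr z)) := by
  obtain ⟨W₀, hW₀, hxW₀, k, Fib, _, _, _, Φ, hΦs, hΦt, hΦ, hΦ', hΦ1⟩ :=
    hpr.locally_trivial (pr x)
  have hxs : x ∈ Φ.source := by rw [hΦs]; exact ⟨hOU hx, hxW₀⟩
  set f₀ : Fib := (Φ x).2
  set c := chartAt (Eucl k) f₀
  have hc : IsSmoothChart (n := k) c := isSmoothChart_chartAt f₀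
  have hfc : f₀ ∈ c.source := mem_chart_source _ f₀
  -- the set of all `(y, b)` such that the point of the fibre over `y` with coordinate `b` is in `O`
  have hopen : IsOpen (Φ.target ∩ Φ.symm ⁻¹' O) := Φ.isOpen_inter_preimage_symm hO
  have hmem : (pr x, f₀) ∈ Φ.target ∩ Φ.symm ⁻¹' O := by
    have h1 : (pr x, f₀) = Φ x := by rw [← hΦ1 x hxs]
    rw [h1]
    exact ⟨Φ.map_source hxs, by simpa [Φ.left_inv hxs]⟩
  obtain ⟨W, T, hW, hxW, hT, hfT, hWT⟩ :=
    mem_nhds_prod_iff'.1 (hopen.mem_nhds hmem)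
  have hT' : IsOpen (c.target ∩ c.symm ⁻¹' T) := c.isOpen_inter_preimage_symm hT
  obtain ⟨ε, hε, hball⟩ := Metric.isOpen_iff.1 hT' (c f₀)
    ⟨c.map_source hfc, by simpa [c.left_inv hfc]⟩
  set B := Metric.ball (c f₀) ε
  have hWO : ∀ y ∈ W, ∀ b ∈ B, (y, c.symm b) ∈ Φ.target ∧ Φ.symm (y, c.symm b) ∈ O :=
    fun y hy b hb ↦ hWT ⟨hy, (hball hb).2⟩
  have hprΦ : ∀ p ∈ Φ.target, pr (Φ.symm p) = p.1 := fun p hp ↦ by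
    rw [← hΦ1 _ (Φ.map_target hp), Φ.right_inv hp]
  have hO'open : IsOpen (Φ.source ∩ Φ ⁻¹' (W ×ˢ (c.source ∩ c ⁻¹' B))) :=
    Φ.isOpen_inter_preimage (hW.prod (c.isOpen_inter_preimage Metric.isOpen_ball))
  have hf₀ : f₀ = c.symm (c f₀) := (c.left_inv hfc).symm
  have hcB : c f₀ ∈ B := Metric.mem_ball_self hε
  refine ⟨Φ.source ∩ Φ ⁻¹' (W ×ˢ (c.source ∩ c ⁻¹' B)), W, fun y ↦ Φ.symm (y, f₀), hO'open,
    ⟨hxs, ⟨by rw [hΦ1 x hxs]; exact hxW, hfc, hcB⟩⟩, ?_, hW, ?_, ?_, ?_, ?_, ?_⟩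
  · rintro z ⟨hz, hz1, hz2, hz3⟩
    have := (hWO _ hz1 _ hz3).2
    rwa [c.left_inv hz2, Prod.mk.eta, Φ.left_inv hz] at this
  · rintro z ⟨hz, hz1, hz2, hz3⟩
    rwa [hΦ1 z hz] at hz1
  · refine hΦ'.comp (contMDiffOn_id.prodMk contMDiffOn_const) fun y hy ↦ ?_
    have := (hWO y hy _ hcB).1
    rwa [← hf₀] at this
  · intro y hy
    have h := hWO y hy _ hcB
    rw [← hf₀] at h
    refine ⟨Φ.map_target h.1, ?_⟩
    rw [mem_preimage, Φ.right_inv h.1]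
    exact ⟨hy, hfc, hcB⟩
  · intro y hy
    have h := hWO y hy _ hcB
    rw [← hf₀] at h
    exact hprΦ _ h.1
  · rintro z ⟨hz, hz1, hz2, hz3⟩
    rw [hΦ1 z hz] at hz1
    set y := pr z
    have hκ : ContMDiffOn (𝓡 k) (𝓡 n) ∞ (fun b ↦ Φ.symm (y, c.symm b)) B := by
      refine hΦ'.comp (contMDiffOn_const.prodMk (hc.smooth_symm.mono fun b hb ↦ (hball hb).1))
        fun b hb ↦ (hWO y hz1 b hb).1
    have hρκ : DifferentiableOn ℝ (fun b ↦ ρ (Φ.symm (y, c.symm b))) B :=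
      ((hρ.comp hκ fun b hb ↦ (hWO y hz1 b hb).2).contDiffOn).differentiableOn (by simp)
    have hder : ∀ b ∈ B, fderiv ℝ (fun b ↦ ρ (Φ.symm (y, c.symm b))) b = 0 := by
      intro b hb
      have hκb : MDifferentiableAt (𝓡 k) (𝓡 n) (fun b ↦ Φ.symm (y, c.symm b)) b :=
        (hκ.contMDiffAt (Metric.isOpen_ball.mem_nhds hb)).mdifferentiableAt (by simp)
      have hbO := (hWO y hz1 b hb).2
      ext β
      have h1 := mvfderiv_comp_mfderiv (f := fun b ↦ Φ.symm (y, c.symm b)) (h := ρ)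
        ((hρ.contMDiffAt (hO.mem_nhds hbO)).mdifferentiableAt (by simp)) hκb β
      have h2 : mvfderiv (𝓡 k) (fun b ↦ ρ (Φ.symm (y, c.symm b))) b β =
          fderiv ℝ (fun b ↦ ρ (Φ.symm (y, c.symm b))) b β := by
        simp only [mvfderiv, mfderiv_eq_fderiv]; rfl
      rw [← h2]
      refine h1.trans (hker _ hbO _ ?_)
      have hprd : MDifferentiableAt (𝓡 n) (𝓡 q) pr (Φ.symm (y, c.symm b)) :=
        (hpr.smooth.contMDiffAt (hpr.isOpen.mem_nhds (hOU hbO))).mdifferentiableAt (by simp)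
      have h3 := mfderiv_comp_apply b hprd hκb β
      have h4 : (pr ∘ fun b ↦ Φ.symm (y, c.symm b)) =ᶠ[𝓝 b] fun _ ↦ y := by
        filter_upwards [Metric.isOpen_ball.mem_nhds hb] with b' hb'
        exact hprΦ _ (hWO y hz1 b' hb').1
      have h5 := (hasMFDerivAt_const (I := 𝓡 k) (I' := 𝓡 q) y b).congr_of_eventuallyEq h4
      rw [h5.mfderiv] at h3
      exact h3.symm
    have hconst := Metric.isOpen_ball.is_const_of_fderiv_eq_zero
      (convex_ball (c f₀) ε).isPreconnected hρκ hder hz3 hcB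
    simp only [c.left_inv hz2, c.left_inv hfc] at hconst
    rw [← hconst]
    congr 1
    have h6 : (y, (Φ z).2) = Φ z := Prod.ext (hΦ1 z hz).symm rfl
    rw [h6, Φ.left_inv hz]

/-- A criterion for projectability onto a given local leaf space: a field is projectable if,
locally, its image under the differential of some submersion `ρ` with the same leaves is a function
of the leaf. -/
theorem IsLeafFibration.exists_projectsTo [FiniteDimensional ℝ F] [IsManifold (𝓡 q) ∞ S]
    (hF : Module.finrank ℝ F = q)
    {V : ∀ x : M, Submodule ℝ (TangentSpace (𝓡 n) x)} {U : Set M} {pr : M → S}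
    (hpr : IsLeafFibration (q := q) V U pr) {w : ∀ x : M, TangentSpace (𝓡 n) x}
    (hw : ∀ x ∈ U, ∃ (O : Set M) (W : Set S) (ρ : M → F) (ζ : S → F), IsOpen O ∧ x ∈ O ∧
      O ⊆ U ∧ IsOpen W ∧ MapsTo pr O W ∧ ContMDiffOn (𝓡 n) 𝓘(ℝ, F) ∞ ρ O ∧
      (∀ y ∈ O, ∀ v, mvfderiv (𝓡 n) ρ y v = 0 ↔ v ∈ V y) ∧
      ContMDiffOn (𝓡 q) 𝓘(ℝ, F) ∞ ζ W ∧ ∀ y ∈ O, mvfderiv (𝓡 n) ρ y (w y) = ζ (pr y)) :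
    ∃ w' : ∀ y : S, TangentSpace (𝓡 q) y, SmoothFieldOn univ w' ∧ ProjectsTo U pr w w' := by
  -- near every point, `w` projects onto a smooth local field
  have hloc : ∀ x ∈ U, ∃ (O : Set M) (W : Set S) (w' : ∀ y : S, TangentSpace (𝓡 q) y),
      IsOpen O ∧ x ∈ O ∧ O ⊆ U ∧ IsOpen W ∧ MapsTo pr O W ∧ W ⊆ pr '' O ∧ SmoothFieldOn W w' ∧
      ∀ z ∈ O, mfderiv (𝓡 n) (𝓡 q) pr z (w z) = w' (pr z) := by
    intro x hx
    obtain ⟨O, W, ρ, ζ, hO, hxO, hOU, hW, hOW, hρ, hker, hζ, hρζ⟩ := hw x hx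
    have hmem : ∀ y ∈ U, ∀ v, mfderiv (𝓡 n) (𝓡 q) pr y v = 0 ↔ v ∈ V y := fun y hy v ↦ by
      rw [← hpr.ker_eq y hy]; rfl
    have hprd : ∀ y ∈ U, MDifferentiableAt (𝓡 n) (𝓡 q) pr y := fun y hy ↦
      (hpr.bundle.smooth.contMDiffAt (hpr.bundle.isOpen.mem_nhds hy)).mdifferentiableAt (by simp)
    have hρd : ∀ y ∈ O, MDifferentiableAt (𝓡 n) 𝓘(ℝ, F) ρ y := fun y hy ↦
      (hρ.contMDiffAt (hO.mem_nhds hy)).mdifferentiableAt (by simp)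
    obtain ⟨O₁, W₁, σ, hO₁, hxO₁, hO₁O, hW₁, hOW₁, hσ, hσO₁, hprσ, hfac⟩ :=
      hpr.bundle.exists_factor hO hOU hρ
        (fun y hy v hv ↦ (hker y hy v).2 ((hmem y (hOU hy) v).1 hv)) hxO
    have hσd : ∀ y ∈ W₁, MDifferentiableAt (𝓡 q) (𝓡 n) σ y := fun y hy ↦
      (hσ.contMDiffAt (hW₁.mem_nhds hy)).mdifferentiableAt (by simp)
    set χ : S → F := fun y ↦ ρ (σ y) with hχdef
    have hχ : ContMDiffOn (𝓡 q) 𝓘(ℝ, F) ∞ χ W₁ := hρ.comp hσ fun y hy ↦ hO₁O (hσO₁ hy)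
    have hy₀ : pr x ∈ W₁ := hOW₁ hxO₁
    have hinj : Function.Injective (mvfderiv (𝓡 q) χ (pr x)) := by
      rw [injective_iff_map_eq_zero]
      intro u hu
      have hσx := hσO₁ hy₀
      rw [mvfderiv_comp_mfderiv (hρd _ (hO₁O hσx)) (hσd _ hy₀), hker _ (hO₁O hσx),
        ← hmem _ (hOU (hO₁O hσx))] at hu
      have h1 := mfderiv_comp_apply (pr x) (hprd _ (hOU (hO₁O hσx))) (hσd _ hy₀) u
      have h2 : (pr ∘ σ) =ᶠ[𝓝 (pr x)] id := by
        filter_upwards [hW₁.mem_nhds hy₀] with y hy using hprσ y hy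
      have h3 := (hasMFDerivAt_id (I := 𝓡 q) (pr x)).congr_of_eventuallyEq h2
      rw [h3.mfderiv, hu] at h1
      exact h1
    have hbij : Function.Bijective (mvfderiv (𝓡 q) χ (pr x)) := by
      refine ⟨hinj, ?_⟩
      have hd : Module.finrank ℝ (TangentSpace (𝓡 q) (pr x)) = Module.finrank ℝ F := by
        rw [hF]; exact finrank_euclideanSpace_fin
      have : FiniteDimensional ℝ (TangentSpace (𝓡 q) (pr x)) :=
        inferInstanceAs (FiniteDimensional ℝ (Eucl q))
      exact (LinearMap.injective_iff_surjective_of_finrank_eq_finrank hd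
        (f := (mvfderiv (𝓡 q) χ (pr x)).toLinearMap)).1 hinj
    obtain ⟨ψ, hψ, hxψ, hψW, hψχ⟩ := exists_isSmoothChart_of_bijective (hW₁.inter hW)
      (hχ.mono inter_subset_left) ⟨hy₀, hOW hxO⟩ hbij
    have hOψ : IsOpen (O₁ ∩ pr ⁻¹' ψ.source) :=
      (hpr.bundle.smooth.continuousOn.mono (hO₁O.trans hOU)).isOpen_inter_preimage hO₁
        ψ.open_source
    refine ⟨O₁ ∩ pr ⁻¹' ψ.source, ψ.source, fun y ↦ coordField ψ (ζ y) y, hOψ,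
      ⟨hxO₁, hxψ⟩, fun z hz ↦ hOU (hO₁O hz.1), ψ.open_source, fun z hz ↦ hz.2, ?_,
      hψ.smoothFieldOn_of_coord ψ.open_source subset_rfl (hζ.mono fun y hy ↦ (hψW hy).2), ?_⟩
    · intro y hy
      have hyW := (hψW hy).1
      exact ⟨σ y, ⟨hσO₁ hyW, by rw [mem_preimage, hprσ y hyW]; exact hy⟩, hprσ y hyW⟩
    · intro z hz
      have hzO := hO₁O hz.1
      have h1 : mvfderiv (𝓡 q) ψ (pr z) (mfderiv (𝓡 n) (𝓡 q) pr z (w z)) = ζ (pr z) := by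
        rw [← mvfderiv_comp_mfderiv (hψ.mdifferentiableAt hz.2) (hprd z (hOU hzO)), ← hρζ z hzO]
        congr 1
        apply mvfderiv_congr_of_eventuallyEq
        filter_upwards [hOψ.mem_nhds hz] with z' hz'
        rw [hψχ hz'.2, hfac z' hz'.1]
      dsimp only
      rw [← h1, hψ.coordField_mvfderiv hz.2]
  -- hence its projection is locally, and so globally, constant on the fibres
  have hconst : ∀ x₁ ∈ U, ∀ x₂ ∈ U, pr x₁ = pr x₂ →
      (mfderiv (𝓡 n) (𝓡 q) pr x₁ (w x₁) : Eucl q) = mfderiv (𝓡 n) (𝓡 q) pr x₂ (w x₂) := by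
    intro x₁ h₁ x₂ h₂ h₁₂
    refine (hpr.fibre_connected (pr x₂)).isPreconnected.induction₂'
      (fun x₁ x₂ ↦ (mfderiv (𝓡 n) (𝓡 q) pr x₁ (w x₁) : Eucl q) =
        mfderiv (𝓡 n) (𝓡 q) pr x₂ (w x₂)) ?_ (fun _ _ _ _ _ _ ↦ Eq.trans) ⟨h₁, h₁₂⟩ ⟨h₂, rfl⟩
    rintro x ⟨hx, hxy⟩
    obtain ⟨O, W, w', hO, hxO, hOU, hW, hOW, hWO, hw', hww'⟩ := hloc x hx
    filter_upwards [mem_nhdsWithin_of_mem_nhds (hO.mem_nhds hxO), self_mem_nhdsWithin]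
      with z hz hzU
    have h : (mfderiv (𝓡 n) (𝓡 q) pr x (w x) : Eucl q) = mfderiv (𝓡 n) (𝓡 q) pr z (w z) := by
      have e1 : (mfderiv (𝓡 n) (𝓡 q) pr x (w x) : Eucl q) = (w' (pr x) : Eucl q) := hww' x hxO
      have e2 : (mfderiv (𝓡 n) (𝓡 q) pr z (w z) : Eucl q) = (w' (pr z) : Eucl q) := hww' z hz
      have e3 : pr x = pr z := hxy.trans hzU.2.symm
      rw [e1, e2, e3]
    exact ⟨h, h.symm⟩
  have hsurj : ∀ y : S, ∃ x ∈ U, pr x = y := fun y ↦ by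
    have := hpr.bundle.surj ▸ mem_univ y
    exact this
  choose s hsU hs using hsurj
  refine ⟨fun y ↦ (mfderiv (𝓡 n) (𝓡 q) pr (s y) (w (s y)) : Eucl q), ?_, fun x hx ↦
    hconst x hx _ (hsU _) (hs _).symm⟩
  intro y _
  obtain ⟨O, W, w', hO, hxO, hOU, hW, hOW, hWO, hw', hww'⟩ := hloc (s y) (hsU y)
  have hyW : y ∈ W := by rw [← hs y]; exact hOW hxO
  refine ((hw'.contMDiffAt (hW.mem_nhds hyW)).congr_of_eventuallyEq ?_).contMDiffWithinAt
  filter_upwards [hW.mem_nhds hyW] with y' hy'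
  obtain ⟨z, hz, rfl⟩ := hWO hy'
  have h : (mfderiv (𝓡 n) (𝓡 q) pr (s (pr z)) (w (s (pr z))) : Eucl q) = (w' (pr z) : Eucl q) :=
    (hconst _ (hsU _) z (hOU hz) (hs _)).trans (hww' z hz)
  exact congrArg (fun t : Eucl q ↦ (⟨pr z, t⟩ : TangentBundle (𝓡 q) S)) h

end LeafSpaces

/-! ### Composition operators on spaces of continuous functions -/

section Nemytskii

variable {K : Type*} [TopologicalSpace K] [CompactSpace K]
  {E : Type u} [NormedAddCommGroup E] [NormedSpace ℝ E]

section

variable {F : Type*} [NormedAddCommGroup F] [NormedSpace ℝ F]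
  {G : Type*} [NormedAddCommGroup G] [NormedSpace ℝ G]

/-- The continuous bilinear map `C(K, G) × C(K, E) → C(K, F)` given pointwise by a continuous
bilinear map `G × E → F`. -/
def pointwiseCLM (K : Type*) [TopologicalSpace K] [CompactSpace K] (B : G →L[ℝ] E →L[ℝ] F) :
    C(K, G) →L[ℝ] C(K, E) →L[ℝ] C(K, F) :=
  LinearMap.mkContinuous₂
    (LinearMap.mk₂ ℝ (fun (L : C(K, G)) (h : C(K, E)) ↦
        (⟨fun t ↦ B (L t) (h t), by fun_prop⟩ : C(K, F)))
      (fun _ _ _ ↦ by ext; simp) (fun _ _ _ ↦ by ext; simp)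
      (fun _ _ _ ↦ by ext; simp) (fun _ _ _ ↦ by ext; simp)) ‖B‖
    (fun L h ↦ by
      rw [ContinuousMap.norm_le _ (by positivity)]
      intro t
      refine (B.le_opNorm₂ _ _).trans ?_
      gcongr
      · exact L.norm_coe_le_norm t
      · exact h.norm_coe_le_norm t)

@[simp]
theorem pointwiseCLM_apply (B : G →L[ℝ] E →L[ℝ] F) (L : C(K, G)) (h : C(K, E)) (t : K) :
    pointwiseCLM K B L h t = B (L t) (h t) := rfl

/-- The composition operator `v ↦ f ∘ v` is differentiable, and its derivative at `u` is given
pointwise by the derivative of `f` along `u`: by the mean value inequality, the error is controlled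
by the uniform continuity of `f'` near the compact image of `u`. -/
theorem hasFDerivAt_comp_continuousMap (B : G →L[ℝ] E →L[ℝ] F) (hB : ∀ x, ‖B x‖ ≤ ‖x‖)
    (f : C(E, F)) (f' : C(E, G)) (hf : ∀ x, HasFDerivAt f (B (f' x)) x) (u : C(K, E)) :
    HasFDerivAt (fun v : C(K, E) ↦ f.comp v) (pointwiseCLM K B (f'.comp u)) u := by
  rw [hasFDerivAt_iff_isLittleO_nhds_zero, Asymptotics.isLittleO_iff]
  intro ε hε
  have hcont : Continuous fun v : C(K, E) ↦ f'.comp v := ContinuousMap.continuous_postcomp f'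
  obtain ⟨δ, hδ, hball⟩ :=
    (Metric.continuous_iff (β := C(K, G)) (f := fun v ↦ f'.comp v)).1 hcont u ε hε
  filter_upwards [Metric.ball_mem_nhds (0 : C(K, E)) hδ] with h hh
  rw [mem_ball_zero_iff] at hh
  rw [ContinuousMap.norm_le _ (by positivity)]
  intro t
  have hseg : ∀ s ∈ Icc (0 : ℝ) 1, ‖B (f' (u t + s • h t)) - B (f' (u t))‖ ≤ ε := by
    intro s hs
    have h1 : dist (u + s • h) u < δ := by
      rw [dist_eq_norm, add_sub_cancel_left, norm_smul, Real.norm_of_nonneg hs.1]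
      exact lt_of_le_of_lt (mul_le_of_le_one_left (norm_nonneg _) hs.2) hh
    have h2 := (hball _ h1).le
    rw [ContinuousMap.dist_le hε.le] at h2
    have h3 := h2 t
    rw [dist_eq_norm] at h3
    rw [← map_sub]
    exact (hB _).trans h3
  have hmv := (convex_segment (u t) (u t + h t)).norm_image_sub_le_of_norm_hasFDerivWithin_le'
    (f := f) (f' := fun x ↦ B (f' x)) (φ := B (f' (u t))) (C := ε) (x := u t) (y := u t + h t)
    (fun x _ ↦ (hf x).hasFDerivWithinAt) ?_ (left_mem_segment ℝ _ _) (right_mem_segment ℝ _ _)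
  · rw [add_sub_cancel_left] at hmv
    refine hmv.trans ?_
    gcongr
    exact h.norm_coe_le_norm t
  · intro x hx
    rw [segment_eq_image'] at hx
    obtain ⟨s, hs, rfl⟩ := hx
    simpa using hseg s hs

end

set_option synthInstance.maxHeartbeats 400000 in
/-- Composition with a smooth map is a smooth map between spaces of continuous functions: its
derivative is composition with `fderiv ℝ f`, followed by a continuous linear map, so that induction
on the order of differentiability applies. The target space has to vary in the induction, and is
therefore taken in the universe of `E`. -/
theorem contDiff_comp_continuousMap {F : Type u} [NormedAddCommGroup F] [NormedSpace ℝ F]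
    {f : E → F} (hf : ContDiff ℝ ∞ f) :
    ContDiff ℝ ∞ (fun v : C(K, E) ↦ (⟨f, hf.continuous⟩ : C(E, F)).comp v) := by
  rw [contDiff_infty]
  intro n
  induction n generalizing F with
  | zero => exact contDiff_zero.2 (ContinuousMap.continuous_postcomp _)
  | succ n ih =>
    have hf' : ContDiff ℝ ∞ (fderiv ℝ f) := hf.fderiv_right (by simp)
    have hd := fun u : C(K, E) ↦ hasFDerivAt_comp_continuousMap
      (ContinuousLinearMap.id ℝ (E →L[ℝ] F)) (fun _ ↦ le_rfl) ⟨f, hf.continuous⟩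
      ⟨fderiv ℝ f, hf'.continuous⟩ (fun x ↦ (hf.differentiable (by simp) x).hasFDerivAt) u
    push_cast
    refine contDiff_succ_iff_hasFDerivAt.2 ⟨_, ?_, hd⟩
    exact (pointwiseCLM K (ContinuousLinearMap.id ℝ (E →L[ℝ] F))).contDiff.comp (ih hf')

end Nemytskii

/-! ### The implicit function theorem in Banach spaces -/

section ImplicitFunction

variable {Z : Type*} [NormedAddCommGroup Z] [NormedSpace ℝ Z] [CompleteSpace Z]
  {C : Type*} [NormedAddCommGroup C] [NormedSpace ℝ C] [CompleteSpace C]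

/-- The smooth implicit function theorem in Banach spaces, with the solution smooth on a whole
neighbourhood. -/
theorem exists_contDiffOn_implicit {Ψ : Z × C → C} (hΨ : ContDiff ℝ ∞ Ψ) {z₀ : Z} {y₀ : C}
    (h₀ : Ψ (z₀, y₀) = 0) (hd : ∀ h, fderiv ℝ Ψ (z₀, y₀) (0, h) = h) :
    ∃ (N : Set Z) (y : Z → C), IsOpen N ∧ z₀ ∈ N ∧ ContDiffOn ℝ ∞ y N ∧ y z₀ = y₀ ∧
      ∀ z ∈ N, Ψ (z, y z) = 0 := by
  let Θ : Z × C → Z × C := fun u ↦ (u.1, Ψ u)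
  have hΘ : ContDiff ℝ ∞ Θ := contDiff_fst.prodMk hΨ
  let e : (Z × C) ≃L[ℝ] (Z × C) := ContinuousLinearEquiv.skewProd (.refl ℝ Z) (.refl ℝ C)
    ((fderiv ℝ Ψ (z₀, y₀)).comp (.inl ℝ Z C))
  have hfd : ∀ u, HasFDerivAt Θ ((ContinuousLinearMap.fst ℝ Z C).prod (fderiv ℝ Ψ u)) u :=
    fun u ↦ hasFDerivAt_fst.prodMk (hΨ.differentiable (by simp) u).hasFDerivAt
  have he : (e : (Z × C) →L[ℝ] (Z × C)) =
      (ContinuousLinearMap.fst ℝ Z C).prod (fderiv ℝ Ψ (z₀, y₀)) := by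
    refine ContinuousLinearMap.ext fun ⟨a, b⟩ ↦ Prod.ext rfl ?_
    have h1 : fderiv ℝ Ψ (z₀, y₀) (a, b) = fderiv ℝ Ψ (z₀, y₀) (a, 0) + b := by
      conv_rhs => rw [← hd b, ← map_add]
      simp
    simp [e, h1, add_comm]
  have hd' : HasFDerivAt Θ (e : (Z × C) →L[ℝ] (Z × C)) (z₀, y₀) := he ▸ hfd _
  let ψ := hΘ.contDiffAt.toOpenPartialHomeomorph Θ hd' (by simp)
  have hs : (z₀, y₀) ∈ ψ.source := hΘ.contDiffAt.mem_toOpenPartialHomeomorph_source hd' (by simp)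
  have hcont : Continuous (fderiv ℝ Θ) := hΘ.continuous_fderiv (by simp)
  have hT : IsOpen (fderiv ℝ Θ ⁻¹' range ((↑) : ((Z × C) ≃L[ℝ] (Z × C)) → _)) :=
    ContinuousLinearEquiv.isOpen.preimage hcont
  let χ := ψ.restrOpen _ hT
  have hsχ : (z₀, y₀) ∈ χ.source := ⟨hs, e, by rw [hd'.fderiv]⟩
  have hχ : ContDiffOn ℝ ∞ χ.symm χ.target := by
    intro z hz
    have hz' := χ.map_target hz
    obtain ⟨e', he'⟩ := hz'.2
    refine (χ.contDiffAt_symm (f₀' := e') hz ?_ hΘ.contDiffAt).contDiffWithinAt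
    rw [he']
    exact (hΘ.differentiable (by simp) _).hasFDerivAt
  have hχΘ : ∀ u, χ u = Θ u := fun _ ↦ rfl
  have hmap : Continuous fun z : Z ↦ (z, (0 : C)) := by fun_prop
  have h0 : χ (z₀, y₀) = (z₀, 0) := by rw [hχΘ]; simp [Θ, h₀]
  refine ⟨(fun z ↦ (z, (0 : C))) ⁻¹' χ.target, fun z ↦ (χ.symm (z, 0)).2,
    χ.open_target.preimage hmap, ?_, ?_, ?_, ?_⟩
  · rw [mem_preimage, ← h0]; exact χ.map_source hsχ
  · exact contDiff_snd.comp_contDiffOn (hχ.comp (contDiff_prodMk_left 0).contDiffOn fun z hz ↦ hz)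
  · dsimp only
    rw [← h0, χ.left_inv hsχ]
  · intro z hz
    have h1 : Θ (χ.symm (z, 0)) = (z, 0) := χ.right_inv hz
    have h2 : (χ.symm (z, 0)).1 = z := congrArg Prod.fst h1
    have h3 : Ψ (χ.symm (z, 0)) = 0 := congrArg Prod.snd h1
    rwa [show (z, (χ.symm (z, 0)).2) = χ.symm (z, 0) from Prod.ext h2.symm rfl]

end ImplicitFunction

/-! ### Frobenius' theorem for total differential equations -/

section TotalDifferential

open unitInterval

variable {E P : Type u} [NormedAddCommGroup E] [NormedSpace ℝ E] [CompleteSpace E]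
  [NormedAddCommGroup P] [NormedSpace ℝ P] [FiniteDimensional ℝ P]

/-- Integration from `0`, as an operator on continuous functions on the unit interval. -/
def integralCLM (E : Type*) [NormedAddCommGroup E] [NormedSpace ℝ E] : C(I, E) →L[ℝ] C(I, E) :=
  LinearMap.mkContinuous
    { toFun := fun u ↦ ⟨fun t ↦ ∫ τ in (0 : ℝ)..t, IccExtend zero_le_one u τ, by
        have h : Continuous fun t : ℝ ↦ ∫ τ in (0 : ℝ)..t, IccExtend zero_le_one u τ :=
          intervalIntegral.continuous_primitive
            (fun a b ↦ (u.continuous.Icc_extend').intervalIntegrable a b) 0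
        exact h.comp continuous_subtype_val⟩
      map_add' := fun u v ↦ by
        ext t
        exact intervalIntegral.integral_add ((u.continuous.Icc_extend').intervalIntegrable _ _)
          ((v.continuous.Icc_extend').intervalIntegrable _ _)
      map_smul' := fun c u ↦ by
        ext t
        exact intervalIntegral.integral_smul c _ } 1 (fun u ↦ by
    rw [ContinuousMap.norm_le _ (by positivity)]
    intro t
    refine (intervalIntegral.norm_integral_le_of_norm_le_const (C := ‖u‖)
      fun τ _ ↦ u.norm_coe_le_norm _).trans ?_
    rw [sub_zero, abs_of_nonneg t.2.1, one_mul]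
    exact mul_le_of_le_one_right (norm_nonneg _) t.2.2)

omit [CompleteSpace E] in
theorem integralCLM_apply (u : C(I, E)) (t : I) :
    integralCLM E u t = ∫ τ in (0 : ℝ)..t, IccExtend zero_le_one u τ := rfl

/-- The linear map `((e, s), y) ↦ (t ↦ (y t, t s, s))`. -/
def rayCLM (E P : Type*) [NormedAddCommGroup E] [NormedSpace ℝ E]
    [NormedAddCommGroup P] [NormedSpace ℝ P] [FiniteDimensional ℝ P] :
    ((E × P) × C(I, E)) →L[ℝ] C(I, E × P × P) :=
  ((ContinuousLinearMap.inl ℝ E (P × P)).compLeftContinuous ℝ I).comp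
      (ContinuousLinearMap.snd ℝ (E × P) C(I, E)) +
    (LinearMap.toContinuousLinearMap (𝕜 := ℝ) (E := P) (F' := C(I, E × P × P))
      { toFun := fun s ↦ ⟨fun t ↦ (0, (t : ℝ) • s, s), by fun_prop⟩
        map_add' := fun _ _ ↦ by ext <;> simp
        map_smul' := fun c s ↦ by ext <;> simp [smul_comm c] }).comp
      ((ContinuousLinearMap.snd ℝ E P).comp (ContinuousLinearMap.fst ℝ (E × P) C(I, E)))

omit [CompleteSpace E] in
theorem rayCLM_apply (z : (E × P) × C(I, E)) (t : I) :
    rayCLM E P z t = (z.2 t, (t : ℝ) • z.1.2, z.1.2) := by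
  simp [rayCLM]

end TotalDifferential

section TotalDifferential

open unitInterval

variable {E P : Type u} [NormedAddCommGroup E] [NormedSpace ℝ E] [CompleteSpace E]
  [NormedAddCommGroup P] [NormedSpace ℝ P] [FiniteDimensional ℝ P]

/-- The right-hand side `A(y, p) s` of the differential equation along rays. -/
def rayField (A : E × P → P →L[ℝ] E) (z : E × P × P) : E := A (z.1, z.2.1) z.2.2

omit [CompleteSpace E] [FiniteDimensional ℝ P] in
theorem contDiff_rayField {A : E × P → P →L[ℝ] E} (hA : ContDiff ℝ ∞ A) :
    ContDiff ℝ ∞ (rayField A) := by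
  unfold rayField
  have h1 : ContDiff ℝ ∞ fun z : E × P × P ↦ A (z.1, z.2.1) := hA.comp (by fun_prop)
  exact h1.clm_apply (by fun_prop)

omit [CompleteSpace E] [FiniteDimensional ℝ P] in
theorem fderiv_rayField {A : E × P → P →L[ℝ] E} (hA : ContDiff ℝ ∞ A) (z h : E × P × P) :
    fderiv ℝ (rayField A) z h =
      fderiv ℝ A (z.1, z.2.1) (h.1, h.2.1) z.2.2 + A (z.1, z.2.1) h.2.2 := by
  have h1 : HasFDerivAt (fun z : E × P × P ↦ A (z.1, z.2.1))
      ((fderiv ℝ A (z.1, z.2.1)).comp ((ContinuousLinearMap.fst ℝ E (P × P)).prod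
        ((ContinuousLinearMap.fst ℝ P P).comp (ContinuousLinearMap.snd ℝ E (P × P))))) z :=
    HasFDerivAt.comp z (hA.differentiable (by simp) _).hasFDerivAt
      ((ContinuousLinearMap.fst ℝ E (P × P)).prod ((ContinuousLinearMap.fst ℝ P P).comp
        (ContinuousLinearMap.snd ℝ E (P × P)))).hasFDerivAt
  have h2 : HasFDerivAt (fun z : E × P × P ↦ z.2.2)
      ((ContinuousLinearMap.snd ℝ P P).comp (ContinuousLinearMap.snd ℝ E (P × P))) z :=
    ((ContinuousLinearMap.snd ℝ P P).comp (ContinuousLinearMap.snd ℝ E (P × P))).hasFDerivAt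
  have h3 : HasFDerivAt (rayField A) _ z := h1.clm_apply h2
  rw [h3.fderiv]
  simp [add_comm]

/-- The solutions of `dy/dt = A(y, t s) s`, `y(0) = e`, on the unit interval, depend smoothly on
`(e, s)` near `(e₀, 0)`: the implicit function theorem applies to the integral equation, as the
right-hand side and its derivative with respect to `y` vanish for `s = 0`. -/
theorem exists_ray_solution {A : E × P → P →L[ℝ] E} (hA : ContDiff ℝ ∞ A) (e₀ : E) :
    ∃ (N : Set (E × P)) (y : E × P → C(I, E)), IsOpen N ∧ (e₀, 0) ∈ N ∧ ContDiffOn ℝ ∞ y N ∧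
      y (e₀, 0) = ContinuousMap.const I e₀ ∧ ∀ z ∈ N, y z = ContinuousLinearMap.const ℝ I z.1 +
        integralCLM E ((⟨rayField A, (contDiff_rayField hA).continuous⟩ : C(E × P × P, E)).comp
          (rayCLM E P (z, y z))) := by
  have hf := contDiff_rayField hA
  set f : C(E × P × P, E) := ⟨rayField A, hf.continuous⟩ with hfdef
  let Ψ : (E × P) × C(I, E) → C(I, E) := fun u ↦
    u.2 - ContinuousLinearMap.const ℝ I u.1.1 - integralCLM E (f.comp (rayCLM E P u))
  have hcomp : ContDiff ℝ ∞ fun u : C(I, E × P × P) ↦ f.comp u := contDiff_comp_continuousMap hf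
  have hΨ : ContDiff ℝ ∞ Ψ := by
    refine (contDiff_snd.sub ?_).sub ?_
    · exact (ContinuousLinearMap.const ℝ I : E →L[ℝ] C(I, E)).contDiff.comp (contDiff_fst.comp contDiff_fst)
    · exact (integralCLM E).contDiff.comp (hcomp.comp (rayCLM E P).contDiff)
  have h₀ : Ψ ((e₀, 0), ContinuousMap.const I e₀) = 0 := by
    ext t
    simp [Ψ, integralCLM_apply, IccExtend, Function.comp_def, f, rayField, rayCLM_apply]
  have hd₀ : ∀ h, fderiv ℝ Ψ ((e₀, 0), ContinuousMap.const I e₀) (0, h) = h := by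
    intro h
    have hd := hasFDerivAt_comp_continuousMap
      (ContinuousLinearMap.id ℝ (E × P × P →L[ℝ] E)) (fun _ ↦ le_rfl) f
      ⟨fderiv ℝ (rayField A), hf.continuous_fderiv (by simp)⟩
      (fun x ↦ (hf.differentiable (by simp) x).hasFDerivAt)
      (rayCLM E P ((e₀, 0), ContinuousMap.const I e₀))
    have h1 : HasFDerivAt Ψ _ ((e₀, 0), ContinuousMap.const I e₀) :=
      ((hasFDerivAt_snd.sub ((ContinuousLinearMap.const ℝ I : E →L[ℝ] C(I, E)).hasFDerivAt.comp _
        (hasFDerivAt_fst.comp _ hasFDerivAt_fst))).sub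
      ((integralCLM E).hasFDerivAt.comp _ (hd.comp _ (rayCLM E P).hasFDerivAt)))
    rw [h1.fderiv]
    ext t
    simp [integralCLM_apply, IccExtend, rayCLM_apply, fderiv_rayField hA]
  obtain ⟨N, y, hN, h0, hy, hy0, hyN⟩ := exists_contDiffOn_implicit hΨ h₀ hd₀
  refine ⟨N, y, hN, h0, hy, hy0, fun z hz ↦ ?_⟩
  have h := hyN z hz
  simp only [Ψ, sub_sub, sub_eq_zero] at h
  exact h

end TotalDifferential

section TotalDifferential

open unitInterval

variable {E P : Type u} [NormedAddCommGroup E] [NormedSpace ℝ E]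
  [NormedAddCommGroup P] [NormedSpace ℝ P] [FiniteDimensional ℝ P]

/-- A function which is smooth near a point agrees near that point with a globally smooth one. -/
theorem exists_contDiff_eventuallyEq {E F : Type*} [NormedAddCommGroup E] [NormedSpace ℝ E]
    [FiniteDimensional ℝ E] [NormedAddCommGroup F] [NormedSpace ℝ F] {f : E → F} {Ω : Set E}
    (hΩ : IsOpen Ω) (hf : ContDiffOn ℝ ∞ f Ω) {x : E} (hx : x ∈ Ω) :
    ∃ f' : E → F, ContDiff ℝ ∞ f' ∧ f' =ᶠ[𝓝 x] f := by
  obtain ⟨ε, hε, hball⟩ := Metric.nhds_basis_closedBall.mem_iff.1 (hΩ.mem_nhds hx)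
  let χ : ContDiffBump x := ⟨ε / 2, ε, by positivity, by linarith⟩
  refine ⟨fun y ↦ χ y • f y, ?_, ?_⟩
  · rw [contDiff_iff_contDiffAt]
    intro y
    by_cases hy : y ∈ tsupport χ
    · rw [χ.tsupport_eq] at hy
      exact χ.contDiffAt.smul (hf.contDiffAt (hΩ.mem_nhds (hball hy)))
    · have h1 : (fun y ↦ χ y • f y) =ᶠ[𝓝 y] fun _ ↦ 0 := by
        filter_upwards [(isClosed_tsupport χ).isOpen_compl.mem_nhds hy] with z hz
        rw [image_eq_zero_of_notMem_tsupport hz, zero_smul]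
      exact contDiffAt_const.congr_of_eventuallyEq h1
  · filter_upwards [χ.eventuallyEq_one] with y hy
    simp [hy]

/-- The solution of the differential equation along rays solves the total differential equation
`∂y/∂s = A(y, s)`, provided that the latter is involutive: the difference of the two sides solves a
homogeneous linear differential equation along each ray. -/
theorem fderiv_ray_solution [CompleteSpace E] {A : E × P → P →L[ℝ] E} (hA : ContDiff ℝ ∞ A)
    {N : Set (E × P)} (hN : IsOpen N) {y : E × P → C(I, E)} (hy : ContDiffOn ℝ ∞ y N)
    (heq : ∀ z ∈ N, y z = ContinuousLinearMap.const ℝ I z.1 +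
        integralCLM E ((⟨rayField A, (contDiff_rayField hA).continuous⟩ : C(E × P × P, E)).comp
          (rayCLM E P (z, y z)))) {z : E × P} (hz : z ∈ N)
    (hinv : ∀ t : I, ∀ ν τ, fderiv ℝ A (y z t, (t : ℝ) • z.2) (A (y z t, (t : ℝ) • z.2) ν, ν) τ =
      fderiv ℝ A (y z t, (t : ℝ) • z.2) (A (y z t, (t : ℝ) • z.2) τ, τ) ν) (ν : P) :
    fderiv ℝ (fun z ↦ y z 1) z (0, ν) = A (y z 1, z.2) ν := by
  have hf := contDiff_rayField hA
  set f : C(E × P × P, E) := ⟨rayField A, hf.continuous⟩ with hfdef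
  have hyd : HasFDerivAt y (fderiv ℝ y z) z :=
    ((hy.contDiffAt (hN.mem_nhds hz)).differentiableAt (by simp)).hasFDerivAt
  set η : C(I, E) := fderiv ℝ y z (0, ν) with hη
  -- the linearized integral equation, satisfied by the derivative of the solution
  have hηeq : ∀ t : I, η t = ∫ τ in (0 : ℝ)..t, IccExtend zero_le_one
      (fun t : I ↦ fderiv ℝ (rayField A) (y z t, (t : ℝ) • z.2, z.2) (η t, (t : ℝ) • ν, ν)) τ := by
    intro t
    have hd := hasFDerivAt_comp_continuousMap
      (ContinuousLinearMap.id ℝ (E × P × P →L[ℝ] E)) (fun _ ↦ le_rfl) f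
      ⟨fderiv ℝ (rayField A), hf.continuous_fderiv (by simp)⟩
      (fun x ↦ (hf.differentiable (by simp) x).hasFDerivAt) (rayCLM E P (z, y z))
    have h1 := (((ContinuousLinearMap.const ℝ I : E →L[ℝ] C(I, E)).hasFDerivAt.comp z
      hasFDerivAt_fst).add ((integralCLM E).hasFDerivAt.comp z (hd.comp z
        ((rayCLM E P).hasFDerivAt.comp z ((hasFDerivAt_id z).prodMk hyd)))))
    have h2 := (h1.congr_of_eventuallyEq (f₁ := y) (by
      filter_upwards [hN.mem_nhds hz] with z' hz'
      exact heq z' hz')).unique hyd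
    have h3 := congrArg (fun u : C(I, E) ↦ u t) (DFunLike.congr_fun h2 (0, ν))
    rw [← hη] at h3
    refine h3.symm.trans ?_
    simp only [add_apply, ContinuousLinearMap.comp_apply,
      ContinuousMap.add_apply, integralCLM_apply]
    have h4 : (ContinuousLinearMap.const ℝ I : E →L[ℝ] C(I, E))
      ((ContinuousLinearMap.fst ℝ E P) (0, ν)) t = 0 := rfl
    rw [h4, zero_add]
    congr 1
    funext τ
    simp only [IccExtend, Function.comp_apply, pointwiseCLM_apply, ContinuousMap.comp_apply,
      rayCLM_apply]
    rfl
  set g₁ : I → E := fun t ↦ A (y z t, (t : ℝ) • z.2) z.2 with hg₁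
  set g₂ : I → E := fun t ↦
    fderiv ℝ (rayField A) (y z t, (t : ℝ) • z.2, z.2) (η t, (t : ℝ) • ν, ν) with hg₂
  have hAc : Continuous A := hA.continuous
  have hA'c : Continuous (fderiv ℝ A) := hA.continuous_fderiv (by simp)
  have hf'c : Continuous (fderiv ℝ (rayField A)) := hf.continuous_fderiv (by simp)
  have hg₁c : Continuous g₁ := by fun_prop
  have hg₂c : Continuous g₂ := by fun_prop
  -- extend the solution and its derivative to all times
  set a : ℝ → E := fun t ↦ z.1 + ∫ τ in (0 : ℝ)..t, IccExtend zero_le_one g₁ τ with ha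
  set b : ℝ → E := fun t ↦ ∫ τ in (0 : ℝ)..t, IccExtend zero_le_one g₂ τ with hb
  have had : ∀ t, HasDerivAt a (IccExtend zero_le_one g₁ t) t := fun t ↦
    ((hg₁c.Icc_extend').integral_hasStrictDerivAt 0 t).hasDerivAt.const_add _
  have hbd : ∀ t, HasDerivAt b (IccExtend zero_le_one g₂ t) t := fun t ↦
    ((hg₂c.Icc_extend').integral_hasStrictDerivAt 0 t).hasDerivAt
  have hay : ∀ t : I, a t = y z t := fun t ↦ by
    have h := congrArg (fun u : C(I, E) ↦ u t) (heq z hz)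
    refine Eq.trans ?_ h.symm
    simp only [ContinuousMap.add_apply, integralCLM_apply, ha]
    congr 2
    funext τ
    simp only [IccExtend, Function.comp_apply, ContinuousMap.comp_apply, rayCLM_apply]
    rfl
  have hbη : ∀ t : I, b t = η t := fun t ↦ (hηeq t).symm
  -- the difference of the two sides at time `t`, which satisfies a homogeneous linear equation
  set k : ℝ → E := fun t ↦ b t - t • A (a t, t • z.2) ν with hk
  have hkd : ∀ t ∈ I, HasDerivAt k (fderiv ℝ A (a t, t • z.2) (k t, 0) z.2) t := by
    intro t ht
    have h1 : HasDerivAt (fun t ↦ (a t, t • z.2)) (IccExtend zero_le_one g₁ t, z.2) t := by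
      simpa using (had t).prodMk ((hasDerivAt_id t).smul_const z.2)
    have h2 : HasDerivAt (fun t ↦ A (a t, t • z.2) ν)
        (fderiv ℝ A (a t, t • z.2) (IccExtend zero_le_one g₁ t, z.2) ν) t := by
      have h3 := ((hA.differentiable (by simp) (a t, t • z.2)).hasFDerivAt).comp_hasDerivAt t h1
      simpa using h3.clm_apply (hasDerivAt_const t ν)
    have h4 := (hbd t).sub ((hasDerivAt_id t).smul h2)
    refine h4.congr_deriv ?_
    have e1 : IccExtend zero_le_one g₁ t = A (a t, t • z.2) z.2 := by
      rw [IccExtend_of_mem _ _ ht, hg₁]; simp only; rw [← hay]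
    have e2 : IccExtend zero_le_one g₂ t =
        fderiv ℝ A (a t, t • z.2) (b t, t • ν) z.2 + A (a t, t • z.2) ν := by
      rw [IccExtend_of_mem _ _ ht, hg₂]; simp only; rw [fderiv_rayField hA, ← hay, ← hbη]
    have e3 := hinv ⟨t, ht⟩ z.2 ν
    rw [← hay] at e3
    simp only at e3
    have e4 : ((k t, 0) : E × P) = (b t, t • ν) - t • (A (a t, t • z.2) ν, ν) := by
      ext <;> simp [hk]
    rw [e1, e2, e4, map_sub, map_smul]
    simp only [id, sub_apply, smul_apply, one_smul]
    rw [e3]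
    abel
  have hac : Continuous a := continuous_iff_continuousAt.2 fun t ↦ (had t).continuousAt
  have hB : ContDiff ℝ ∞ fun w ↦ A w z.2 := hA.clm_apply contDiff_const
  have hBA : ∀ w h, fderiv ℝ (fun w ↦ A w z.2) w h = fderiv ℝ A w h z.2 := fun w h ↦ by
    have h1 := ((hA.differentiable (by simp) w).hasFDerivAt).clm_apply (hasFDerivAt_const z.2 w)
    rw [h1.fderiv]
    simp
  have hB' : Continuous (fderiv ℝ fun w ↦ A w z.2) := hB.continuous_fderiv (by simp)
  have hcont : Continuous fun t ↦ ‖fderiv ℝ (fun w ↦ A w z.2) (a t, t • z.2)‖ := by fun_prop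
  obtain ⟨C, hC⟩ := (isCompact_Icc (a := (0 : ℝ)) (b := 1)).bddAbove_image hcont.continuousOn
  have hk0 := eq_zero_of_abs_deriv_le_mul_abs_self_of_eq_zero_right (f := k)
    (f' := fun t ↦ fderiv ℝ A (a t, t • z.2) (k t, 0) z.2) (K := C) (a := 0) (b := 1)
    (fun t ht ↦ (hkd t ht).continuousAt.continuousWithinAt)
    (fun t ht ↦ (hkd t ⟨ht.1, ht.2.le⟩).hasDerivWithinAt) (by simp [hk, hb]) (fun t ht ↦ by
      have h1 : ‖fderiv ℝ (fun w ↦ A w z.2) (a t, t • z.2)‖ ≤ C := hC ⟨t, ⟨ht.1, ht.2.le⟩, rfl⟩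
      have h3 : ‖((k t, 0) : E × P)‖ = ‖k t‖ := by simp [Prod.norm_def]
      rw [← hBA, ← h3]
      exact (ContinuousLinearMap.le_opNorm _ _).trans (by gcongr)) 1 ⟨zero_le_one, le_rfl⟩
  have h1 : fderiv ℝ (fun z ↦ y z 1) z (0, ν) = η 1 := by
    have h2 : HasFDerivAt (fun z ↦ y z 1)
      (((ContinuousMap.evalCLM ℝ (1 : I) : C(I, E) →L[ℝ] E)).comp (fderiv ℝ y z)) z :=
      (ContinuousMap.evalCLM ℝ (1 : I) : C(I, E) →L[ℝ] E).hasFDerivAt.comp z hyd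
    rw [h2.fderiv]; rfl
  have e1 := hay 1
  have e2 := hbη 1
  simp only [Icc.coe_one] at e1 e2
  rw [h1, ← e1, ← e2]
  simpa [hk, sub_eq_zero] using hk0

/-- Frobenius' theorem, for total differential equations: an involutive equation
`∂Y/∂s = A(Y, s)` has a solution, smoothly dependent on the initial value `Y(e, 0) = e`. -/
theorem exists_totalDifferential [FiniteDimensional ℝ E] {A : E × P → P →L[ℝ] E} {Ω : Set (E × P)}
    (hΩ : IsOpen Ω) (hA : ContDiffOn ℝ ∞ A Ω) {e₀ : E} (h₀ : (e₀, 0) ∈ Ω)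
    (hinv : ∀ z ∈ Ω, ∀ ν τ, fderiv ℝ A z (A z ν, ν) τ = fderiv ℝ A z (A z τ, τ) ν) :
    ∃ (N : Set (E × P)) (Y : E × P → E), IsOpen N ∧ (e₀, 0) ∈ N ∧ ContDiffOn ℝ ∞ Y N ∧
      (∀ e, (e, 0) ∈ N → Y (e, 0) = e) ∧
      ∀ z ∈ N, (Y z, z.2) ∈ Ω ∧ ∀ ν, fderiv ℝ Y z (0, ν) = A (Y z, z.2) ν := by
  have : CompleteSpace E := FiniteDimensional.complete ℝ E
  -- the equation along rays is solved for a globally defined right-hand side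
  obtain ⟨A', hA', hAA'⟩ := exists_contDiff_eventuallyEq hΩ hA h₀
  obtain ⟨N, y, hN, hN0, hy, hy0, hyN⟩ := exists_ray_solution hA' e₀
  have hnear : ∀ᶠ z in 𝓝 (e₀, 0), z ∈ Ω ∧ A' =ᶠ[𝓝 z] A :=
    Filter.Eventually.and (hΩ.mem_nhds h₀) hAA'.eventually_nhds
  obtain ⟨ε, hε, hball⟩ := Metric.eventually_nhds_iff_ball.1 hnear
  have hcont : ContinuousOn (fun z ↦ (y z, z.2)) N := hy.continuousOn.prodMk continuousOn_snd
  have hopen : IsOpen (N ∩ (fun z ↦ (y z, z.2)) ⁻¹'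
      (Metric.ball (ContinuousMap.const I e₀) ε ×ˢ Metric.ball 0 ε)) :=
    hcont.isOpen_inter_preimage hN (Metric.isOpen_ball.prod Metric.isOpen_ball)
  have hmem : ∀ z ∈ N ∩ (fun z ↦ (y z, z.2)) ⁻¹'
      (Metric.ball (ContinuousMap.const I e₀) ε ×ˢ Metric.ball 0 ε), ∀ t : I,
      (y z t, (t : ℝ) • z.2) ∈ Metric.ball (e₀, (0 : P)) ε := by
    rintro z ⟨-, h1, h2⟩ t
    rw [← ball_prod_same]
    refine ⟨(ContinuousMap.dist_apply_le_dist t).trans_lt h1, ?_⟩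
    simp only [mem_ball_zero_iff] at h2 ⊢
    rw [norm_smul, Real.norm_of_nonneg t.2.1]
    exact lt_of_le_of_lt (mul_le_of_le_one_left (norm_nonneg _) t.2.2) h2
  refine ⟨_, fun z ↦ y z 1, hopen, ⟨hN0, ?_, ?_⟩, ?_, ?_, ?_⟩
  · simp [hy0, hε]
  · simpa using hε
  · exact (ContinuousMap.evalCLM ℝ (1 : I) : C(I, E) →L[ℝ] E).contDiff.comp_contDiffOn
      (hy.mono inter_subset_left)
  · intro e he
    have h := congrArg (fun u : C(I, E) ↦ u 1) (hyN _ he.1)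
    refine h.trans ?_
    simp [integralCLM_apply, IccExtend, Function.comp_def, rayField, rayCLM_apply]
  · intro z hz
    have h1 := hmem z hz 1
    simp only [Icc.coe_one, one_smul] at h1
    refine ⟨(hball _ h1).1, fun ν ↦ ?_⟩
    rw [← (hball _ h1).2.self_of_nhds]
    refine fderiv_ray_solution hA' hN hy hyN hz.1 (fun t ν τ ↦ ?_) ν
    obtain ⟨h2, h3⟩ := hball _ (hmem z hz t)
    rw [h3.fderiv_eq, h3.self_of_nhds]
    exact hinv _ h2 ν τ

end TotalDifferential

/-! ### Charts adapted to a metric and a null distribution -/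

section FirstComponent

theorem mvfderiv_chart_fst {n : ℕ} {M : Type u} [TopologicalSpace M] [ChartedSpace (Eucl n) M]
    {F G : Type*} [NormedAddCommGroup F] [NormedSpace ℝ F] [NormedAddCommGroup G] [NormedSpace ℝ G]
    {φ : OpenPartialHomeomorph M (F × G)} (hφ : IsSmoothChart (n := n) φ) {x : M}
    (hx : x ∈ φ.source) (v : TangentSpace (𝓡 n) x) :
    mvfderiv (𝓡 n) (fun y ↦ (φ y).1) x v = (mvfderiv (𝓡 n) φ x v).1 := by
  refine (mvfderiv_fderiv_comp (h := Prod.fst) differentiableAt_fst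
    (hφ.mdifferentiableAt hx) v).trans ?_
  rw [fderiv_fst]; rfl

end FirstComponent

section AdaptedChart

variable {n q : ℕ} {M : Type u} [TopologicalSpace M] [ChartedSpace (Eucl n) M]
  [IsManifold (𝓡 n) ∞ M]
  {S : Type v} [TopologicalSpace S] [ChartedSpace (Eucl q) S] [IsManifold (𝓡 q) ∞ S]
  {F : Type*} [NormedAddCommGroup F] [NormedSpace ℝ F] [FiniteDimensional ℝ F]

/-- A chart `(q, p)` with values in `F × F*` which is adapted to the metric `g` and the
distribution `V`: the leaves of `V` are given by `q = const`, and `g(∂_p, ·) = dq`, while the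
derivative of the metric coefficients in the direction of `∂_p` is `-2Γ(q)`, for a function `Γ` of
`q` only, which is smooth on an open set `Q` containing the values of `q`. -/
structure IsAdaptedChart (g : PseudoRiemannianMetric n M)
    (V : ∀ x : M, Submodule ℝ (TangentSpace (𝓡 n) x))
    (φ : OpenPartialHomeomorph M (F × (F →L[ℝ] ℝ))) (Q : Set F) (Γ : F → F →L[ℝ] F →L[ℝ] F) :
    Prop where
  chart : IsSmoothChart (n := n) φ
  mem_iff : ∀ y ∈ φ.source, ∀ v, v ∈ V y ↔ (mvfderiv (𝓡 n) φ y v).1 = 0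
  standard : ∀ y ∈ φ.source, ∀ (η : F →L[ℝ] ℝ) (w : TangentSpace (𝓡 n) y),
    g.form y (coordField φ (0, η) y) w = η (mvfderiv (𝓡 n) φ y w).1
  isOpen : IsOpen Q
  mapsTo : ∀ y ∈ φ.source, (φ y).1 ∈ Q
  smooth : ContDiffOn ℝ ∞ Γ Q
  deriv : ∀ y ∈ φ.source, ∀ (η : F →L[ℝ] ℝ) (a b : F × (F →L[ℝ] ℝ)),
    mvfderiv (𝓡 n) (fun y ↦ g.form y (coordField φ a y) (coordField φ b y)) y
      (coordField φ (0, η) y) = -2 * η (Γ (φ y).1 a.1 b.1)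

namespace IsAdaptedChart

variable {g : PseudoRiemannianMetric n M} {V : ∀ x : M, Submodule ℝ (TangentSpace (𝓡 n) x)}
  {φ : OpenPartialHomeomorph M (F × (F →L[ℝ] ℝ))} {Q : Set F} {Γ : F → F →L[ℝ] F →L[ℝ] F}
  {D : Connection n M} {x : M}

theorem fst_coord_eq (hφ : IsAdaptedChart g V φ Q Γ) (hD : IsLeviCivita g D) (hx : x ∈ φ.source)
    {w : ∀ x : M, TangentSpace (𝓡 n) x} (hw : MDifferentiableAt (𝓡 n) (𝓡 n).tangent
      (fun y ↦ (⟨y, w y⟩ : TangentBundle (𝓡 n) M)) x) (u : TangentSpace (𝓡 n) x) :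
    (mvfderiv (𝓡 n) φ x (D w x u)).1 =
      mvfderiv (𝓡 n) (fun y ↦ (mvfderiv (𝓡 n) φ y (w y)).1) x u
        + Γ (φ x).1 (mvfderiv (𝓡 n) φ x u).1 (mvfderiv (𝓡 n) φ x (w x)).1 :=
  hD.fst_coord_eq hφ.chart hφ.standard hx (G := fun a b ↦ Γ (φ x).1 a b)
    (fun η a b ↦ hφ.deriv x hx η a b) hw u

theorem isNull (h : ∀ x, ∃ (φ : OpenPartialHomeomorph M (F × (F →L[ℝ] ℝ))) (Q : Set F)
    (Γ : F → F →L[ℝ] F →L[ℝ] F), x ∈ φ.source ∧ IsAdaptedChart g V φ Q Γ) : IsNull g V := by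
  intro x v hv w hw
  obtain ⟨φ, Q, Γ, hx, hφ⟩ := h x
  rw [hφ.mem_iff x hx] at hv hw
  have h1 := hφ.standard x hx (mvfderiv (𝓡 n) φ x v).2 w
  have h2 : ((0, (mvfderiv (𝓡 n) φ x v).2) : F × (F →L[ℝ] ℝ)) = mvfderiv (𝓡 n) φ x v :=
    Prod.ext hv.symm rfl
  rwa [h2, hφ.chart.coordField_mvfderiv hx, hw, map_zero] at h1

/-- If the `q`-components of a field vanish, so do those of its covariant derivatives. -/
theorem isParallel (hD : IsLeviCivita g D)
    (h : ∀ x, ∃ (φ : OpenPartialHomeomorph M (F × (F →L[ℝ] ℝ))) (Q : Set F)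
      (Γ : F → F →L[ℝ] F →L[ℝ] F), x ∈ φ.source ∧ IsAdaptedChart g V φ Q Γ) :
    IsParallel D V := by
  intro U w hU hw hwV x hx u
  obtain ⟨φ, Q, Γ, hxφ, hφ⟩ := h x
  rw [hφ.mem_iff x hxφ, hφ.fst_coord_eq hD hxφ
    ((hw.contMDiffAt (hU.mem_nhds hx)).mdifferentiableAt (by simp)),
    (hφ.mem_iff x hxφ _).1 (hwV x hx), map_zero, add_zero]
  have h1 : (fun y ↦ (mvfderiv (𝓡 n) φ y (w y)).1) =ᶠ[𝓝 x] fun _ ↦ 0 := by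
    filter_upwards [hU.mem_nhds hx, φ.open_source.mem_nhds hxφ] with y hy hyφ
    exact (hφ.mem_iff y hyφ _).1 (hwV y hy)
  rw [mvfderiv_congr_of_eventuallyEq h1, mvfderiv_const]
  rfl

/-- The Levi-Civita connection is projectable if there are adapted charts: in such a chart, the
Christoffel symbols which determine the transversal component of a covariant derivative are
functions of the leaf. -/
theorem isProjectable (hF : Module.finrank ℝ F = q) (hD : IsLeviCivita g D)
    (h : ∀ x, ∃ (φ : OpenPartialHomeomorph M (F × (F →L[ℝ] ℝ))) (Q : Set F)
      (Γ : F → F →L[ℝ] F →L[ℝ] F), x ∈ φ.source ∧ IsAdaptedChart g V φ Q Γ) :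
    IsProjectable.{u, v} q D V := by
  intro U' v w hU' hv hw hvp hwp S _ _ _ _ _ _ U pr hUU' hpr
  obtain ⟨v', hv', hvv'⟩ := hvp S U pr hUU' hpr
  obtain ⟨w', hw', hww'⟩ := hwp S U pr hUU' hpr
  refine hpr.exists_projectsTo hF fun x hx ↦ ?_
  obtain ⟨φ, Q, Γ, hxφ, hφ⟩ := h x
  have hUo := hpr.bundle.isOpen
  have hO : IsOpen (φ.source ∩ U) := φ.open_source.inter hUo
  have hρ : ContMDiffOn (𝓡 n) 𝓘(ℝ, F) ∞ (fun y ↦ (φ y).1) φ.source :=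
    contDiff_fst.contMDiff.comp_contMDiffOn hφ.chart.smooth
  have hker : ∀ y ∈ φ.source, ∀ v, mvfderiv (𝓡 n) (fun y ↦ (φ y).1) y v = 0 ↔ v ∈ V y := by
    intro y hy v
    rw [hφ.mem_iff y hy, mvfderiv_chart_fst hφ.chart hy]
  obtain ⟨O, W, ν, hOo, hxO, hOO, hW, hOW, hν, hνO, hprν, hfac⟩ :=
    hpr.bundle.exists_factor hO inter_subset_right (hρ.mono inter_subset_left)
      (fun y hy v hv ↦ (hker y hy.1 v).2 (by rw [← hpr.ker_eq y hy.2]; exact hv)) ⟨hxφ, hx⟩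
  -- `χ` are the coordinates `q`, as functions on the leaf space
  set χ : S → F := fun y ↦ (φ (ν y)).1 with hχdef
  have hχ : ContMDiffOn (𝓡 q) 𝓘(ℝ, F) ∞ χ W := hρ.comp hν fun y hy ↦ (hOO (hνO hy)).1
  have hdv : ContMDiffOn (𝓡 q) 𝓘(ℝ, F) ∞ (fun y ↦ mvfderiv (𝓡 q) χ y (v' y)) W :=
    contMDiffOn_mvfderiv_apply hW hχ (hv'.mono (subset_univ _))
  have hdw : ContMDiffOn (𝓡 q) 𝓘(ℝ, F) ∞ (fun y ↦ mvfderiv (𝓡 q) χ y (w' y)) W :=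
    contMDiffOn_mvfderiv_apply hW hχ (hw'.mono (subset_univ _))
  have hprd : ∀ y ∈ O, MDifferentiableAt (𝓡 n) (𝓡 q) pr y := fun y hy ↦
    (hpr.bundle.smooth.contMDiffAt (hUo.mem_nhds (hOO hy).2)).mdifferentiableAt (by simp)
  have hproj : ∀ y ∈ O, ∀ u, mvfderiv (𝓡 n) (fun y ↦ (φ y).1) y u =
      mvfderiv (𝓡 q) χ (pr y) (mfderiv (𝓡 n) (𝓡 q) pr y u) := by
    intro y hy u
    rw [← mvfderiv_comp_mfderiv
      ((hχ.contMDiffAt (hW.mem_nhds (hOW hy))).mdifferentiableAt (by simp)) (hprd y hy)]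
    congr 1
    apply mvfderiv_congr_of_eventuallyEq
    filter_upwards [hOo.mem_nhds hy] with z hz using hfac z hz
  refine ⟨O, W, fun y ↦ (φ y).1, fun y ↦
    mvfderiv (𝓡 q) (fun y ↦ mvfderiv (𝓡 q) χ y (w' y)) y (v' y)
      + Γ (χ y) (mvfderiv (𝓡 q) χ y (v' y)) (mvfderiv (𝓡 q) χ y (w' y)),
    hOo, hxO, fun y hy ↦ (hOO hy).2, hW, hOW, hρ.mono fun y hy ↦ (hOO hy).1,
    fun y hy v ↦ hker y (hOO hy).1 v, ?_, ?_⟩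
  · refine (contMDiffOn_mvfderiv_apply hW hdw (hv'.mono (subset_univ _))).add ?_
    have h1 : ContMDiffOn (𝓡 q) 𝓘(ℝ, F →L[ℝ] F →L[ℝ] F) ∞ (fun y ↦ Γ (χ y)) W :=
      hφ.smooth.contMDiffOn.comp hχ fun y hy ↦ hφ.mapsTo _ (hOO (hνO hy)).1
    exact (h1.clm_apply hdv).clm_apply hdw
  · intro y hy
    have hyφ := (hOO hy).1
    have hyU := (hOO hy).2
    have h1 : (fun y ↦ (mvfderiv (𝓡 n) φ y (w y)).1) =ᶠ[𝓝 y]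
        fun y ↦ (fun y ↦ mvfderiv (𝓡 q) χ y (w' y)) (pr y) := by
      filter_upwards [hOo.mem_nhds hy] with z hz
      rw [← mvfderiv_chart_fst hφ.chart (hOO hz).1, hproj z hz, hww' z (hOO hz).2]
    have hwy := (hw.contMDiffAt (hU'.mem_nhds (hUU' hyU))).mdifferentiableAt
      (show (∞ : ℕ∞ω) ≠ 0 by simp)
    rw [mvfderiv_chart_fst hφ.chart hyφ, covDeriv, hφ.fst_coord_eq hD hyφ hwy,
      ← mvfderiv_chart_fst hφ.chart hyφ, ← mvfderiv_chart_fst hφ.chart hyφ, hproj y hy, hproj y hy,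
      hvv' y hyU, hww' y hyU, mvfderiv_congr_of_eventuallyEq h1, mvfderiv_comp_mfderiv
        ((hdw.contMDiffAt (hW.mem_nhds (hOW hy))).mdifferentiableAt (by simp)) (hprd y hy),
      hvv' y hyU, hfac y hy]

/-- The projection of the Levi-Civita connection onto a leaf space is computed in adapted charts:
it is the connection with the Christoffel symbols `Γ`. -/
theorem isProjectedConnection (hD : IsLeviCivita g D) {U : Set M} {pr : M → S}
    (hpr : IsLeafFibration (q := q) V U pr) {D' : Connection q S}
    (h : ∀ x ∈ U, ∃ (φ : OpenPartialHomeomorph M (F × (F →L[ℝ] ℝ))) (Q : Set F)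
      (Γ : F → F →L[ℝ] F →L[ℝ] F) (c : OpenPartialHomeomorph S F), x ∈ φ.source ∧
      IsAdaptedChart g V φ Q Γ ∧ IsSmoothChart (n := q) c ∧ pr x ∈ c.source ∧
      (∀ᶠ y in 𝓝 x, (φ y).1 = c (pr y)) ∧
      ∀ (b : F) (u : TangentSpace (𝓡 q) (pr x)), mvfderiv (𝓡 q) c (pr x)
        (D' (coordField c b) (pr x) u) = Γ (c (pr x)) (mvfderiv (𝓡 q) c (pr x) u) b) :
    IsProjectedConnection D V U pr D' where
  leafSpace := hpr
  projects := by
    intro v w v' w' hv hw hv' hw' hvv' hww' x hx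
    obtain ⟨φ, Q, Γ, c, hxφ, hφ, hc, hxc, hφc, hΓ⟩ := h x hx
    have hUo := hpr.bundle.isOpen
    have hprd : ∀ y ∈ U, MDifferentiableAt (𝓡 n) (𝓡 q) pr y := fun y hy ↦
      (hpr.bundle.smooth.contMDiffAt (hUo.mem_nhds hy)).mdifferentiableAt (by simp)
    have hnear : ∀ᶠ y in 𝓝 x, y ∈ U ∧ y ∈ φ.source ∧ pr y ∈ c.source ∧
        ∀ u, (mvfderiv (𝓡 n) φ y u).1 =
          mvfderiv (𝓡 q) c (pr y) (mfderiv (𝓡 n) (𝓡 q) pr y u) := by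
      filter_upwards [hUo.mem_nhds hx, φ.open_source.mem_nhds hxφ,
        (hprd x hx).continuousAt (c.open_source.mem_nhds hxc), hφc.eventually_nhds]
        with y hy hyφ hyc hyφc
      refine ⟨hy, hyφ, hyc, fun u ↦ ?_⟩
      rw [← mvfderiv_chart_fst hφ.chart hyφ, ← mvfderiv_comp_mfderiv (hc.mdifferentiableAt hyc)
        (hprd y hy)]
      congr 1
      exact mvfderiv_congr_of_eventuallyEq hyφc
    obtain ⟨-, -, -, hx'⟩ := hnear.self_of_nhds
    have hwx := (hw.contMDiffAt (hUo.mem_nhds hx)).mdifferentiableAt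
      (show (∞ : ℕ∞ω) ≠ 0 by simp)
    have hwx' := (hw'.contMDiffAt (x := pr x) Filter.univ_mem).mdifferentiableAt
      (show (∞ : ℕ∞ω) ≠ 0 by simp)
    have h1 : (fun y ↦ (mvfderiv (𝓡 n) φ y (w y)).1) =ᶠ[𝓝 x]
        fun y ↦ (fun y ↦ mvfderiv (𝓡 q) c y (w' y)) (pr y) := by
      filter_upwards [hnear] with z hz
      rw [hz.2.2.2, hww' z hz.1]
    refine (hc.bijective hxc).1 ?_
    rw [← hx', covDeriv, covDeriv, hφ.fst_coord_eq hD hxφ hwx, hx', hx', hvv' x hx, hww' x hx,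
      mvfderiv_congr_of_eventuallyEq h1, mvfderiv_comp_mfderiv
        (mdifferentiableAt_mvfderiv_apply c.open_source hc.smooth hxc hwx') (hprd x hx),
      hvv' x hx, Connection.coord_eq hc D' hxc hwx', hΓ, hφc.self_of_nhds]

end IsAdaptedChart

end AdaptedChart

/-! ### Charts of a cotangent affine bundle -/

section LeftInverse

variable {n : ℕ} {M : Type u} [TopologicalSpace M] [ChartedSpace (Eucl n) M]
  [IsManifold (𝓡 n) ∞ M]
  {E : Type*} [NormedAddCommGroup E] [NormedSpace ℝ E] [FiniteDimensional ℝ E]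

/-- A smooth map `h : T → M` on an open set of a vector space of the dimension of `M` is the inverse
of a smooth chart if it has a left inverse which is smooth on the (a priori not open) image: by
the chain rule the differentials of `h` are bijective, so that the image is open. -/
theorem exists_isSmoothChart_of_leftInverse (hE : Module.finrank ℝ E = n) {T : Set E}
    (hT : IsOpen T) {h : E → M} (hh : ContMDiffOn 𝓘(ℝ, E) (𝓡 n) ∞ h T) {f : M → E}
    (hf : ContMDiffOn (𝓡 n) 𝓘(ℝ, E) ∞ f (h '' T)) (hfh : ∀ z ∈ T, f (h z) = z) :
    ∃ φ : OpenPartialHomeomorph M E, IsSmoothChart (n := n) φ ∧ φ.source = h '' T ∧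
      φ.target = T ∧ (φ : M → E) = f ∧ (φ.symm : E → M) = h := by
  have hbij : ∀ z ∈ T, Function.Bijective (mfderiv 𝓘(ℝ, E) (𝓡 n) h z) := by
    intro z hz
    have h1 := ((hf (h z) ⟨z, hz, rfl⟩).mdifferentiableWithinAt (by simp)).hasMFDerivWithinAt
    have h2 := ((hh.contMDiffAt (hT.mem_nhds hz)).mdifferentiableAt
      (show (∞ : ℕ∞ω) ≠ 0 by simp)).hasMFDerivAt
    have h3 := HasMFDerivWithinAt.comp z h1 (h2.hasMFDerivWithinAt (s := T))
      fun y hy ↦ ⟨y, hy, rfl⟩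
    have h4 : id =ᶠ[𝓝 z] f ∘ h := by
      filter_upwards [hT.mem_nhds hz] with y hy using (hfh y hy).symm
    have h5 := ((h3.hasMFDerivAt (hT.mem_nhds hz)).congr_of_eventuallyEq h4).mfderiv.symm.trans
      (hasMFDerivAt_id (I := 𝓘(ℝ, E)) z).mfderiv
    have hinj : Function.Injective (mfderiv 𝓘(ℝ, E) (𝓡 n) h z) := by
      intro a b hab
      have ea := DFunLike.congr_fun h5 a
      have eb := DFunLike.congr_fun h5 b
      exact ea.symm.trans ((congrArg
        (mfderivWithin (𝓡 n) 𝓘(ℝ, E) f (h '' T) (h z)) hab).trans eb)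
    refine ⟨hinj, ?_⟩
    have hd : Module.finrank ℝ E = Module.finrank ℝ (Eucl n) := by
      rw [hE]; exact finrank_euclideanSpace_fin.symm
    exact (LinearMap.injective_iff_surjective_of_finrank_eq_finrank hd
        (f := (mfderiv 𝓘(ℝ, E) (𝓡 n) h z : E →L[ℝ] Eucl n).toLinearMap)).1 hinj
  have hopen : IsOpen (h '' T) := by
    rw [isOpen_iff_mem_nhds]
    rintro _ ⟨z, hz, rfl⟩
    set c := chartAt (Eucl n) (h z)
    have hc : IsSmoothChart (n := n) c := isSmoothChart_chartAt (h z)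
    have hzc : h z ∈ c.source := mem_chart_source _ _
    have hO : IsOpen (T ∩ h ⁻¹' c.source) := hh.continuousOn.isOpen_inter_preimage hT c.open_source
    have hch : ContDiffOn ℝ ∞ (fun z ↦ c (h z)) (T ∩ h ⁻¹' c.source) :=
      (hc.smooth.comp (hh.mono inter_subset_left) fun y hy ↦ hy.2).contDiffOn
    have hb : Function.Bijective (fderiv ℝ (fun z ↦ c (h z)) z) := by
      have h1 := mfderiv_comp_apply (I := 𝓘(ℝ, E)) z (hc.mdifferentiableAt hzc)
        ((hh.contMDiffAt (hT.mem_nhds hz)).mdifferentiableAt (by simp))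
      rw [mfderiv_eq_fderiv] at h1
      have h2 : (fderiv ℝ (fun z ↦ c (h z)) z : E → Eucl n) =
          (mvfderiv (𝓡 n) c (h z)) ∘ (mfderiv 𝓘(ℝ, E) (𝓡 n) h z) := funext h1
      rw [h2]
      exact (hc.bijective hzc).comp (hbij z hz)
    obtain ⟨ψ, hzψ, hψO, hψ, -⟩ := exists_openPartialHomeomorph_of_bijective hO hch ⟨hz, hzc⟩ hb
    have h3 : c.source ∩ c ⁻¹' (ψ.target) ∈ 𝓝 (h z) := by
      refine (c.isOpen_inter_preimage ψ.open_target).mem_nhds ⟨hzc, ?_⟩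
      have := ψ.map_source hzψ
      rwa [hψ] at this
    filter_upwards [h3] with x hx
    have h4 := ψ.map_target hx.2
    have h5 := ψ.right_inv hx.2
    rw [hψ] at h5
    refine ⟨ψ.symm (c x), (hψO h4).1, ?_⟩
    exact c.injOn (hψO h4).2 hx.1 h5
  let φ : OpenPartialHomeomorph M E :=
    { toFun := f
      invFun := h
      source := h '' T
      target := T
      map_source' := by rintro _ ⟨z, hz, rfl⟩; rwa [hfh z hz]
      map_target' := fun z hz ↦ ⟨z, hz, rfl⟩
      left_inv' := by rintro _ ⟨z, hz, rfl⟩; rw [hfh z hz]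
      right_inv' := hfh
      open_source := hopen
      open_target := hT
      continuousOn_toFun := hf.continuousOn
      continuousOn_invFun := hh.continuousOn }
  exact ⟨φ, ⟨hf, hh⟩, rfl, rfl, rfl, rfl⟩

end LeftInverse

section CotangentTrivialization

variable {r : ℕ} {S : Type v} [TopologicalSpace S] [ChartedSpace (Eucl r) S]
  [IsManifold (𝓡 r) ∞ S]

/-- The trivialization of the cotangent bundle over the domain of a preferred chart. -/
def cotangentTrivialization (y₀ : S) : Trivialization (Eucl r →L[ℝ] ℝ)
    (TotalSpace.proj : CotangentBundle r S → S) :=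
  trivializationAt (Eucl r →L[ℝ] ℝ) (fun y : S ↦ TangentSpace (𝓡 r) y →L[ℝ] ℝ) y₀

theorem cotangentTrivialization_baseSet (y₀ : S) :
    (cotangentTrivialization (r := r) y₀).baseSet = (chartAt (Eucl r) y₀).source := by
  simp [cotangentTrivialization]

theorem cotangentTrivialization_apply {y₀ y : S} (hy : y ∈ (chartAt (Eucl r) y₀).source)
    (ξ : Cotangent r y) (a : Eucl r) :
    (cotangentTrivialization (r := r) y₀ (⟨y, ξ⟩ : CotangentBundle r S)).2 a =
      ξ (coordField (chartAt (Eucl r) y₀) a y) := by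
  have h1 : (cotangentTrivialization (r := r) y₀ (⟨y, ξ⟩ : CotangentBundle r S)).2 a =
      ξ ((trivializationAt (Eucl r) (TangentSpace (𝓡 r)) y₀).symmL ℝ y a) := by
    simp [cotangentTrivialization, hom_trivializationAt_apply, ContinuousLinearMap.inCoordinates]
  rw [h1]
  congr 1
  have hc : IsSmoothChart (n := r) (chartAt (Eucl r) y₀) := isSmoothChart_chartAt y₀
  refine (hc.bijective hy).1 ?_
  rw [hc.mvfderiv_coordField hy]
  have h2 := TangentBundle.continuousLinearMapAt_trivializationAt (I := 𝓡 r) hy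
  have h3 := (trivializationAt (Eucl r) (TangentSpace (𝓡 r)) y₀).continuousLinearMapAt_symmL
    (R := ℝ) (b := y) (by simpa using hy) a
  rw [h2] at h3
  exact h3

theorem contMDiffOn_cotangentTrivialization (y₀ : S) :
    ContMDiffOn ((𝓡 r).prod 𝓘(ℝ, Eucl r →L[ℝ] ℝ)) ((𝓡 r).prod 𝓘(ℝ, Eucl r →L[ℝ] ℝ)) ∞
      (cotangentTrivialization (r := r) (S := S) y₀) (TotalSpace.proj ⁻¹' (chartAt (Eucl r) y₀).source) := by
  have : MemTrivializationAtlas (cotangentTrivialization (r := r) (S := S) y₀) := by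
    unfold cotangentTrivialization; infer_instance
  have h := (cotangentTrivialization (r := r) (S := S) y₀).contMDiffOn (IB := 𝓡 r) (n := ∞)
  rwa [Trivialization.source_eq, cotangentTrivialization_baseSet] at h

theorem contMDiffOn_cotangentTrivialization_symm (y₀ : S) :
    ContMDiffOn ((𝓡 r).prod 𝓘(ℝ, Eucl r →L[ℝ] ℝ)) ((𝓡 r).prod 𝓘(ℝ, Eucl r →L[ℝ] ℝ)) ∞
      (cotangentTrivialization (r := r) (S := S) y₀).toOpenPartialHomeomorph.symm
      ((chartAt (Eucl r) y₀).source ×ˢ univ) := by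
  have : MemTrivializationAtlas (cotangentTrivialization (r := r) (S := S) y₀) := by
    unfold cotangentTrivialization; infer_instance
  have h := (cotangentTrivialization (r := r) (S := S) y₀).contMDiffOn_symm (IB := 𝓡 r) (n := ∞)
  rwa [Trivialization.target_eq, cotangentTrivialization_baseSet] at h

end CotangentTrivialization

section BundleCharts

theorem finrank_prod_dual (F : Type*) [NormedAddCommGroup F] [NormedSpace ℝ F]
    [FiniteDimensional ℝ F] :
    Module.finrank ℝ (F × (F →L[ℝ] ℝ)) = 2 * Module.finrank ℝ F := by
  have h : Module.finrank ℝ (F →L[ℝ] ℝ) = Module.finrank ℝ F := by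
    rw [← (LinearMap.toContinuousLinearMap (𝕜 := ℝ) (E := F) (F' := ℝ)).finrank_eq]
    exact Subspace.dual_finrank_eq
  rw [Module.finrank_prod, h]
  ring

namespace CotangentAffineBundle

variable {r : ℕ} {S : Type v} [TopologicalSpace S] [ChartedSpace (Eucl r) S]
  [IsManifold (𝓡 r) ∞ S]
  {N : Type w} [TopologicalSpace N] [ChartedSpace (Eucl (2 * r)) N]
  [IsManifold (𝓡 (2 * r)) ∞ N] (B : CotangentAffineBundle r S N)

omit [IsManifold (𝓡 (2 * r)) ∞ N] in
@[simp]
theorem proj_translate (x : N) (ξ : Cotangent r (B.proj x)) : B.proj (B.translate x ξ) = B.proj x :=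
  ((ξ +ᵥ (⟨x, rfl⟩ : B.proj ⁻¹' {B.proj x}) : B.proj ⁻¹' {B.proj x})).2

/-- The charts of the total space with the coordinates `q` of the base and the components `p` of
the difference from a local section. -/
theorem exists_chart (y₀ : S) : ∃ (W : Set S)
    (φ : OpenPartialHomeomorph N (Eucl r × (Eucl r →L[ℝ] ℝ))), IsOpen W ∧ y₀ ∈ W ∧
      W ⊆ (chartAt (Eucl r) y₀).source ∧ IsSmoothChart (n := 2 * r) φ ∧
      φ.source = B.proj ⁻¹' W ∧
      φ.target = ((chartAt (Eucl r) y₀).target ∩ (chartAt (Eucl r) y₀).symm ⁻¹' W) ×ˢ univ ∧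
      (∀ x ∈ φ.source, (φ x).1 = chartAt (Eucl r) y₀ (B.proj x)) ∧
      ∀ x ∈ φ.source, ∀ (ξ : Cotangent r (B.proj x)) (a : Eucl r), (φ (B.translate x ξ)).2 a =
        (φ x).2 a + ξ (coordField (chartAt (Eucl r) y₀) a (B.proj x)) := by
  obtain ⟨W₀, hW₀, hyW₀, o, hΘ, hΛ⟩ := B.locally_trivial y₀
  set c := chartAt (Eucl r) y₀ with hcdef
  have hc : IsSmoothChart (n := r) c := isSmoothChart_chartAt y₀
  have hyc : y₀ ∈ c.source := mem_chart_source _ y₀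
  set e := cotangentTrivialization (r := r) y₀
  have hes : ∀ p : CotangentBundle r S, p.1 ∈ c.source → p ∈ e.source := fun p hp ↦ by
    rw [e.mem_source, cotangentTrivialization_baseSet]; exact hp
  have het : ∀ p : S × (Eucl r →L[ℝ] ℝ), p.1 ∈ c.source → p ∈ e.target := fun p hp ↦ by
    rw [e.mem_target, cotangentTrivialization_baseSet]; exact hp
  -- the difference from the local section `o`, and its inverse
  let Λ : N → CotangentBundle r S := fun x ↦
    ⟨B.proj x, ((⟨x, rfl⟩ : B.proj ⁻¹' {B.proj x}) -ᵥ o (B.proj x) : Cotangent r (B.proj x))⟩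
  let Θ : CotangentBundle r S → N := fun p ↦ (((p.2 : Cotangent r p.1) +ᵥ o p.1 : _) : N)
  have hprojΘ : ∀ p, B.proj (Θ p) = p.1 := fun p ↦ ((p.2 : Cotangent r p.1) +ᵥ o p.1).2
  have hΛfib : ∀ (y : S) (x : B.proj ⁻¹' {y}), Λ x = ⟨y, x -ᵥ o y⟩ := by
    rintro y ⟨x, hx⟩
    obtain rfl : B.proj x = y := hx
    rfl
  have hΛΘ : ∀ p, Λ (Θ p) = p := fun p ↦ by
    refine (hΛfib p.1 _).trans ?_
    rw [vadd_vsub]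
  have hΘΛ : ∀ x, Θ (Λ x) = x := fun x ↦ by
    have h : (((⟨x, rfl⟩ : B.proj ⁻¹' {B.proj x}) -ᵥ o (B.proj x) : Cotangent r (B.proj x)) +ᵥ
      o (B.proj x)) = ⟨x, rfl⟩ := vsub_vadd _ _
    exact congrArg Subtype.val h
  let T : Set (Eucl r × (Eucl r →L[ℝ] ℝ)) := (c.target ∩ c.symm ⁻¹' (W₀ ∩ c.source)) ×ˢ univ
  have hW : IsOpen (W₀ ∩ c.source) := hW₀.inter c.open_source
  have hT : IsOpen T := (c.isOpen_inter_preimage_symm hW).prod isOpen_univ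
  let h : Eucl r × (Eucl r →L[ℝ] ℝ) → N := fun z ↦
    Θ (e.toOpenPartialHomeomorph.symm (c.symm z.1, z.2))
  let f : N → Eucl r × (Eucl r →L[ℝ] ℝ) := fun x ↦ (c (B.proj x), (e (Λ x)).2)
  have hsymm1 : ∀ z ∈ T, (e.toOpenPartialHomeomorph.symm (c.symm z.1, z.2)).1 = c.symm z.1 :=
    fun z hz ↦ e.proj_symm_apply (het _ hz.1.2.2)
  have hfh : ∀ z ∈ T, f (h z) = z := by
    intro z hz
    have h1 : (e (e.toOpenPartialHomeomorph.symm (c.symm z.1, z.2))) = (c.symm z.1, z.2) :=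
      e.apply_symm_apply (het _ hz.1.2.2)
    refine Prod.ext ?_ ?_
    · simp only [f, h, hprojΘ, hsymm1 z hz]
      exact c.right_inv hz.1.1
    · simp only [f, h, hΛΘ, h1]
  have hhf : ∀ x, B.proj x ∈ c.source → h (f x) = x := by
    intro x hx
    have h1 : (B.proj x, (e (Λ x)).2) = e (Λ x) := Prod.ext (e.coe_fst (hes (Λ x) hx)).symm rfl
    simp only [f, h, c.left_inv hx]
    rw [h1]
    exact (congrArg Θ (e.symm_apply_apply (hes _ hx))).trans (hΘΛ x)
  have himage : h '' T = B.proj ⁻¹' (W₀ ∩ c.source) := by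
    ext x
    constructor
    · rintro ⟨z, hz, rfl⟩
      simp only [mem_preimage, h, hprojΘ, hsymm1 z hz]
      exact hz.1.2
    · intro hx
      refine ⟨f x, ⟨⟨c.map_source hx.2, ?_⟩, mem_univ _⟩, hhf x hx.2⟩
      simp only [f, mem_preimage, c.left_inv hx.2]
      exact hx
  have hh : ContMDiffOn 𝓘(ℝ, Eucl r × (Eucl r →L[ℝ] ℝ)) (𝓡 (2 * r)) ∞ h T := by
    have h1 : ContMDiffOn 𝓘(ℝ, Eucl r × (Eucl r →L[ℝ] ℝ)) ((𝓡 r).prod 𝓘(ℝ, Eucl r →L[ℝ] ℝ)) ∞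
        (fun z ↦ (c.symm z.1, z.2)) T :=
      (hc.smooth_symm.comp contDiff_fst.contMDiff.contMDiffOn fun z hz ↦ hz.1.1).prodMk
        contDiff_snd.contMDiff.contMDiffOn
    have h2 := (contMDiffOn_cotangentTrivialization_symm (r := r) y₀).comp h1
      fun z hz ↦ ⟨hz.1.2.2, mem_univ _⟩
    refine hΘ.comp h2 fun z hz ↦ ?_
    have := hsymm1 z hz
    simp only [mem_preimage]
    exact this ▸ hz.1.2.1
  have hproj : ContMDiffOn (𝓡 (2 * r)) (𝓡 r) ∞ B.proj (B.proj ⁻¹' W₀) := by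
    have := (contMDiff_proj (fun y : S ↦ TangentSpace (𝓡 r) y →L[ℝ] ℝ) (IB := 𝓡 r)
      (F := Eucl r →L[ℝ] ℝ) (n := ∞)).comp_contMDiffOn hΛ
    exact this
  have hf : ContMDiffOn (𝓡 (2 * r)) 𝓘(ℝ, Eucl r × (Eucl r →L[ℝ] ℝ)) ∞ f (h '' T) := by
    rw [himage]
    refine (hc.smooth.comp (hproj.mono fun x hx ↦ hx.1) fun x hx ↦ hx.2).prodMk_space ?_
    have h2 := (contMDiffOn_cotangentTrivialization (r := r) y₀).comp
      (hΛ.mono (t := B.proj ⁻¹' (W₀ ∩ c.source)) fun x hx ↦ hx.1) fun x hx ↦ hx.2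
    exact contMDiff_snd.comp_contMDiffOn h2
  obtain ⟨φ, hφ, hφs, hφt, hφf, hφh⟩ := exists_isSmoothChart_of_leftInverse
    ((finrank_prod_dual (Eucl r)).trans (by rw [finrank_euclideanSpace_fin])) hT hh hf hfh
  refine ⟨W₀ ∩ c.source, φ, hW, ⟨hyW₀, hyc⟩, inter_subset_right, hφ, hφs.trans himage, hφt, ?_, ?_⟩
  · intro x _
    rw [hφf]
  · intro x hx ξ a
    rw [hφs, himage] at hx
    have h1 : Λ (B.translate x ξ) = ⟨B.proj x, ξ + (Λ x).2⟩ := by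
      refine (hΛfib (B.proj x) (ξ +ᵥ (⟨x, rfl⟩ : B.proj ⁻¹' {B.proj x}))).trans ?_
      rw [vadd_vsub_assoc]
    rw [hφf]
    have h2 := cotangentTrivialization_apply hx.2 (Λ x).2 a
    simp only [f, h1]
    refine (cotangentTrivialization_apply hx.2 _ a).trans ?_
    refine (add_comm _ _).trans ?_
    congr 1
    exact h2.symm

end CotangentAffineBundle

end BundleCharts

/-! ### Coordinate lines and forms with constant coefficients -/

section CoordinateLines

variable {n : ℕ} {M : Type u} [TopologicalSpace M] [ChartedSpace (Eucl n) M]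
  {E : Type*} [NormedAddCommGroup E] [NormedSpace ℝ E] [FiniteDimensional ℝ E]
  {φ : OpenPartialHomeomorph M E}

namespace IsSmoothChart

theorem hasMFDerivAt_symm_line (hφ : IsSmoothChart (n := n) φ) {x : M} (hx : x ∈ φ.source)
    (a : E) : MDifferentiableAt 𝓘(ℝ, ℝ) (𝓡 n) (fun t : ℝ ↦ φ.symm (φ x + t • a)) 0 ∧
      (mfderiv 𝓘(ℝ, ℝ) (𝓡 n) (fun t : ℝ ↦ φ.symm (φ x + t • a)) 0 (1 : ℝ) : Eucl n) =
        coordField φ a x := by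
  have hline : HasFDerivAt (fun t : ℝ ↦ φ x + t • a) (ContinuousLinearMap.toSpanSingleton ℝ a) 0 :=
    (((hasDerivAt_id (0 : ℝ)).smul_const a).const_add (φ x)).hasFDerivAt.congr_fderiv
      (by ext; simp)
  have h0 : φ x + (0 : ℝ) • a = φ x := by simp
  have hd : MDifferentiableAt 𝓘(ℝ, ℝ) (𝓡 n) (fun t : ℝ ↦ φ.symm (φ x + t • a)) 0 := by
    refine MDifferentiableAt.comp (I' := 𝓘(ℝ, E)) (0 : ℝ) (g := φ.symm)
      (f := fun t : ℝ ↦ φ x + t • a) ?_ hline.differentiableAt.mdifferentiableAt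
    rw [h0]
    exact hφ.mdifferentiableAt_symm (φ.map_source hx)
  refine ⟨hd, ?_⟩
  have hx0 : φ.symm (φ x + (0 : ℝ) • a) = x := by rw [h0, φ.left_inv hx]
  have h1 := mfderiv_comp_apply (I := 𝓘(ℝ, ℝ)) (I' := 𝓡 n) (I'' := 𝓘(ℝ, E)) (g := φ) (0 : ℝ)
    (by rw [hx0]; exact hφ.mdifferentiableAt hx) hd (1 : ℝ)
  have h2 : (φ ∘ fun t : ℝ ↦ φ.symm (φ x + t • a)) =ᶠ[𝓝 0] fun t : ℝ ↦ φ x + t • a := by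
    have h3 : φ.target ∈ 𝓝 (φ x + (0 : ℝ) • a) := by
      rw [h0]; exact φ.open_target.mem_nhds (φ.map_source hx)
    filter_upwards [hline.continuousAt h3] with t ht using φ.right_inv ht
  rw [h2.mfderiv_eq, hline.hasMFDerivAt.mfderiv] at h1
  refine (hφ.bijective hx).1 ?_
  rw [hφ.mvfderiv_coordField hx]
  have h4 : ∀ z, z = x → ∀ v : Eucl n, mfderiv (𝓡 n) 𝓘(ℝ, E) φ z v = mvfderiv (𝓡 n) φ x v := by
    rintro z rfl v; rfl
  refine (h4 _ hx0 _).symm.trans (h1.symm.trans ?_)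
  have h5 : (ContinuousLinearMap.toSpanSingleton ℝ a) (1 : ℝ) = a := by simp
  exact h5

/-- The derivative along a coordinate field is the derivative along a straight line in the
coordinate space. -/
theorem hasDerivAt_coordField (hφ : IsSmoothChart (n := n) φ) {x : M} (hx : x ∈ φ.source) (a : E)
    {f : M → ℝ} (hf : MDifferentiableAt (𝓡 n) 𝓘(ℝ, ℝ) f x) :
    HasDerivAt (fun t : ℝ ↦ f (φ.symm (φ x + t • a))) (mvfderiv (𝓡 n) f x (coordField φ a x)) 0 := by
  obtain ⟨hd, h⟩ := hφ.hasMFDerivAt_symm_line hx a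
  have hx0 : φ.symm (φ x + (0 : ℝ) • a) = x := by simp [φ.left_inv hx]
  have hf' : MDifferentiableAt (𝓡 n) 𝓘(ℝ, ℝ) f (φ.symm (φ x + (0 : ℝ) • a)) := by rwa [hx0]
  have h1 := mfderiv_comp_apply (I := 𝓘(ℝ, ℝ)) (0 : ℝ) hf' hd (1 : ℝ)
  have h2 : DifferentiableAt ℝ (f ∘ fun t : ℝ ↦ φ.symm (φ x + t • a)) 0 :=
    (hf'.comp (0 : ℝ) hd).differentiableAt
  rw [mfderiv_eq_fderiv] at h1
  refine h2.hasDerivAt.congr_deriv ?_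
  rw [← fderiv_apply_one_eq_deriv]
  have h4 : ∀ z, z = x → ∀ v : Eucl n, mfderiv (𝓡 n) 𝓘(ℝ, ℝ) f z v = mvfderiv (𝓡 n) f x v := by
    rintro z rfl v; rfl
  exact h1.trans ((h4 _ hx0 _).trans (congrArg _ h))

end IsSmoothChart

end CoordinateLines

section LocalForms

variable {r : ℕ} {S : Type v} [TopologicalSpace S] [ChartedSpace (Eucl r) S]
  [IsManifold (𝓡 r) ∞ S] [T2Space S]

/-- A form with constant coefficients in a chart extends, near a given point, to a global smooth
form. -/
theorem exists_smoothForm {y₀ y : S} (hy : y ∈ (chartAt (Eucl r) y₀).source) (η : Eucl r →L[ℝ] ℝ) :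
    ∃ θ : ∀ y : S, Cotangent r y, SmoothForm θ ∧
      ∀ᶠ z in 𝓝 y, θ z = η.comp (mvfderiv (𝓡 r) (chartAt (Eucl r) y₀) z) := by
  set c := chartAt (Eucl r) y₀
  have hc : IsSmoothChart (n := r) c := isSmoothChart_chartAt y₀
  obtain ⟨f, -, hf⟩ := (SmoothBumpFunction.nhds_basis_tsupport (I := 𝓡 r) y).mem_iff.1
    (c.open_source.mem_nhds hy)
  refine ⟨fun z ↦ f z • η.comp (mvfderiv (𝓡 r) c z), ?_, ?_⟩
  · intro z
    by_cases hz : z ∈ tsupport f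
    · have hzc := hf hz
      have h1 : ContMDiffOn (𝓡 r) ((𝓡 r).prod 𝓘(ℝ, Eucl r →L[ℝ] ℝ)) ∞
          (fun z ↦ (z, f z • η)) c.source :=
        contMDiffOn_id.prodMk (f.contMDiff.contMDiffOn.smul contMDiffOn_const)
      have h2 := ((contMDiffOn_cotangentTrivialization_symm (r := r) y₀).comp h1
        fun z hz ↦ ⟨hz, mem_univ _⟩).contMDiffAt (c.open_source.mem_nhds hzc)
      refine h2.congr_of_eventuallyEq ?_
      filter_upwards [c.open_source.mem_nhds hzc] with z' hz'
      set e := cotangentTrivialization (r := r) y₀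
      have hs : (⟨z', f z' • η.comp (mvfderiv (𝓡 r) c z')⟩ : CotangentBundle r S) ∈ e.source := by
        rw [e.mem_source, cotangentTrivialization_baseSet]; exact hz'
      refine (e.symm_apply_apply hs).symm.trans ?_
      refine congrArg e.toOpenPartialHomeomorph.symm (Prod.ext (e.coe_fst hs) ?_)
      ext a
      refine (cotangentTrivialization_apply hz' _ a).trans ?_
      simp only [smul_apply, ContinuousLinearMap.comp_apply]
      exact congrArg (fun b ↦ f z' • η b) (hc.mvfderiv_coordField hz' a)
    · have h0 := (contMDiff_zeroSection (𝕜 := ℝ) (IB := 𝓡 r) (n := ∞) (F := Eucl r →L[ℝ] ℝ)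
        (E := fun y : S ↦ TangentSpace (𝓡 r) y →L[ℝ] ℝ)) z
      refine h0.congr_of_eventuallyEq ?_
      filter_upwards [(isClosed_tsupport f).isOpen_compl.mem_nhds hz] with z' hz'
      rw [image_eq_zero_of_notMem_tsupport hz', zero_smul]
      rfl
  · filter_upwards [f.eventuallyEq_one] with z hz
    rw [hz]
    exact one_smul ℝ _

omit [T2Space S] in
/-- The Killing operator on a form with constant coefficients is given by the Christoffel
symbols. -/
theorem killing_eq {D : Connection r S} (hD : D.torsion = 0) {y₀ y : S}
    (hy : y ∈ (chartAt (Eucl r) y₀).source) {θ : ∀ y : S, Cotangent r y} (hθ : SmoothForm θ)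
    {η : Eucl r →L[ℝ] ℝ}
    (hθη : ∀ᶠ z in 𝓝 y, θ z = η.comp (mvfderiv (𝓡 r) (chartAt (Eucl r) y₀) z)) (a b : Eucl r) :
    killing D θ y (coordField (chartAt (Eucl r) y₀) a y) (coordField (chartAt (Eucl r) y₀) b y) =
      -2 * η (mvfderiv (𝓡 r) (chartAt (Eucl r) y₀) y
        (D (coordField (chartAt (Eucl r) y₀) b) y (coordField (chartAt (Eucl r) y₀) a y))) := by
  set c := chartAt (Eucl r) y₀
  have hc : IsSmoothChart (n := r) c := isSmoothChart_chartAt y₀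
  have h : ∀ a b, covDerivForm D θ y (coordField c a y) (coordField c b y) =
      - η (mvfderiv (𝓡 r) c y (D (coordField c b) y (coordField c a y))) := by
    intro a b
    have h1 : (fun z ↦ θ z (coordField c b z)) =ᶠ[𝓝 y] fun _ ↦ η b := by
      filter_upwards [hθη, c.open_source.mem_nhds hy] with z hz hzc
      rw [hz]
      exact congrArg η (hc.mvfderiv_coordField hzc b)
    rw [covDerivForm_apply D θ hθ y _ _ (hc.mdifferentiableAt_coordField hy b),
      mvfderiv_congr_of_eventuallyEq h1, mvfderiv_const, hθη.self_of_nhds]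
    exact zero_sub _
  rw [killing, h, h, Connection.coordField_symm hc hD hy a b]
  ring

end LocalForms

/-! ### Christoffel symbols -/

section Christoffel

variable {n : ℕ} {M : Type u} [TopologicalSpace M] [ChartedSpace (Eucl n) M]
  [IsManifold (𝓡 n) ∞ M]

theorem SmoothFieldOn.mdifferentiableAt {U : Set M} {w : ∀ x : M, TangentSpace (𝓡 n) x}
    (hw : SmoothFieldOn U w) (hU : IsOpen U) {x : M} (hx : x ∈ U) :
    MDifferentiableAt (𝓡 n) (𝓡 n).tangent (fun y ↦ (⟨y, w y⟩ : TangentBundle (𝓡 n) M)) x :=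
  (hw.contMDiffAt (hU.mem_nhds hx)).mdifferentiableAt (by simp)

theorem smoothFieldOn_covDeriv [T2Space M] {D : Connection n M}
    (hD : D.ContMDiffCovariantDerivative ∞) {U : Set M} (hU : IsOpen U)
    {v w : ∀ x : M, TangentSpace (𝓡 n) x} (hv : SmoothFieldOn U v) (hw : SmoothFieldOn U w) :
    SmoothFieldOn U (covDeriv D v w) := by
  intro x hx
  -- replace `w` by a global field which agrees with it near `x`
  obtain ⟨f, -, hf⟩ := (SmoothBumpFunction.nhds_basis_tsupport (I := 𝓡 n) x).mem_iff.1
    (hU.mem_nhds hx)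
  have h1 := ContMDiffOn.smul_section_of_tsupport (f.contMDiff.contMDiffOn (s := U)) hU hf hw
  have h2 := (hD.contMDiff.contMDiff (σ := fun y ↦ f y • w y) h1.contMDiffOn).contMDiffAt
    (x := x) Filter.univ_mem
  have h3 := h2.clm_bundle_apply (hv.contMDiffAt (hU.mem_nhds hx))
  refine (h3.congr_of_eventuallyEq ?_).contMDiffWithinAt
  filter_upwards [f.eventuallyEq_one.eventually_nhds, hU.mem_nhds hx] with y hy hyU
  have h4 := D.isCovariantDerivativeOn.leibniz (x := y) (g := f) (hw.mdifferentiableAt hU hyU)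
    ((f.contMDiff y).mdifferentiableAt (by simp))
  have h5 : mvfderiv (𝓡 n) f y = 0 :=
    (mvfderiv_congr_of_eventuallyEq (h := fun _ ↦ (1 : ℝ)) hy).trans (mvfderiv_const ..)
  have h6 : D (fun y ↦ f y • w y) y = D w y := by
    refine h4.trans ?_
    rw [h5, hy.self_of_nhds]
    simp
  rw [covDeriv, h6]

variable {F : Type*} [NormedAddCommGroup F] [NormedSpace ℝ F] [FiniteDimensional ℝ F]

omit [IsManifold (𝓡 n) ∞ M] [FiniteDimensional ℝ F] in
theorem coordField_add (c : OpenPartialHomeomorph M F) (a b : F) :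
    coordField (n := n) c (a + b) = coordField c a + coordField c b :=
  funext fun _ ↦ map_add _ _ _

omit [IsManifold (𝓡 n) ∞ M] [FiniteDimensional ℝ F] in
theorem coordField_smul (c : OpenPartialHomeomorph M F) (t : ℝ) (a : F) :
    coordField (n := n) c (t • a) = t • coordField c a :=
  funext fun _ ↦ map_smul _ _ _

theorem IsSmoothChart.isBilinearMap {c : OpenPartialHomeomorph M F} (hc : IsSmoothChart (n := n) c)
    (D : Connection n M) {y : M} (hy : y ∈ c.source) :
    IsBilinearMap ℝ fun a b ↦ mvfderiv (𝓡 n) c y (D (coordField c b) y (coordField c a y)) where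
  add_left a a' b := by rw [coordField_add, Pi.add_apply, map_add, map_add]
  smul_left t a b := by rw [coordField_smul, Pi.smul_apply, map_smul, map_smul]
  add_right a b b' := by
    rw [coordField_add, D.isCovariantDerivativeOn.add (hc.mdifferentiableAt_coordField hy b)
      (hc.mdifferentiableAt_coordField hy b'), add_apply, map_add]
  smul_right t a b := by
    have h := D.isCovariantDerivativeOn.leibniz (g := fun _ ↦ t)
      (hc.mdifferentiableAt_coordField hy b) mdifferentiableAt_const
    rw [mvfderiv_const] at h
    have h1 : D (coordField c (t • b)) y = t • D (coordField c b) y := by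
      rw [coordField_smul]
      refine h.trans ?_
      ext; simp
    rw [h1, smul_apply, map_smul]

open Classical in
/-- The Christoffel symbols of a connection in a chart `c`, as functions on the target of `c`, with
values in the bilinear maps: `Γ(a, b) = D_a ∂_b`. -/
def christoffel (c : OpenPartialHomeomorph M F) (D : Connection n M) (z : F) : F →L[ℝ] F →L[ℝ] F :=
  if h : IsBilinearMap ℝ fun a b ↦ mvfderiv (𝓡 n) c (c.symm z)
    (D (coordField c b) (c.symm z) (coordField c a (c.symm z))) then h.toContinuousBilinearMap else 0

theorem IsSmoothChart.christoffel_apply {c : OpenPartialHomeomorph M F}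
    (hc : IsSmoothChart (n := n) c) (D : Connection n M) {z : F} (hz : z ∈ c.target) (a b : F) :
    christoffel c D z a b = mvfderiv (𝓡 n) c (c.symm z)
      (D (coordField c b) (c.symm z) (coordField c a (c.symm z))) := by
  rw [christoffel, dif_pos (hc.isBilinearMap D (c.map_target hz))]
  rfl

theorem IsSmoothChart.christoffel_apply' {c : OpenPartialHomeomorph M F}
    (hc : IsSmoothChart (n := n) c) (D : Connection n M) {y : M} (hy : y ∈ c.source) (a b : F) :
    christoffel c D (c y) a b = mvfderiv (𝓡 n) c y (D (coordField c b) y (coordField c a y)) := by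
  rw [hc.christoffel_apply D (c.map_source hy), c.left_inv hy]

theorem IsSmoothChart.contDiffOn_christoffel [T2Space M] {c : OpenPartialHomeomorph M F}
    (hc : IsSmoothChart (n := n) c) {D : Connection n M} (hD : D.ContMDiffCovariantDerivative ∞) :
    ContDiffOn ℝ ∞ (christoffel c D) c.target := by
  refine contDiffOn_clm_apply.2 fun a ↦ contDiffOn_clm_apply.2 fun b ↦ ?_
  have h1 := contMDiffOn_mvfderiv_apply c.open_source hc.smooth (smoothFieldOn_covDeriv hD
    c.open_source (hc.smoothFieldOn_coordField a) (hc.smoothFieldOn_coordField b))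
  have h2 := h1.comp hc.smooth_symm fun z hz ↦ c.map_target hz
  exact h2.contDiffOn.congr fun z hz ↦ hc.christoffel_apply D hz a b

end Christoffel

/-! ### The base of a cotangent affine bundle as a leaf space -/

namespace CotangentAffineBundle

variable {r : ℕ} {S : Type v} [TopologicalSpace S] [ChartedSpace (Eucl r) S]
  [IsManifold (𝓡 r) ∞ S]
  {N : Type u} [TopologicalSpace N] [ChartedSpace (Eucl (2 * r)) N]
  [IsManifold (𝓡 (2 * r)) ∞ N] (B : CotangentAffineBundle r S N)

theorem contMDiff_proj : ContMDiff (𝓡 (2 * r)) (𝓡 r) ∞ B.proj := by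
  intro x
  obtain ⟨W, φ, hW, hyW, hWc, hφ, hφs, hφt, hφ1, -⟩ := B.exists_chart (B.proj x)
  set c := chartAt (Eucl r) (B.proj x)
  have hc : IsSmoothChart (n := r) c := isSmoothChart_chartAt _
  have hx : x ∈ φ.source := by rw [hφs]; exact hyW
  have h1 : ContMDiffOn (𝓡 (2 * r)) (𝓡 r) ∞ (fun x ↦ c.symm (φ x).1) φ.source :=
    hc.smooth_symm.comp (contDiff_fst.contMDiff.comp_contMDiffOn hφ.smooth) fun y hy ↦ by
      have := φ.map_source hy
      rw [hφt] at this
      exact this.1.1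
  refine (h1.contMDiffAt (φ.open_source.mem_nhds hx)).congr_of_eventuallyEq ?_
  filter_upwards [φ.open_source.mem_nhds hx] with y hy
  rw [hφ1 y hy, c.left_inv]
  rw [hφs] at hy
  exact hWc hy

/-- The fibres of a cotangent affine bundle are connected: they are affine spaces. -/
theorem isLeafFibration : IsLeafFibration (q := r) B.vertical univ B.proj where
  bundle :=
    { isOpen := isOpen_univ
      surj := by
        rw [image_univ]
        ext y
        simp only [mem_range, mem_univ, iff_true]
        obtain ⟨W, hW, hy, o, -⟩ := B.locally_trivial y
        exact ⟨o y, (o y).2⟩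
      smooth := B.contMDiff_proj.contMDiffOn
      locally_trivial := by
        intro y
        obtain ⟨W, φ, hW, hyW, hWc, hφ, hφs, hφt, hφ1, -⟩ := B.exists_chart y
        set c := chartAt (Eucl r) y
        have hc : IsSmoothChart (n := r) c := isSmoothChart_chartAt _
        have hF : Module.finrank ℝ (Eucl r →L[ℝ] ℝ) = Module.finrank ℝ (Eucl r) := by
          rw [← (LinearMap.toContinuousLinearMap (𝕜 := ℝ) (E := Eucl r) (F' := ℝ)).finrank_eq]
          exact Subspace.dual_finrank_eq
        let L : (Eucl r →L[ℝ] ℝ) ≃L[ℝ] Eucl r := ContinuousLinearEquiv.ofFinrankEq hF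
        have hmem : ∀ x ∈ B.proj ⁻¹' W, x ∈ φ.source := fun x hx ↦ by rwa [hφs]
        have hmem' : ∀ p ∈ W ×ˢ (univ : Set (Eucl r)), (c p.1, L.symm p.2) ∈ φ.target :=
          fun p hp ↦ by
            rw [hφt]
            refine ⟨⟨c.map_source (hWc hp.1), ?_⟩, mem_univ _⟩
            rw [mem_preimage, c.left_inv (hWc hp.1)]
            exact hp.1
        have hΦ : ContMDiffOn (𝓡 (2 * r)) ((𝓡 r).prod (𝓡 r)) ∞
            (fun x ↦ (B.proj x, L (φ x).2)) (B.proj ⁻¹' W) :=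
          B.contMDiff_proj.contMDiffOn.prodMk ((L.contDiff.comp contDiff_snd).contMDiff.comp_contMDiffOn
            (hφ.smooth.mono hmem))
        have hΦ' : ContMDiffOn ((𝓡 r).prod (𝓡 r)) (𝓡 (2 * r)) ∞
            (fun p : S × Eucl r ↦ φ.symm (c p.1, L.symm p.2)) (W ×ˢ univ) := by
          refine hφ.smooth_symm.comp (ContMDiffOn.prodMk_space ?_ ?_) hmem'
          · exact hc.smooth.comp contMDiffOn_fst fun p hp ↦ hWc hp.1
          · exact L.symm.contDiff.contMDiff.comp_contMDiffOn contMDiffOn_snd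
        have hprojsymm : ∀ p ∈ W ×ˢ (univ : Set (Eucl r)),
            B.proj (φ.symm (c p.1, L.symm p.2)) = p.1 := by
          intro p hp
          have h1 := φ.map_target (hmem' p hp)
          have h2 := hφ1 _ h1
          rw [φ.right_inv (hmem' p hp)] at h2
          rw [hφs] at h1
          exact (c.injOn (hWc hp.1) (hWc h1) h2).symm
        let Φ : OpenPartialHomeomorph N (S × Eucl r) :=
          { toFun := fun x ↦ (B.proj x, L (φ x).2)
            invFun := fun p ↦ φ.symm (c p.1, L.symm p.2)
            source := B.proj ⁻¹' W
            target := W ×ˢ univ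
            map_source' := fun x hx ↦ ⟨hx, mem_univ _⟩
            map_target' := fun p hp ↦ by
              rw [mem_preimage, hprojsymm p hp]; exact hp.1
            left_inv' := fun x hx ↦ by
              simp only [L.symm_apply_apply]
              rw [← hφ1 x (hmem x hx)]
              exact φ.left_inv (hmem x hx)
            right_inv' := fun p hp ↦ by
              rw [hprojsymm p hp, φ.right_inv (hmem' p hp), L.apply_symm_apply]
            open_source := hW.preimage B.contMDiff_proj.continuous
            open_target := hW.prod isOpen_univ
            continuousOn_toFun := hΦ.continuousOn
            continuousOn_invFun := hΦ'.continuousOn }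
        exact ⟨W, hW, hyW, r, Eucl r, inferInstance, inferInstance, inferInstance, Φ,
          (univ_inter _).symm, rfl, hΦ, hΦ', fun x _ ↦ rfl⟩ }
  ker_eq := fun x _ ↦ rfl
  fibre_connected := by
    intro y
    obtain ⟨W, φ, hW, hyW, hWc, hφ, hφs, hφt, hφ1, -⟩ := B.exists_chart y
    set c := chartAt (Eucl r) y
    have hsub : ({c y} ×ˢ univ : Set (Eucl r × (Eucl r →L[ℝ] ℝ))) ⊆ φ.target := by
      rw [hφt]
      rintro ⟨a, b⟩ ⟨rfl, -⟩
      refine ⟨⟨c.map_source (hWc hyW), ?_⟩, mem_univ _⟩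
      rw [mem_preimage, c.left_inv (hWc hyW)]
      exact hyW
    have himage : univ ∩ B.proj ⁻¹' {y} = φ.symm '' ({c y} ×ˢ univ) := by
      ext x
      constructor
      · rintro ⟨-, hx⟩
        have hx' : B.proj x = y := hx
        have hxs : x ∈ φ.source := by rw [hφs, mem_preimage, hx']; exact hyW
        exact ⟨φ x, ⟨by rw [mem_singleton_iff, hφ1 x hxs, hx'], mem_univ _⟩, φ.left_inv hxs⟩
      · rintro ⟨z, hz, rfl⟩
        have h1 := φ.map_target (hsub hz)
        have h2 := hφ1 _ h1
        rw [φ.right_inv (hsub hz)] at h2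
        rw [hφs] at h1
        exact ⟨mem_univ _, (c.injOn (hWc hyW) (hWc h1) (hz.1.symm.trans h2)).symm⟩
    rw [himage]
    refine ((isConnected_singleton).prod isConnected_univ).image _ ?_
    exact φ.continuousOn_symm.mono hsub

end CotangentAffineBundle

/-! ### Adapted charts for Riemann extension metrics -/

namespace CotangentAffineBundle

variable {r : ℕ} {S : Type v} [TopologicalSpace S] [ChartedSpace (Eucl r) S]
  [IsManifold (𝓡 r) ∞ S]
  {N : Type u} [TopologicalSpace N] [ChartedSpace (Eucl (2 * r)) N]
  [IsManifold (𝓡 (2 * r)) ∞ N] {B : CotangentAffineBundle r S N}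

/-- In the bundle charts `(q, p)`, a Riemann extension metric satisfies `g(∂_p, ·) = dq`, by
definition, and its coefficients are affine functions of `p`: they are shifted, under translations
by a form with constant coefficients, by the Killing operator of this form. -/
theorem IsRiemannExtension.exists_isAdaptedChart [T2Space S] {D : Connection r S}
    (hD : IsTorsionFreeConnection D) {g : PseudoRiemannianMetric (2 * r) N}
    (hg : B.IsRiemannExtension D g) (x₀ : N) :
    ∃ φ : OpenPartialHomeomorph N (Eucl r × (Eucl r →L[ℝ] ℝ)), x₀ ∈ φ.source ∧
      (∀ x ∈ φ.source, (φ x).1 = chartAt (Eucl r) (B.proj x₀) (B.proj x)) ∧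
      IsAdaptedChart g B.vertical φ (chartAt (Eucl r) (B.proj x₀)).target
        (christoffel (chartAt (Eucl r) (B.proj x₀)) D) := by
  obtain ⟨W, φ, hW, hyW, hWc, hφ, hφs, hφt, hφ1, hφ2⟩ := B.exists_chart (B.proj x₀)
  set c := chartAt (Eucl r) (B.proj x₀)
  have hc : IsSmoothChart (n := r) c := isSmoothChart_chartAt _
  have hsc : ∀ x ∈ φ.source, B.proj x ∈ c.source := fun x hx ↦ by
    rw [hφs] at hx; exact hWc hx
  have hprojd : ∀ x, MDifferentiableAt (𝓡 (2 * r)) (𝓡 r) B.proj x := fun x ↦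
    (B.contMDiff_proj x).mdifferentiableAt (by simp)
  have hfst : ∀ x ∈ φ.source, ∀ v, (mvfderiv (𝓡 (2 * r)) φ x v).1 =
      mvfderiv (𝓡 r) c (B.proj x) (mfderiv (𝓡 (2 * r)) (𝓡 r) B.proj x v) := by
    intro x hx v
    rw [← mvfderiv_chart_fst hφ hx, ← mvfderiv_comp_mfderiv
      (hc.mdifferentiableAt (hsc x hx)) (hprojd x)]
    congr 1
    apply mvfderiv_congr_of_eventuallyEq
    filter_upwards [φ.open_source.mem_nhds hx] with y hy using hφ1 y hy
  -- translations in the chart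
  have htrans_mem : ∀ x ∈ φ.source, ∀ ξ, B.translate x ξ ∈ φ.source := fun x hx ξ ↦ by
    rw [hφs] at hx ⊢
    rwa [mem_preimage, proj_translate]
  have htrans : ∀ x ∈ φ.source, ∀ η : Eucl r →L[ℝ] ℝ,
      φ (B.translate x (η.comp (mvfderiv (𝓡 r) c (B.proj x)))) = φ x + (0, η) := by
    intro x hx η
    refine Prod.ext ?_ ?_
    · rw [hφ1 _ (htrans_mem x hx _), proj_translate, ← hφ1 x hx]
      simp
    · ext a
      rw [hφ2 x hx]
      have h : η.comp (mvfderiv (𝓡 r) c (B.proj x)) (coordField c a (B.proj x)) = η a :=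
        congrArg η (hc.mvfderiv_coordField (hsc x hx) a)
      rw [h]
      rfl
  have htrans' : ∀ x ∈ φ.source, ∀ η : Eucl r →L[ℝ] ℝ,
      B.translate x (η.comp (mvfderiv (𝓡 r) c (B.proj x))) = φ.symm (φ x + (0, η)) := by
    intro x hx η
    rw [← htrans x hx, φ.left_inv (htrans_mem x hx _)]
  have hvert : ∀ x ∈ φ.source, ∀ η : Eucl r →L[ℝ] ℝ,
      B.verticalVector x (η.comp (mvfderiv (𝓡 r) c (B.proj x))) = coordField φ (0, η) x := by
    intro x hx η
    refine Eq.trans ?_ (hφ.hasMFDerivAt_symm_line hx (0, η)).2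
    have h : (fun t : ℝ ↦ B.translate x (t • η.comp (mvfderiv (𝓡 r) c (B.proj x)))) =
        fun t : ℝ ↦ φ.symm (φ x + t • (0, η)) := by
      funext t
      have h1 := htrans' x hx (t • η)
      rw [Prod.smul_mk, smul_zero, ← h1]
      rfl
    unfold verticalVector
    rw [h]
    rfl
  have hφmem : ∀ x ∈ φ.source, ∀ η, φ x + (0, η) ∈ φ.target := by
    intro x hx η
    rw [← htrans x hx]
    exact φ.map_source (htrans_mem x hx _)
  -- the shift rule in the chart
  have hshift : ∀ x ∈ φ.source, ∀ (η : Eucl r →L[ℝ] ℝ) (a b : Eucl r × (Eucl r →L[ℝ] ℝ)),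
      g.form (φ.symm (φ x + (0, η))) (coordField φ a (φ.symm (φ x + (0, η))))
        (coordField φ b (φ.symm (φ x + (0, η)))) = g.form x (coordField φ a x) (coordField φ b x)
        + -2 * η (christoffel c D (φ x).1 a.1 b.1) := by
    intro x hx η a b
    obtain ⟨θ, hθ, hθη⟩ := exists_smoothForm (hsc x hx) η
    have hs : ∀ᶠ z in 𝓝 x, z ∈ φ.source ∧ B.shift θ z = φ.symm (φ z + (0, η)) := by
      filter_upwards [φ.open_source.mem_nhds hx, (hprojd x).continuousAt.eventually hθη]
        with z hz hθz
      refine ⟨hz, ?_⟩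
      rw [← htrans' z hz, shift, hθz]
    have hd : MDifferentiableAt (𝓡 (2 * r)) (𝓡 (2 * r)) (B.shift θ) x := by
      refine MDifferentiableAt.congr_of_eventuallyEq
        (f := fun z ↦ φ.symm (φ z + (0, η))) ?_ (hs.mono fun z hz ↦ hz.2)
      refine MDifferentiableAt.comp (I' := 𝓘(ℝ, Eucl r × (Eucl r →L[ℝ] ℝ))) x (g := φ.symm)
        (f := fun z ↦ φ z + (0, η)) (hφ.mdifferentiableAt_symm (hφmem x hx η)) ?_
      exact (hφ.mdifferentiableAt hx).add mdifferentiableAt_const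
    have hsx := hs.self_of_nhds.2
    have hsmem : B.shift θ x ∈ φ.source := by rw [hsx]; exact φ.map_target (hφmem x hx η)
    have hdcoord : ∀ a, mfderiv (𝓡 (2 * r)) (𝓡 (2 * r)) (B.shift θ) x (coordField φ a x) =
        coordField φ a (B.shift θ x) := by
      intro a
      refine (hφ.bijective hsmem).1 ?_
      rw [hφ.mvfderiv_coordField hsmem, ← mvfderiv_comp_mfderiv (hφ.mdifferentiableAt hsmem) hd]
      have h1 : (fun z ↦ φ (B.shift θ z)) =ᶠ[𝓝 x] fun z ↦ φ z + (0, η) := by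
        filter_upwards [hs] with z hz
        rw [hz.2, φ.right_inv (hφmem z hz.1 η)]
      rw [mvfderiv_congr_of_eventuallyEq h1, mvfderiv_fun_add (hφ.mdifferentiableAt hx)
        mdifferentiableAt_const, mvfderiv_const, add_zero, hφ.mvfderiv_coordField hx]
    have h := hg.shift_rule θ hθ x (coordField φ a x) (coordField φ b x)
    have hproja : ∀ a, mfderiv (𝓡 (2 * r)) (𝓡 r) B.proj x (coordField φ a x) =
        coordField c a.1 (B.proj x) := by
      intro a
      refine (hc.bijective (hsc x hx)).1 ?_
      rw [hc.mvfderiv_coordField (hsc x hx), ← hfst x hx, hφ.mvfderiv_coordField hx]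
    rw [hproja, hproja, killing_eq hD.torsion_free (hsc x hx) hθ hθη, hdcoord, hdcoord, hsx] at h
    rw [h, hφ1 x hx, hc.christoffel_apply' D (hsc x hx)]
  refine ⟨φ, by rw [hφs]; exact hyW, hφ1, hφ, ?_, ?_, c.open_target, ?_,
    hc.contDiffOn_christoffel hD.smooth, ?_⟩
  · intro x hx v
    rw [hfst x hx, ← map_zero (mvfderiv (𝓡 r) c (B.proj x)), (hc.bijective (hsc x hx)).1.eq_iff]
    rfl
  · intro x hx η w
    rw [← hvert x hx, hg.standard, hfst x hx]
    rfl
  · intro x hx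
    have := φ.map_source hx
    rw [hφt] at this
    exact this.1.1
  · intro x hx η a b
    have h1 := hφ.hasDerivAt_coordField hx (0, η) (mdifferentiableAt_metric g
      (hφ.mdifferentiableAt_coordField hx a) (hφ.mdifferentiableAt_coordField hx b))
    -- the coefficients are affine along the lines in the direction of `∂_p`
    have h2 : ∀ t : ℝ, g.form (φ.symm (φ x + t • (0, η)))
        (coordField φ a (φ.symm (φ x + t • (0, η)))) (coordField φ b (φ.symm (φ x + t • (0, η)))) =
        g.form x (coordField φ a x) (coordField φ b x)
        + t * (-2 * η (christoffel c D (φ x).1 a.1 b.1)) := by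
      intro t
      have := hshift x hx (t • η) a b
      rw [Prod.smul_mk, smul_zero, this, smul_apply, smul_eq_mul]
      ring
    refine h1.unique ?_
    simp only [h2]
    simpa using ((hasDerivAt_id (0 : ℝ)).mul_const
      (-2 * η (christoffel c D (φ x).1 a.1 b.1))).const_add
        (g.form x (coordField φ a x) (coordField φ b x))

/-- The Levi-Civita connection of a Riemann extension metric, as seen from the base. -/
theorem IsRiemannExtension.properties [T2Space S] {D : Connection r S}
    (hD : IsTorsionFreeConnection D) {g : PseudoRiemannianMetric (2 * r) N}
    (hg : B.IsRiemannExtension D g) {nabla : Connection (2 * r) N} (hn : IsLeviCivita g nabla) :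
    IsNull g B.vertical ∧ IsParallel nabla B.vertical ∧
      IsProjectable.{u, v} r nabla B.vertical ∧
      IsProjectedConnection nabla B.vertical univ B.proj D := by
  have h := hg.exists_isAdaptedChart hD
  have h' : ∀ x, ∃ (φ : OpenPartialHomeomorph N (Eucl r × (Eucl r →L[ℝ] ℝ))) (Q : Set (Eucl r))
      (Γ : Eucl r → Eucl r →L[ℝ] Eucl r →L[ℝ] Eucl r), x ∈ φ.source ∧
        IsAdaptedChart g B.vertical φ Q Γ := fun x ↦ by
    obtain ⟨φ, hx, -, hφ⟩ := h x
    exact ⟨φ, _, _, hx, hφ⟩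
  refine ⟨IsAdaptedChart.isNull h', IsAdaptedChart.isParallel hn h',
    IsAdaptedChart.isProjectable (F := Eucl r) finrank_euclideanSpace_fin hn h',
    IsAdaptedChart.isProjectedConnection (F := Eucl r) hn B.isLeafFibration fun x _ ↦ ?_⟩
  obtain ⟨φ, hx, hφ1, hφ⟩ := h x
  set c := chartAt (Eucl r) (B.proj x)
  have hc : IsSmoothChart (n := r) c := isSmoothChart_chartAt _
  have hxc : B.proj x ∈ c.source := mem_chart_source _ _
  refine ⟨φ, _, _, c, hx, hφ, hc, hxc, ?_, fun b u ↦ ?_⟩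
  · filter_upwards [φ.open_source.mem_nhds hx] with y hy using hφ1 y hy
  · rw [hc.christoffel_apply' D hxc, hc.coordField_mvfderiv hxc]

end CotangentAffineBundle

/-! ### Flat charts of integrable distributions -/

section FrobeniusChart

/-- The derivatives of a smooth partial homeomorphism and of its inverse are mutually inverse. -/
theorem fderiv_fderiv_symm {E E' : Type*} [NormedAddCommGroup E] [NormedSpace ℝ E]
    [NormedAddCommGroup E'] [NormedSpace ℝ E'] {ψ : OpenPartialHomeomorph E E'}
    (h : ContDiffOn ℝ ∞ ψ ψ.source) (h' : ContDiffOn ℝ ∞ ψ.symm ψ.target) {z : E'}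
    (hz : z ∈ ψ.target) (v : E') : fderiv ℝ ψ (ψ.symm z) (fderiv ℝ ψ.symm z v) = v := by
  have h1 := (h.contDiffAt (ψ.open_source.mem_nhds (ψ.map_target hz))).differentiableAt
    (show (∞ : ℕ∞ω) ≠ 0 by simp)
  have h2 := (h'.contDiffAt (ψ.open_target.mem_nhds hz)).differentiableAt
    (show (∞ : ℕ∞ω) ≠ 0 by simp)
  have h3 : (ψ ∘ ψ.symm) =ᶠ[𝓝 z] id := by
    filter_upwards [ψ.open_target.mem_nhds hz] with y hy using ψ.right_inv hy
  have h4 := fderiv_comp z h1 h2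
  rw [h3.fderiv_eq, fderiv_id] at h4
  exact (DFunLike.congr_fun h4 v).symm

theorem fderiv_symm_fderiv {E E' : Type*} [NormedAddCommGroup E] [NormedSpace ℝ E]
    [NormedAddCommGroup E'] [NormedSpace ℝ E'] {ψ : OpenPartialHomeomorph E E'}
    (h : ContDiffOn ℝ ∞ ψ ψ.source) (h' : ContDiffOn ℝ ∞ ψ.symm ψ.target) {z : E}
    (hz : z ∈ ψ.source) (v : E) : fderiv ℝ ψ.symm (ψ z) (fderiv ℝ ψ z v) = v := by
  have := fderiv_fderiv_symm (ψ := ψ.symm) h' h (z := z) hz v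
  simpa using this

variable {F P : Type u} [NormedAddCommGroup F] [NormedSpace ℝ F] [FiniteDimensional ℝ F]
  [NormedAddCommGroup P] [NormedSpace ℝ P] [FiniteDimensional ℝ P]

/-- Frobenius' theorem: an involutive distribution given by the graphs of linear maps `A(z)` is
straightened by a change of coordinates. -/
theorem exists_frobenius_chart {A : F × P → P →L[ℝ] F} {Ω : Set (F × P)} (hΩ : IsOpen Ω)
    (hA : ContDiffOn ℝ ∞ A Ω) (h₀ : (0 : F × P) ∈ Ω)
    (hinv : ∀ z ∈ Ω, ∀ ν τ, fderiv ℝ A z (A z ν, ν) τ = fderiv ℝ A z (A z τ, τ) ν) :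
    ∃ χ : OpenPartialHomeomorph (F × P) (F × P), 0 ∈ χ.source ∧ χ.source ⊆ Ω ∧
      ContDiffOn ℝ ∞ χ χ.source ∧ ContDiffOn ℝ ∞ χ.symm χ.target ∧
      ∀ z ∈ χ.source, ∀ v, (fderiv ℝ χ z v).1 = 0 ↔ v.1 = A z v.2 := by
  obtain ⟨N, Y, hN, hN0, hY, hY0, hYN⟩ := exists_totalDifferential hΩ hA (e₀ := 0) h₀ hinv
  -- `G` maps the sets `e = const` to the leaves
  let G : F × P → F × P := fun z ↦ (Y z, z.2)
  have hG : ContDiffOn ℝ ∞ G N := hY.prodMk contDiffOn_snd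
  have hYd : ∀ z ∈ N, HasFDerivAt Y (fderiv ℝ Y z) z := fun z hz ↦
    ((hY.contDiffAt (hN.mem_nhds hz)).differentiableAt (by simp)).hasFDerivAt
  have hGd : ∀ z ∈ N, ∀ v, fderiv ℝ G z v = (fderiv ℝ Y z v, v.2) := fun z hz v ↦ by
    have h : HasFDerivAt G _ z := (hYd z hz).prodMk hasFDerivAt_snd
    rw [h.fderiv]
    rfl
  have hY1 : ∀ e, fderiv ℝ Y 0 (e, 0) = e := fun e ↦ by
    have h1 : HasFDerivAt (fun e : F ↦ Y (e, 0))
        ((fderiv ℝ Y 0).comp (ContinuousLinearMap.inl ℝ F P)) 0 :=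
      HasFDerivAt.comp (g := Y) (f := fun e : F ↦ (e, (0 : P))) 0 (hYd 0 hN0)
        (ContinuousLinearMap.inl ℝ F P).hasFDerivAt
    have h2 : (fun e : F ↦ Y (e, 0)) =ᶠ[𝓝 0] id := by
      have hc : Continuous fun e : F ↦ (e, (0 : P)) := by fun_prop
      filter_upwards [(hN.preimage hc).mem_nhds (show (0 : F) ∈ _ from hN0)] with e he
        using hY0 e he
    have h3 := (h1.congr_of_eventuallyEq h2.symm).unique (hasFDerivAt_id (0 : F))
    exact DFunLike.congr_fun h3 e
  have hb : Function.Bijective (fderiv ℝ G 0) := by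
    have hinj : Function.Injective (fderiv ℝ G 0) := by
      rw [injective_iff_map_eq_zero]
      rintro ⟨e, ν⟩ h
      rw [hGd 0 hN0] at h
      obtain rfl : ν = 0 := congrArg Prod.snd h
      have h1 := congrArg Prod.fst h
      simp only [hY1] at h1
      exact Prod.ext h1 rfl
    exact ⟨hinj, LinearMap.surjective_of_injective (f := (fderiv ℝ G 0).toLinearMap) hinj⟩
  obtain ⟨ψ, h0ψ, hψN, hψG, hψs⟩ := exists_openPartialHomeomorph_of_bijective hN hG hN0 hb
  have hψ : ContDiffOn ℝ ∞ ψ ψ.source := hψG ▸ hG.mono hψN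
  have hG0 : G (0, 0) = 0 := Prod.ext (hY0 0 hN0) rfl
  refine ⟨ψ.symm, ?_, ?_, hψs, hψ, ?_⟩
  · have := ψ.map_source h0ψ
    rwa [hψG, hG0] at this
  · intro z hz
    have h1 := (hYN _ (hψN (ψ.map_target hz))).1
    have h2 : G (ψ.symm z) = z := by rw [← hψG]; exact ψ.right_inv hz
    rwa [show (Y (ψ.symm z), (ψ.symm z).2) = z from h2] at h1
  · intro z hz v
    have hw := ψ.map_target hz
    have h2 : G (ψ.symm z) = z := by rw [← hψG]; exact ψ.right_inv hz
    have h3 : ∀ ν, fderiv ℝ ψ (ψ.symm z) (0, ν) = (A z ν, ν) := fun ν ↦ by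
      rw [hψG, hGd _ (hψN hw), (hYN _ (hψN hw)).2,
        show (Y (ψ.symm z), (ψ.symm z).2) = z from h2]
    have h4 := fderiv_fderiv_symm hψ hψs hz v
    constructor
    · intro h
      have h5 : fderiv ℝ ψ.symm z v = (0, (fderiv ℝ ψ.symm z v).2) := Prod.ext h rfl
      rw [h5, h3] at h4
      rw [← h4]
    · intro h
      have h5 := fderiv_symm_fderiv hψ hψs hw (0, v.2)
      rw [h3, ← h, ψ.right_inv hz] at h5
      exact congrArg Prod.fst h5

end FrobeniusChart

section GraphChart

/-- Coordinates in which a given injective linear map is the inclusion of the second factor. -/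
theorem exists_linear_coordinates {E F P : Type*} [NormedAddCommGroup E] [NormedSpace ℝ E]
    [FiniteDimensional ℝ E] [NormedAddCommGroup F] [NormedSpace ℝ F] [FiniteDimensional ℝ F]
    [NormedAddCommGroup P] [NormedSpace ℝ P] [FiniteDimensional ℝ P] (ε : P →ₗ[ℝ] E)
    (hε : Function.Injective ε)
    (hd : Module.finrank ℝ E = Module.finrank ℝ F + Module.finrank ℝ P) :
    ∃ Λ : E ≃L[ℝ] F × P, ∀ ν, Λ (ε ν) = (0, ν) := by
  obtain ⟨W, hW⟩ := Submodule.exists_isCompl (LinearMap.range ε)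
  have h1 := Submodule.finrank_add_eq_of_isCompl hW
  have h2 : Module.finrank ℝ (LinearMap.range ε) = Module.finrank ℝ P :=
    LinearMap.finrank_range_of_inj hε
  let w : W ≃ₗ[ℝ] F := LinearEquiv.ofFinrankEq W F (by omega)
  let Λ : E ≃ₗ[ℝ] F × P := (Submodule.prodEquivOfIsCompl W _ hW.symm).symm ≪≫ₗ
    LinearEquiv.prodCongr w (LinearEquiv.ofInjective ε hε).symm
  refine ⟨Λ.toContinuousLinearEquiv, fun ν ↦ ?_⟩
  have h3 := Submodule.prodEquivOfIsCompl_symm_apply_right _ _ hW.symm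
    (LinearEquiv.ofInjective ε hε ν)
  have h4 : Λ (ε ν) = (0, ν) := by
    simp only [Λ, LinearEquiv.trans_apply]
    rw [show ε ν = ((LinearEquiv.ofInjective ε hε ν : LinearMap.range ε) : E) from rfl, h3]
    simp
  exact h4

variable {n q k : ℕ} {M : Type u} [TopologicalSpace M] [ChartedSpace (Eucl n) M]
  [IsManifold (𝓡 n) ∞ M]

/-- Near every point there are coordinates in which a given distribution consists of the graphs of
linear maps `A(z)`. -/
theorem IsDistribution.exists_graph_chart (hn : n = q + k)
    {V : ∀ x : M, Submodule ℝ (TangentSpace (𝓡 n) x)} (hV : IsDistribution k V) (x₀ : M) :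
    ∃ (φ : OpenPartialHomeomorph M (Eucl q × Eucl k)) (A : Eucl q × Eucl k → Eucl k →L[ℝ] Eucl q),
      IsSmoothChart (n := n) φ ∧ x₀ ∈ φ.source ∧ φ x₀ = 0 ∧ ContDiffOn ℝ ∞ A φ.target ∧
      ∀ y ∈ φ.source, ∀ v, v ∈ V y ↔
        (mvfderiv (𝓡 n) φ y v).1 = A (φ y) (mvfderiv (𝓡 n) φ y v).2 := by
  obtain ⟨U, hU, hxU, e, he, hspan⟩ := hV x₀
  set c := chartAt (Eucl n) x₀
  have hc : IsSmoothChart (n := n) c := isSmoothChart_chartAt x₀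
  have hxc : x₀ ∈ c.source := mem_chart_source _ x₀
  -- the frame of the distribution, in the chart
  let ε : M → Eucl k → Eucl n := fun y ν ↦ mvfderiv (𝓡 n) c y (∑ i, ν i • e i y)
  have hε : ∀ y ν, ε y ν = ∑ i, ν i • mvfderiv (𝓡 n) c y (e i y) := fun y ν ↦ by
    simp only [ε, map_sum, map_smul]
  let ε₀ : Eucl k →ₗ[ℝ] Eucl n :=
    { toFun := ε x₀
      map_add' := fun a b ↦ by simp [hε, add_smul, Finset.sum_add_distrib]
      map_smul' := fun t a ↦ by simp [hε, mul_smul, Finset.smul_sum] }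
  have hε₀ : Function.Injective ε₀ := by
    rw [injective_iff_map_eq_zero]
    intro ν hν
    have h1 : ∑ i, ν i • e i x₀ = 0 := (hc.bijective hxc).1 (hν.trans (map_zero _).symm)
    have h2 := Fintype.linearIndependent_iff.1 (hspan x₀ hxU).1 (fun i ↦ ν i) h1
    ext i
    exact h2 i
  obtain ⟨Λ, hΛ⟩ := exists_linear_coordinates (F := Eucl q) ε₀ hε₀ (by
    simp [hn])
  let Ψ : Eucl n ≃ₜ Eucl q × Eucl k := (Homeomorph.subRight (c x₀)).trans Λ.toHomeomorph
  have hΨ : ∀ z, Ψ z = Λ (z - c x₀) := fun z ↦ rfl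
  have hΨs : ContDiff ℝ ∞ Ψ := Λ.contDiff.comp (contDiff_id.sub contDiff_const)
  have hΨs' : ContDiff ℝ ∞ Ψ.symm := by
    have h : ∀ z, Ψ.symm z = Λ.symm z + c x₀ := fun z ↦ by
      rw [Homeomorph.symm_apply_eq, hΨ]; simp
    rw [funext h]
    exact Λ.symm.contDiff.add contDiff_const
  let φ₀ : OpenPartialHomeomorph M (Eucl q × Eucl k) := c.trans Ψ.toOpenPartialHomeomorph
  have hφ₀ : IsSmoothChart (n := n) φ₀ := hc.trans hΨs.contDiffOn hΨs'.contDiffOn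
  have hφ₀s : φ₀.source = c.source := by simp [φ₀]
  have hdφ₀ : ∀ y ∈ c.source, ∀ v, mvfderiv (𝓡 n) φ₀ y v = Λ (mvfderiv (𝓡 n) c y v) := by
    intro y hy v
    have h := mvfderiv_fderiv_comp (h := Ψ) (hΨs.differentiable (by simp) _)
      (hc.mdifferentiableAt hy) v
    refine h.trans ?_
    have h2 : HasFDerivAt Ψ (Λ : Eucl n →L[ℝ] Eucl q × Eucl k) (c y) := by
      have h3 := (Λ.hasFDerivAt (x := c y - c x₀)).comp (c y)
        ((hasFDerivAt_id (c y)).sub_const (c x₀))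
      exact h3
    rw [h2.fderiv]
    rfl
  -- the two components of the frame, as functions with values in linear maps
  have hframe : ∀ i, ContMDiffOn (𝓡 n) 𝓘(ℝ, Eucl q × Eucl k) ∞
      (fun y ↦ Λ (mvfderiv (𝓡 n) c y (e i y))) (c.source ∩ U) := fun i ↦
    Λ.contDiff.contMDiff.comp_contMDiffOn (contMDiffOn_mvfderiv_apply (c.open_source.inter hU)
      (hc.smooth.mono inter_subset_left) ((he i).mono inter_subset_right))
  let a : M → Eucl k →L[ℝ] Eucl q := fun y ↦ ∑ i, ContinuousLinearMap.smulRightL ℝ (Eucl k) (Eucl q)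
    (EuclideanSpace.proj i) (Λ (mvfderiv (𝓡 n) c y (e i y))).1
  let b : M → Eucl k →L[ℝ] Eucl k := fun y ↦ ∑ i, ContinuousLinearMap.smulRightL ℝ (Eucl k) (Eucl k)
    (EuclideanSpace.proj i) (Λ (mvfderiv (𝓡 n) c y (e i y))).2
  have hab : ∀ y ν, (a y ν, b y ν) = Λ (ε y ν) := by
    intro y ν
    rw [hε, map_sum]
    ext1
    · simp [a, ContinuousLinearMap.smulRightL, Prod.fst_sum]
    · simp [b, ContinuousLinearMap.smulRightL, Prod.snd_sum]
  have ha : ContMDiffOn (𝓡 n) 𝓘(ℝ, Eucl k →L[ℝ] Eucl q) ∞ a (c.source ∩ U) := by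
    refine contMDiffOn_finsetSum fun i _ ↦ ?_
    exact (ContinuousLinearMap.contDiff _).contMDiff.comp_contMDiffOn
      (contDiff_fst.contMDiff.comp_contMDiffOn (hframe i))
  have hb : ContMDiffOn (𝓡 n) 𝓘(ℝ, Eucl k →L[ℝ] Eucl k) ∞ b (c.source ∩ U) := by
    refine contMDiffOn_finsetSum fun i _ ↦ ?_
    exact (ContinuousLinearMap.contDiff _).contMDiff.comp_contMDiffOn
      (contDiff_snd.contMDiff.comp_contMDiffOn (hframe i))
  have hb₀ : b x₀ = ContinuousLinearMap.id ℝ (Eucl k) := by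
    ext1 ν
    exact congrArg Prod.snd ((hab x₀ ν).trans (hΛ ν))
  let O : Set M := (c.source ∩ U) ∩ b ⁻¹' range ((↑) : (Eucl k ≃L[ℝ] Eucl k) → _)
  have hO : IsOpen O :=
    hb.continuousOn.isOpen_inter_preimage (c.open_source.inter hU) ContinuousLinearEquiv.isOpen
  have hxO : x₀ ∈ O := ⟨⟨hxc, hxU⟩, ContinuousLinearEquiv.refl ℝ (Eucl k), by rw [hb₀]; rfl⟩
  let A : M → Eucl k →L[ℝ] Eucl q := fun y ↦ (a y).comp (b y).inverse
  have hA : ContMDiffOn (𝓡 n) 𝓘(ℝ, Eucl k →L[ℝ] Eucl q) ∞ A O := by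
    intro y hy
    obtain ⟨l, hl⟩ := hy.2
    have h1 : ContMDiffAt (𝓡 n) 𝓘(ℝ, Eucl k →L[ℝ] Eucl k) ∞ b y :=
      hb.contMDiffAt ((c.open_source.inter hU).mem_nhds hy.1)
    have h2 : ContDiffAt ℝ ∞ ContinuousLinearMap.inverse (b y) := by
      rw [← hl]; exact contDiffAt_map_inverse l
    have h3 : ContMDiffAt (𝓡 n) 𝓘(ℝ, Eucl k →L[ℝ] Eucl k) ∞ (fun y ↦ (b y).inverse) y :=
      h2.contMDiffAt.comp y h1
    exact (ContMDiffAt.clm_comp (ha.contMDiffAt ((c.open_source.inter hU).mem_nhds hy.1))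
      h3).contMDiffWithinAt
  refine ⟨φ₀.restrOpen O hO, fun z ↦ A (φ₀.symm z), hφ₀.restrOpen hO, ⟨by rwa [hφ₀s], hxO⟩, ?_,
    ?_, ?_⟩
  · show Λ (c x₀ - c x₀) = 0
    simp
  · have h := hA.comp ((hφ₀.restrOpen hO).smooth_symm) fun z hz ↦
      ((φ₀.restrOpen O hO).map_target hz).2
    exact h.contDiffOn
  · rintro y ⟨-, hy⟩ v
    have hyc := hy.1.1
    have hbij := hφ₀.bijective (x := y) (by rwa [hφ₀s])
    show _ ↔ (mvfderiv (𝓡 n) φ₀ y v).1 = A (φ₀.symm (φ₀ y)) (mvfderiv (𝓡 n) φ₀ y v).2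
    rw [φ₀.left_inv (by rwa [hφ₀s]), ← (hspan y hy.1.2).2, Submodule.mem_span_range_iff_exists_fun]
    obtain ⟨l, hl⟩ := hy.2
    have hA' : ∀ ν, A y (b y ν) = a y ν := fun ν ↦ by
      simp only [A, ContinuousLinearMap.comp_apply, ← hl, ContinuousLinearMap.inverse_equiv]
      simp
    have hsum : ∀ ν : Eucl k, mvfderiv (𝓡 n) φ₀ y (∑ i, ν i • e i y) = (a y ν, b y ν) :=
      fun ν ↦ by rw [hab, hdφ₀ y hyc]
    constructor
    · rintro ⟨ν, rfl⟩
      have := hsum (WithLp.toLp 2 ν)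
      simp only at this
      rw [this, hA']
    · intro h
      refine ⟨fun i ↦ l.symm (mvfderiv (𝓡 n) φ₀ y v).2 i, hbij.1 ?_⟩
      rw [hsum (l.symm (mvfderiv (𝓡 n) φ₀ y v).2)]
      have h1 : b y (l.symm (mvfderiv (𝓡 n) φ₀ y v).2) = (mvfderiv (𝓡 n) φ₀ y v).2 := by
        rw [← hl]; simp
      rw [← hA', h1]
      exact Prod.ext h.symm rfl

end GraphChart

section FlatChart

variable {n q k : ℕ} {M : Type u} [TopologicalSpace M] [ChartedSpace (Eucl n) M]
  [IsManifold (𝓡 n) ∞ M] {V : ∀ x : M, Submodule ℝ (TangentSpace (𝓡 n) x)}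

/-- A distribution which is parallel for a torsion-free connection is involutive. Involutivity is
stated as the symmetry of the second derivatives of the solutions of the equation `∂q/∂s = A(q, s)`
for the leaves. -/
theorem IsParallel.involutive {E P : Type*} [NormedAddCommGroup E] [NormedSpace ℝ E]
    [FiniteDimensional ℝ E] [NormedAddCommGroup P] [NormedSpace ℝ P] [FiniteDimensional ℝ P]
    {D : Connection n M} (hV : IsParallel D V) (hD : D.torsion = 0)
    {φ : OpenPartialHomeomorph M (E × P)} (hφ : IsSmoothChart (n := n) φ) {A : E × P → P →L[ℝ] E}
    (hA : ContDiffOn ℝ ∞ A φ.target) (hVA : ∀ y ∈ φ.source, ∀ v, v ∈ V y ↔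
        (mvfderiv (𝓡 n) φ y v).1 = A (φ y) (mvfderiv (𝓡 n) φ y v).2)
    {y : M} (hy : y ∈ φ.source) (ν τ : P) :
    fderiv ℝ A (φ y) (A (φ y) ν, ν) τ = fderiv ℝ A (φ y) (A (φ y) τ, τ) ν := by
  let X : P → ∀ y : M, TangentSpace (𝓡 n) y := fun ν y ↦ coordField φ (A (φ y) ν, ν) y
  have hAφ : ∀ ν, ContMDiffOn (𝓡 n) 𝓘(ℝ, E × P) ∞ (fun y ↦ (A (φ y) ν, ν)) φ.source := by
    intro ν
    have h1 : ContDiffOn ℝ ∞ (fun z ↦ (A z ν, ν)) φ.target :=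
      (hA.clm_apply contDiffOn_const).prodMk contDiffOn_const
    exact h1.contMDiffOn.comp hφ.smooth fun y hy ↦ φ.map_source hy
  have hX : ∀ ν, SmoothFieldOn φ.source (X ν) := fun ν ↦
    hφ.smoothFieldOn_of_coord φ.open_source subset_rfl (hAφ ν)
  have hdX : ∀ ν, ∀ y ∈ φ.source, mvfderiv (𝓡 n) φ y (X ν y) = (A (φ y) ν, ν) :=
    fun ν y hy ↦ hφ.mvfderiv_coordField hy _
  have hXV : ∀ ν, ∀ y ∈ φ.source, X ν y ∈ V y := fun ν y hy ↦ by
    rw [hVA y hy, hdX ν y hy]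
  have hder : ∀ ν τ, mvfderiv (𝓡 n) (fun y ↦ mvfderiv (𝓡 n) φ y (X τ y)) y (X ν y) =
      (fderiv ℝ A (φ y) (A (φ y) ν, ν) τ, 0) := by
    intro ν τ
    have h1 : (fun y ↦ mvfderiv (𝓡 n) φ y (X τ y)) =ᶠ[𝓝 y] fun y ↦ (A (φ y) τ, τ) := by
      filter_upwards [φ.open_source.mem_nhds hy] with z hz using hdX τ z hz
    have hAd : HasFDerivAt A (fderiv ℝ A (φ y)) (φ y) :=
      ((hA.contDiffAt (φ.open_target.mem_nhds (φ.map_source hy))).differentiableAt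
        (by simp)).hasFDerivAt
    have h2 : HasFDerivAt (fun z ↦ (A z τ, τ)) _ (φ y) :=
      (hAd.clm_apply (hasFDerivAt_const τ (φ y))).prodMk (hasFDerivAt_const τ (φ y))
    rw [mvfderiv_congr_of_eventuallyEq h1]
    refine (mvfderiv_fderiv_comp (h := fun z ↦ (A z τ, τ)) h2.differentiableAt
      (hφ.mdifferentiableAt hy) _).trans ?_
    rw [h2.fderiv, hdX ν y hy]
    simp
  have hcov : ∀ ν τ, mvfderiv (𝓡 n) φ y (D (X τ) y (X ν y)) =
      (fderiv ℝ A (φ y) (A (φ y) ν, ν) τ, 0) + mvfderiv (𝓡 n) φ y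
        (D (coordField φ (A (φ y) τ, τ)) y (coordField φ (A (φ y) ν, ν) y)) := by
    intro ν τ
    rw [Connection.coord_eq hφ D hy ((hX τ).mdifferentiableAt φ.open_source hy), hder,
      hdX τ y hy]
  have hmem : ∀ ν τ, D (X τ) y (X ν y) ∈ V y := fun ν τ ↦
    hV φ.source (X τ) φ.open_source (hX τ) (hXV τ) y hy _
  have hdiff := (V y).sub_mem (hmem ν τ) (hmem τ ν)
  rw [hVA y hy, map_sub, hcov, hcov, Connection.coordField_symm hφ hD hy, add_sub_add_right_eq_sub]
    at hdiff
  simpa [sub_eq_zero] using hdiff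

/-- Coordinates `(q, s)` in which the leaves of a distribution are given by `q = const`. -/
theorem IsDistribution.exists_flat_chart (hn : n = q + k) (hV : IsDistribution k V)
    {D : Connection n M} (hD : D.torsion = 0) (hp : IsParallel D V) (x₀ : M) :
    ∃ φ : OpenPartialHomeomorph M (Eucl q × Eucl k), IsSmoothChart (n := n) φ ∧ x₀ ∈ φ.source ∧
      ∀ y ∈ φ.source, ∀ v, v ∈ V y ↔ (mvfderiv (𝓡 n) φ y v).1 = 0 := by
  obtain ⟨φ, A, hφ, hx, hx0, hA, hVA⟩ := hV.exists_graph_chart hn x₀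
  have h0 : (0 : Eucl q × Eucl k) ∈ φ.target := hx0 ▸ φ.map_source hx
  obtain ⟨χ, h0χ, hχt, hχ, hχ', hχA⟩ := exists_frobenius_chart φ.open_target hA h0
    fun z hz ν τ ↦ by
      have := hp.involutive hD hφ hA hVA (φ.map_target hz) ν τ
      rwa [φ.right_inv hz] at this
  refine ⟨φ.trans χ, hφ.trans hχ hχ', ⟨hx, show φ x₀ ∈ χ.source by rwa [hx0]⟩, ?_⟩
  rintro y ⟨hy, hyχ⟩ v
  have hyχ' : φ y ∈ χ.source := hyχ
  have h1 : mvfderiv (𝓡 n) (φ.trans χ) y v = fderiv ℝ χ (φ y) (mvfderiv (𝓡 n) φ y v) :=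
    mvfderiv_fderiv_comp (h := χ) ((hχ.contDiffAt (χ.open_source.mem_nhds hyχ')).differentiableAt
      (by simp)) (hφ.mdifferentiableAt hy) v
  rw [h1, hχA _ hyχ', hVA y hy]

end FlatChart

section Boxes

variable {n q k : ℕ} {M : Type u} [TopologicalSpace M] [ChartedSpace (Eucl n) M]
  [IsManifold (𝓡 n) ∞ M] {V : ∀ x : M, Submodule ℝ (TangentSpace (𝓡 n) x)}

omit [IsManifold (𝓡 n) ∞ M] in
/-- If the leaves of `V` are given by `q = const` in a chart `(q, s)` onto the whole coordinate
space, then `q` is the projection onto a local leaf space. -/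
theorem IsSmoothChart.isLeafFibration {φ : OpenPartialHomeomorph M (Eucl q × Eucl k)}
    (hφ : IsSmoothChart (n := n) φ) (htarget : φ.target = univ)
    (hV : ∀ y ∈ φ.source, ∀ v, v ∈ V y ↔ (mvfderiv (𝓡 n) φ y v).1 = 0) :
    IsLeafFibration (q := q) V φ.source (fun y ↦ (φ y).1) where
  bundle :=
    { isOpen := φ.open_source
      surj := by
        refine eq_univ_of_forall fun z ↦ ⟨φ.symm (z, 0), φ.map_target (htarget ▸ mem_univ _), ?_⟩
        exact congrArg Prod.fst (φ.right_inv (htarget ▸ mem_univ _))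
      smooth := contDiff_fst.contMDiff.comp_contMDiffOn hφ.smooth
      locally_trivial := fun z ↦ by
        refine ⟨univ, isOpen_univ, mem_univ _, k, Eucl k, inferInstance, inferInstance,
          inferInstance, φ, by simp, by rw [htarget, univ_prod_univ], ?_, ?_, fun x _ ↦ rfl⟩
        · exact ContMDiffOn.prodMk (contDiff_fst.contMDiff.comp_contMDiffOn hφ.smooth)
            (contDiff_snd.contMDiff.comp_contMDiffOn hφ.smooth)
        · have h := hφ.smooth_symm
          rw [modelWithCornersSelf_prod, ← chartedSpaceSelf_prod] at h
          exact h }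
  ker_eq := fun y hy ↦ by
    ext v
    have h := mvfderiv_chart_fst hφ hy v
    rw [hV y hy, ← h]
    rfl
  fibre_connected := fun z ↦ by
    have himage : φ.source ∩ (fun y ↦ (φ y).1) ⁻¹' {z} = φ.symm '' ({z} ×ˢ univ) := by
      ext x
      constructor
      · rintro ⟨hx, hxz⟩
        exact ⟨φ x, ⟨hxz, mem_univ _⟩, φ.left_inv hx⟩
      · rintro ⟨w, hw, rfl⟩
        have hwt : w ∈ φ.target := htarget ▸ mem_univ _
        refine ⟨φ.map_target hwt, ?_⟩
        rw [mem_preimage, φ.right_inv hwt]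
        exact hw.1
    rw [himage]
    exact (isConnected_singleton.prod isConnected_univ).image _
      (φ.continuousOn_symm.mono (by rw [htarget]; exact subset_univ _))

end Boxes

/-! ### The Poincaré lemma with parameters -/

section PotentialChart

variable {F P G : Type u} [NormedAddCommGroup F] [NormedSpace ℝ F] [FiniteDimensional ℝ F]
  [NormedAddCommGroup P] [NormedSpace ℝ P] [FiniteDimensional ℝ P]
  [NormedAddCommGroup G] [NormedSpace ℝ G] [FiniteDimensional ℝ G]

/-- The Poincaré lemma with parameters `q`: if `C(q, ·)` is a closed `1`-form for every `q`, then it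
is locally the differential of a function `p(q, ·)`, smooth in both variables. -/
theorem exists_potential {C : F × P → P →L[ℝ] G} (hC : ContDiff ℝ ∞ C)
    (hclosed : ∀ z ν τ, fderiv ℝ C z (0, ν) τ = fderiv ℝ C z (0, τ) ν) :
    ∃ δ > 0, ∃ p : F × P → G, ContDiffOn ℝ ∞ p (Metric.ball 0 δ) ∧
      ∀ z ∈ Metric.ball 0 δ, ∀ ν, fderiv ℝ p z (0, ν) = C z ν := by
  -- the total differential equation `dq/ds = 0`, `dp/ds = C(q, s)`
  let A : (F × G) × P → P →L[ℝ] F × G := fun z ↦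
    (ContinuousLinearMap.inr ℝ F G).comp (C (z.1.1, z.2))
  have hCz : ∀ z : (F × G) × P, HasFDerivAt (fun z : (F × G) × P ↦ C (z.1.1, z.2))
      ((fderiv ℝ C (z.1.1, z.2)).comp (((ContinuousLinearMap.fst ℝ F G).comp
        (ContinuousLinearMap.fst ℝ (F × G) P)).prod (ContinuousLinearMap.snd ℝ (F × G) P))) z :=
    fun z ↦ HasFDerivAt.comp (g := C) z (hC.differentiable (by simp) _).hasFDerivAt
      (((ContinuousLinearMap.fst ℝ F G).comp
        (ContinuousLinearMap.fst ℝ (F × G) P)).prod (ContinuousLinearMap.snd ℝ (F × G) P)).hasFDerivAt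
  have hA : ContDiff ℝ ∞ A :=
    contDiff_const.clm_comp (hC.comp (f := fun z : (F × G) × P ↦ (z.1.1, z.2)) (by fun_prop))
  have hAd : ∀ z h τ, fderiv ℝ A z h τ = (0, fderiv ℝ C (z.1.1, z.2) (h.1.1, h.2) τ) := by
    intro z h τ
    have h1 := (hasFDerivAt_const (ContinuousLinearMap.inr ℝ F G) z).clm_comp (hCz z)
    have h2 : HasFDerivAt A _ z := h1
    rw [h2.fderiv]
    simp
  obtain ⟨N, Y, hN, hN0, hY, hY0, hYN⟩ := exists_totalDifferential (A := A) (e₀ := 0) isOpen_univ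
    hA.contDiffOn (mem_univ _) fun z _ ν τ ↦ by
      rw [hAd, hAd]
      simp only [A, ContinuousLinearMap.comp_apply, ContinuousLinearMap.inr_apply]
      rw [hclosed]
  have hj : Continuous fun z : F × P ↦ ((z.1, (0 : G)), z.2) := by fun_prop
  obtain ⟨δ, hδ, hball⟩ := Metric.isOpen_iff.1 (hN.preimage hj) 0 hN0
  have hjd : ∀ z : F × P, HasFDerivAt (fun z : F × P ↦ ((z.1, (0 : G)), z.2))
      (((ContinuousLinearMap.inl ℝ F G).comp (ContinuousLinearMap.fst ℝ F P)).prod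
        (ContinuousLinearMap.snd ℝ F P)) z := fun z ↦
    (((ContinuousLinearMap.inl ℝ F G).comp (ContinuousLinearMap.fst ℝ F P)).prod
        (ContinuousLinearMap.snd ℝ F P)).hasFDerivAt
  have hYj : ContDiffOn ℝ ∞ (fun z : F × P ↦ Y ((z.1, 0), z.2)) (Metric.ball 0 δ) :=
    hY.comp (by fun_prop) hball
  have hYd : ∀ z ∈ Metric.ball (0 : F × P) δ, ∀ ν,
      fderiv ℝ (fun z : F × P ↦ Y ((z.1, 0), z.2)) z (0, ν) =
        (0, C ((Y ((z.1, 0), z.2)).1, z.2) ν) := by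
    intro z hz ν
    have hd : HasFDerivAt Y (fderiv ℝ Y ((z.1, 0), z.2)) ((z.1, 0), z.2) :=
      ((hY.contDiffAt (hN.mem_nhds (hball hz))).differentiableAt (by simp)).hasFDerivAt
    have h := HasFDerivAt.comp (g := Y) z hd (hjd z)
    have h' : HasFDerivAt (fun z : F × P ↦ Y ((z.1, 0), z.2)) _ z := h
    rw [h'.fderiv]
    have h2 := (hYN _ (hball hz)).2 ν
    refine Eq.trans ?_ h2
    simp only [ContinuousLinearMap.comp_apply, ContinuousLinearMap.prod_apply,
      ContinuousLinearMap.coe_fst', ContinuousLinearMap.coe_snd', map_zero]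
  -- the component `q` of the solution is constant
  have hY1 : ∀ z ∈ Metric.ball (0 : F × P) δ, (Y ((z.1, 0), z.2)).1 = z.1 := by
    rintro ⟨q, s⟩ hz
    have hz' : (q, s) ∈ Metric.ball (0 : F) δ ×ˢ Metric.ball (0 : P) δ := by
      rw [ball_prod_same]; exact hz
    have hq : ∀ t ∈ Metric.ball (0 : P) δ, (q, t) ∈ Metric.ball (0 : F × P) δ := fun t ht ↦ by
      have h : (q, t) ∈ Metric.ball (0 : F) δ ×ˢ Metric.ball (0 : P) δ := ⟨hz'.1, ht⟩
      rw [ball_prod_same] at h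
      exact h
    have hder : ∀ t ∈ Metric.ball (0 : P) δ, HasFDerivAt (fun t ↦ (Y ((q, 0), t)).1) (0 : P →L[ℝ] F) t := by
      intro t ht
      have h1 := ((hYj.contDiffAt (Metric.isOpen_ball.mem_nhds (hq t ht))).differentiableAt
        (by simp)).hasFDerivAt
      have h2 := (hasFDerivAt_fst.comp t (HasFDerivAt.comp (f := fun t : P ↦ (q, t)) t h1
        (ContinuousLinearMap.inr ℝ F P |>.hasFDerivAt.const_add (q, (0 : P)) |>.congr_of_eventuallyEq
          (Filter.Eventually.of_forall fun t ↦ by simp))))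
      refine h2.congr_fderiv ?_
      ext ν
      have h3 := hYd (q, t) (hq t ht) ν
      simp only [ContinuousLinearMap.comp_apply, ContinuousLinearMap.inr_apply]
      rw [h3]
      rfl
    have h := Metric.isOpen_ball.is_const_of_fderiv_eq_zero (𝕜 := ℝ)
      (convex_ball (0 : P) δ).isPreconnected
      (fun t ht ↦ (hder t ht).differentiableAt.differentiableWithinAt)
      (fun t ht ↦ (hder t ht).fderiv) hz'.2 (Metric.mem_ball_self hδ)
    have h0 := hY0 (q, 0) (hball (hq 0 (Metric.mem_ball_self hδ)))
    simp only at h ⊢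
    rw [h, h0]
  refine ⟨δ, hδ, fun z ↦ (Y ((z.1, 0), z.2)).2, contDiff_snd.comp_contDiffOn hYj, fun z hz ν ↦ ?_⟩
  have h1 := ((hYj.contDiffAt (Metric.isOpen_ball.mem_nhds hz)).differentiableAt
      (show (∞ : ℕ∞ω) ≠ 0 by simp)).hasFDerivAt
  have h2 : HasFDerivAt (fun z : F × P ↦ (Y ((z.1, 0), z.2)).2) _ z := hasFDerivAt_snd.comp z h1
  rw [h2.fderiv, ContinuousLinearMap.comp_apply, hYd z hz, hY1 z hz]
  rfl

/-- The potential of the preceding lemma as a coordinate, when its differential is bijective. -/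
theorem exists_potential_chart {C : F × P → P →L[ℝ] G} (hC : ContDiff ℝ ∞ C)
    (hclosed : ∀ z ν τ, fderiv ℝ C z (0, ν) τ = fderiv ℝ C z (0, τ) ν)
    (hinj : Function.Injective (C 0)) (hd : Module.finrank ℝ P = Module.finrank ℝ G) :
    ∃ ψ : OpenPartialHomeomorph (F × P) (F × G), 0 ∈ ψ.source ∧
      ContDiffOn ℝ ∞ ψ ψ.source ∧ ContDiffOn ℝ ∞ ψ.symm ψ.target ∧ (∀ z, (ψ z).1 = z.1) ∧
      ∀ z ∈ ψ.source, (∀ v, (fderiv ℝ ψ z v).1 = v.1) ∧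
        ∀ ν, fderiv ℝ ψ z (0, ν) = (0, C z ν) := by
  obtain ⟨δ, hδ, p, hp, hpd⟩ := exists_potential hC hclosed
  have hΨ : ContDiffOn ℝ ∞ (fun z : F × P ↦ (z.1, p z)) (Metric.ball 0 δ) :=
    contDiffOn_fst.prodMk hp
  have hΨd : ∀ z ∈ Metric.ball (0 : F × P) δ, ∀ v,
      fderiv ℝ (fun z : F × P ↦ (z.1, p z)) z v = (v.1, fderiv ℝ p z v) := by
    intro z hz v
    have h1 := ((hp.contDiffAt (Metric.isOpen_ball.mem_nhds hz)).differentiableAt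
        (show (∞ : ℕ∞ω) ≠ 0 by simp)).hasFDerivAt
    have h2 : HasFDerivAt (fun z : F × P ↦ (z.1, p z)) _ z := hasFDerivAt_fst.prodMk h1
    rw [h2.fderiv]
    rfl
  have h0 := Metric.mem_ball_self (x := (0 : F × P)) hδ
  have hb : Function.Bijective (fderiv ℝ (fun z : F × P ↦ (z.1, p z)) 0) := by
    have hi : Function.Injective (fderiv ℝ (fun z : F × P ↦ (z.1, p z)) 0) := by
      rw [injective_iff_map_eq_zero]
      rintro ⟨a, ν⟩ h
      rw [hΨd 0 h0] at h
      obtain rfl : a = 0 := congrArg Prod.fst h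
      have h1 := congrArg Prod.snd h
      simp only [hpd 0 h0] at h1
      exact Prod.ext rfl (hinj (h1.trans (map_zero _).symm))
    have hd' : Module.finrank ℝ (F × P) = Module.finrank ℝ (F × G) := by
      rw [Module.finrank_prod, Module.finrank_prod, hd]
    exact ⟨hi, (LinearMap.injective_iff_surjective_of_finrank_eq_finrank hd'
      (f := (fderiv ℝ (fun z : F × P ↦ (z.1, p z)) 0).toLinearMap)).1 hi⟩
  obtain ⟨ψ, h0ψ, hψ, hψf, hψs⟩ := exists_openPartialHomeomorph_of_bijective Metric.isOpen_ball hΨ h0 hb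
  refine ⟨ψ, h0ψ, hψf ▸ hΨ.mono hψ, hψs, fun z ↦ by rw [hψf], fun z hz ↦ ⟨?_, ?_⟩⟩
  · intro v
    rw [hψf, hΨd z (hψ hz)]
  · intro ν
    rw [hψf, hΨd z (hψ hz), hpd z (hψ hz)]

end PotentialChart

/-! ### Changes of coordinates -/

section Boxes

variable {q k : ℕ}

/-- A product of two balls of radius `ε > 0`, blown up to the whole space. -/
def box (c : Eucl q) (d : Eucl k) (ε : ℝ) :
    OpenPartialHomeomorph (Eucl q × Eucl k) (Eucl q × Eucl k) :=
  (OpenPartialHomeomorph.univBall c ε).symm.prod (OpenPartialHomeomorph.univBall d ε).symm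

theorem box_source (c : Eucl q) (d : Eucl k) {ε : ℝ} (hε : 0 < ε) :
    (box c d ε).source = Metric.ball c ε ×ˢ Metric.ball d ε := by
  simp [box, OpenPartialHomeomorph.univBall_target, hε]

theorem box_target (c : Eucl q) (d : Eucl k) (ε : ℝ) : (box c d ε).target = univ := by
  simp [box]

theorem contDiffOn_box (c : Eucl q) (d : Eucl k) {ε : ℝ} (hε : 0 < ε) :
    ContDiffOn ℝ ∞ (box c d ε) (box c d ε).source := by
  rw [box_source c d hε]
  exact (OpenPartialHomeomorph.contDiffOn_univBall_symm.comp contDiffOn_fst fun z hz ↦ hz.1).prodMk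
    (OpenPartialHomeomorph.contDiffOn_univBall_symm.comp contDiffOn_snd fun z hz ↦ hz.2)

theorem contDiffOn_box_symm (c : Eucl q) (d : Eucl k) (ε : ℝ) :
    ContDiffOn ℝ ∞ (box c d ε).symm (box c d ε).target :=
  ((OpenPartialHomeomorph.contDiff_univBall.comp contDiff_fst).prodMk
    (OpenPartialHomeomorph.contDiff_univBall.comp contDiff_snd)).contDiffOn

variable {n : ℕ} {M : Type u} [TopologicalSpace M] [ChartedSpace (Eucl n) M]
  [IsManifold (𝓡 n) ∞ M] {V : ∀ x : M, Submodule ℝ (TangentSpace (𝓡 n) x)}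

omit [IsManifold (𝓡 n) ∞ M] in
/-- Blowing up a box inside the target of a flat chart gives a flat chart onto the whole space. -/
theorem IsSmoothChart.trans_box {φ : OpenPartialHomeomorph M (Eucl q × Eucl k)}
    (hφ : IsSmoothChart (n := n) φ)
    (hV : ∀ y ∈ φ.source, ∀ v, v ∈ V y ↔ (mvfderiv (𝓡 n) φ y v).1 = 0) {c : Eucl q} {d : Eucl k}
    {ε : ℝ} (hε : 0 < ε) (hball : Metric.ball c ε ×ˢ Metric.ball d ε ⊆ φ.target) :
    IsSmoothChart (n := n) (φ.trans (box c d ε)) ∧ (φ.trans (box c d ε)).target = univ ∧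
      (∀ y, y ∈ (φ.trans (box c d ε)).source ↔
        y ∈ φ.source ∧ φ y ∈ Metric.ball c ε ×ˢ Metric.ball d ε) ∧
      ∀ y ∈ (φ.trans (box c d ε)).source, ∀ v, v ∈ V y ↔
        (mvfderiv (𝓡 n) (φ.trans (box c d ε)) y v).1 = 0 := by
  have hbox := contDiffOn_box c d hε
  have hbox' := contDiffOn_box_symm c d ε
  have hsource : ∀ y, y ∈ (φ.trans (box c d ε)).source ↔
        y ∈ φ.source ∧ φ y ∈ Metric.ball c ε ×ˢ Metric.ball d ε := fun y ↦ by
    rw [OpenPartialHomeomorph.trans_source, box_source c d hε]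
    rfl
  refine ⟨hφ.trans hbox hbox', ?_, hsource, ?_⟩
  · rw [OpenPartialHomeomorph.trans_target, box_target, univ_inter]
    refine eq_univ_of_forall fun z ↦ hball ?_
    rw [← box_source c d hε]
    exact (box c d ε).map_target (box_target c d ε ▸ mem_univ z)
  · intro y hy v
    obtain ⟨hyφ, hyb⟩ := (hsource y).1 hy
    let u := (OpenPartialHomeomorph.univBall c ε).symm
    have hu : ContDiffOn ℝ ∞ u u.source := by
      simpa [u, OpenPartialHomeomorph.univBall_target c hε] using
        OpenPartialHomeomorph.contDiffOn_univBall_symm (c := c) (r := ε) (n := (⊤ : ℕ∞))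
    have hu' : ContDiffOn ℝ ∞ u.symm u.target := OpenPartialHomeomorph.contDiff_univBall.contDiffOn
    have hyu : (φ y).1 ∈ u.source := by
      simpa [u, OpenPartialHomeomorph.univBall_target c hε] using hyb.1
    have h1 : (mvfderiv (𝓡 n) (φ.trans (box c d ε)) y v).1 =
        fderiv ℝ u (φ y).1 (mvfderiv (𝓡 n) φ y v).1 := by
      rw [← mvfderiv_chart_fst (hφ.trans hbox hbox') hy, ← mvfderiv_chart_fst hφ hyφ]
      exact mvfderiv_fderiv_comp (f := fun y ↦ (φ y).1) (h := u)
        ((hu.contDiffAt (u.open_source.mem_nhds hyu)).differentiableAt (by simp))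
        ((contDiff_fst (𝕜 := ℝ) (n := ∞)).contMDiff.contMDiffAt.comp y
          (hφ.contMDiffAt hyφ) |>.mdifferentiableAt (by simp)) v
    rw [hV y hyφ, h1]
    constructor
    · intro h
      rw [h, map_zero]
    · intro h
      have := fderiv_symm_fderiv hu hu' hyu (mvfderiv (𝓡 n) φ y v).1
      rwa [h, map_zero, eq_comm] at this

end Boxes

section CotangentLift

variable {F F' : Type*} [NormedAddCommGroup F] [NormedSpace ℝ F]
  [NormedAddCommGroup F'] [NormedSpace ℝ F']

/-- The cotangent lift `(q, p) ↦ (f(q), p ∘ (df_q)⁻¹)` of a smooth change of coordinates `f`. -/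
def cotangentLift (f : OpenPartialHomeomorph F F') (hf : ContDiffOn ℝ ∞ f f.source)
    (hf' : ContDiffOn ℝ ∞ f.symm f.target) :
    OpenPartialHomeomorph (F × (F →L[ℝ] ℝ)) (F' × (F' →L[ℝ] ℝ)) where
  toFun z := (f z.1, z.2.comp (fderiv ℝ f.symm (f z.1)))
  invFun z := (f.symm z.1, z.2.comp (fderiv ℝ f (f.symm z.1)))
  source := f.source ×ˢ univ
  target := f.target ×ˢ univ
  map_source' := fun z hz ↦ ⟨f.map_source hz.1, mem_univ _⟩
  map_target' := fun z hz ↦ ⟨f.map_target hz.1, mem_univ _⟩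
  left_inv' := fun z hz ↦ by
    refine Prod.ext (f.left_inv hz.1) ?_
    ext v
    simp only [ContinuousLinearMap.comp_apply, f.left_inv hz.1, fderiv_symm_fderiv hf hf' hz.1]
  right_inv' := fun z hz ↦ by
    refine Prod.ext (f.right_inv hz.1) ?_
    ext v
    simp only [ContinuousLinearMap.comp_apply, f.right_inv hz.1, fderiv_fderiv_symm hf hf' hz.1]
  open_source := f.open_source.prod isOpen_univ
  open_target := f.open_target.prod isOpen_univ
  continuousOn_toFun := by
    refine (f.continuousOn.comp continuousOn_fst fun z hz ↦ hz.1).prodMk ?_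
    exact continuousOn_snd.clm_comp ((hf'.continuousOn_fderiv_of_isOpen f.open_target
      (by simp)).comp (f.continuousOn.comp continuousOn_fst fun z hz ↦ hz.1)
        fun z hz ↦ f.map_source hz.1)
  continuousOn_invFun := by
    refine (f.continuousOn_symm.comp continuousOn_fst fun z hz ↦ hz.1).prodMk ?_
    exact continuousOn_snd.clm_comp ((hf.continuousOn_fderiv_of_isOpen f.open_source
      (by simp)).comp (f.continuousOn_symm.comp continuousOn_fst fun z hz ↦ hz.1)
        fun z hz ↦ f.map_target hz.1)

variable {f : OpenPartialHomeomorph F F'} {hf : ContDiffOn ℝ ∞ f f.source}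
    {hf' : ContDiffOn ℝ ∞ f.symm f.target}

theorem contDiffOn_cotangentLift :
    ContDiffOn ℝ ∞ (cotangentLift f hf hf') (cotangentLift f hf hf').source := by
  have h1 : ContDiffOn ℝ ∞ (fun z : F × (F →L[ℝ] ℝ) ↦ f z.1) (f.source ×ˢ univ) :=
    hf.comp contDiffOn_fst fun z hz ↦ hz.1
  refine h1.prodMk (contDiffOn_snd.clm_comp ?_)
  exact (hf'.fderiv_of_isOpen f.open_target (m := ∞) (by simp)).comp h1 fun z hz ↦ f.map_source hz.1

theorem contDiffOn_cotangentLift_symm :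
    ContDiffOn ℝ ∞ (cotangentLift f hf hf').symm (cotangentLift f hf hf').target := by
  have h1 : ContDiffOn ℝ ∞ (fun z : F' × (F' →L[ℝ] ℝ) ↦ f.symm z.1) (f.target ×ˢ univ) :=
    hf'.comp contDiffOn_fst fun z hz ↦ hz.1
  refine h1.prodMk (contDiffOn_snd.clm_comp ?_)
  exact (hf.fderiv_of_isOpen f.open_source (m := ∞) (by simp)).comp h1 fun z hz ↦ f.map_target hz.1

theorem fderiv_cotangentLift_fst {z : F × (F →L[ℝ] ℝ)} (hz : z.1 ∈ f.source)
    (v : F × (F →L[ℝ] ℝ)) :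
    (fderiv ℝ (cotangentLift f hf hf') z v).1 = fderiv ℝ f z.1 v.1 := by
  have h1 := ((contDiffOn_cotangentLift (hf := hf) (hf' := hf')).contDiffAt
    ((cotangentLift f hf hf').open_source.mem_nhds (show z ∈ _ from ⟨hz, mem_univ _⟩))).differentiableAt
      (show (∞ : ℕ∞ω) ≠ 0 by simp)
  have h2 : HasFDerivAt (fun z : F × (F →L[ℝ] ℝ) ↦ f z.1) _ z :=
    HasFDerivAt.comp (g := Prod.fst) z hasFDerivAt_fst h1.hasFDerivAt
  have h3 : HasFDerivAt (fun z : F × (F →L[ℝ] ℝ) ↦ f z.1) _ z :=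
    HasFDerivAt.comp (g := f) (f := Prod.fst) z
      ((hf.contDiffAt (f.open_source.mem_nhds hz)).differentiableAt
        (show (∞ : ℕ∞ω) ≠ 0 by simp)).hasFDerivAt hasFDerivAt_fst
  exact DFunLike.congr_fun (h2.unique h3) v

theorem fderiv_cotangentLift_vertical {z : F × (F →L[ℝ] ℝ)} (hz : z.1 ∈ f.source)
    (η : F →L[ℝ] ℝ) :
    fderiv ℝ (cotangentLift f hf hf') z (0, η) = (0, η.comp (fderiv ℝ f.symm (f z.1))) := by
  have h1 := ((contDiffOn_cotangentLift (hf := hf) (hf' := hf')).contDiffAt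
    ((cotangentLift f hf hf').open_source.mem_nhds (show z ∈ _ from ⟨hz, mem_univ _⟩))).differentiableAt
      (show (∞ : ℕ∞ω) ≠ 0 by simp)
  have h2 : HasFDerivAt (fun p : F →L[ℝ] ℝ ↦ cotangentLift f hf hf' (z.1, p))
      ((fderiv ℝ (cotangentLift f hf hf') z).comp (ContinuousLinearMap.inr ℝ F (F →L[ℝ] ℝ))) z.2 :=
    HasFDerivAt.comp (g := cotangentLift f hf hf') (f := fun p : F →L[ℝ] ℝ ↦ (z.1, p)) z.2
      h1.hasFDerivAt (hasFDerivAt_prodMk_right z.1 z.2)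
  have h3 : HasFDerivAt (fun p : F →L[ℝ] ℝ ↦ cotangentLift f hf hf' (z.1, p)) _ z.2 :=
    (hasFDerivAt_const (f z.1) z.2).prodMk
      ((hasFDerivAt_id z.2).clm_comp (hasFDerivAt_const (fderiv ℝ f.symm (f z.1)) z.2))
  have h4 := DFunLike.congr_fun (h2.unique h3) η
  simp only [ContinuousLinearMap.comp_apply, ContinuousLinearMap.inr_apply] at h4
  rw [h4]
  ext <;> simp

end CotangentLift

/-! ### Metric coefficients -/

section MetricCoefficients

variable {n : ℕ} {M : Type u} [TopologicalSpace M] [ChartedSpace (Eucl n) M]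
  [IsManifold (𝓡 n) ∞ M]

theorem contMDiffOn_metric (g : PseudoRiemannianMetric n M) {U : Set M}
    {X Y : ∀ x : M, TangentSpace (𝓡 n) x} (hX : SmoothFieldOn U X) (hY : SmoothFieldOn U Y) :
    ContMDiffOn (𝓡 n) 𝓘(ℝ, ℝ) ∞ (fun y ↦ g.form y (X y) (Y y)) U := by
  intro x hx
  have h := ContMDiffWithinAt.clm_bundle_apply₂ (F₁ := Eucl n) (F₂ := Eucl n) (F₃ := ℝ)
    (E₃ := fun _ : M ↦ ℝ) (ψ := g.form) ((g.smooth x).contMDiffWithinAt (s := U)) (hX x hx) (hY x hx)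
  rw [contMDiffWithinAt_totalSpace] at h
  exact h.2

variable {E : Type*} [NormedAddCommGroup E] [NormedSpace ℝ E] [FiniteDimensional ℝ E]
  {φ : OpenPartialHomeomorph M E}

omit [IsManifold (𝓡 n) ∞ M] in
theorem IsSmoothChart.mvfderiv_apply_coordField (hφ : IsSmoothChart (n := n) φ) {x : M}
    (hx : x ∈ φ.source) {E' : Type*} [NormedAddCommGroup E'] [NormedSpace ℝ E'] {f : M → E'}
    (hf : MDifferentiableAt (𝓡 n) 𝓘(ℝ, E') f x) (a : E) :
    DifferentiableAt ℝ (fun z ↦ f (φ.symm z)) (φ x) ∧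
      mvfderiv (𝓡 n) f x (coordField φ a x) = fderiv ℝ (fun z ↦ f (φ.symm z)) (φ x) a := by
  have h1 : MDifferentiableAt 𝓘(ℝ, E) 𝓘(ℝ, E') (fun z ↦ f (φ.symm z)) (φ x) := by
    refine MDifferentiableAt.comp (I' := 𝓡 n) (φ x) (g := f) ?_
      (hφ.mdifferentiableAt_symm (φ.map_source hx))
    rwa [φ.left_inv hx]
  have h2 : f =ᶠ[𝓝 x] fun y ↦ (fun z ↦ f (φ.symm z)) (φ y) := by
    filter_upwards [φ.open_source.mem_nhds hx] with y hy
    rw [φ.left_inv hy]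
  refine ⟨h1.differentiableAt, ?_⟩
  rw [mvfderiv_congr_of_eventuallyEq h2, mvfderiv_fderiv_comp h1.differentiableAt
    (hφ.mdifferentiableAt hx), hφ.mvfderiv_coordField hx]

/-- The coefficients of a metric in a chart, as functions on the target of the chart with values in
the bilinear forms. -/
def metricCoeff (g : PseudoRiemannianMetric n M) (φ : OpenPartialHomeomorph M E) (z : E) :
    E →L[ℝ] E →L[ℝ] ℝ :=
  IsBilinearMap.toContinuousBilinearMap
    (f := fun a b : E ↦ g.form (φ.symm z) (coordField φ a (φ.symm z)) (coordField φ b (φ.symm z)))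
    { add_left := fun a a' b ↦ by
        rw [coordField_add, Pi.add_apply, map_add, add_apply]
      smul_left := fun t a b ↦ by
        rw [coordField_smul, Pi.smul_apply, map_smul, smul_apply]
      add_right := fun a b b' ↦ by rw [coordField_add, Pi.add_apply, map_add]
      smul_right := fun t a b ↦ by rw [coordField_smul, Pi.smul_apply, map_smul] }

theorem metricCoeff_apply (g : PseudoRiemannianMetric n M) (φ : OpenPartialHomeomorph M E) (z a b : E) :
    metricCoeff g φ z a b =
      g.form (φ.symm z) (coordField φ a (φ.symm z)) (coordField φ b (φ.symm z)) := rfl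

theorem IsSmoothChart.contDiffOn_metricCoeff (hφ : IsSmoothChart (n := n) φ)
    (g : PseudoRiemannianMetric n M) : ContDiffOn ℝ ∞ (metricCoeff g φ) φ.target := by
  refine contDiffOn_clm_apply.2 fun a ↦ contDiffOn_clm_apply.2 fun b ↦ ?_
  exact ((contMDiffOn_metric g (hφ.smoothFieldOn_coordField a) (hφ.smoothFieldOn_coordField b)).comp
    hφ.smooth_symm fun z hz ↦ φ.map_target hz).contDiffOn

theorem IsSmoothChart.mvfderiv_metric_coordField (hφ : IsSmoothChart (n := n) φ)
    (g : PseudoRiemannianMetric n M) {x : M} (hx : x ∈ φ.source) (a b c : E) :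
    mvfderiv (𝓡 n) (fun y ↦ g.form y (coordField φ a y) (coordField φ b y)) x (coordField φ c x) =
      fderiv ℝ (metricCoeff g φ) (φ x) c a b := by
  rw [(hφ.mvfderiv_apply_coordField hx (mdifferentiableAt_metric g
    (hφ.mdifferentiableAt_coordField hx a) (hφ.mdifferentiableAt_coordField hx b)) c).2]
  have hd : DifferentiableAt ℝ (metricCoeff g φ) (φ x) :=
    ((hφ.contDiffOn_metricCoeff g).contDiffAt
      (φ.open_target.mem_nhds (φ.map_source hx))).differentiableAt (by simp)
  have h1 := ((hd.hasFDerivAt.clm_apply (hasFDerivAt_const a (φ x))).clm_apply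
    (hasFDerivAt_const b (φ x))).fderiv
  have h2 := DFunLike.congr_fun h1 c
  refine h2.trans ?_
  simp

end MetricCoefficients

/-! ### Projectability in flat charts -/

section Projections

variable {n q : ℕ} {M : Type u} [TopologicalSpace M] [ChartedSpace (Eucl n) M]
  [IsManifold (𝓡 n) ∞ M] {V : ∀ x : M, Submodule ℝ (TangentSpace (𝓡 n) x)}
  {G : Type*} [NormedAddCommGroup G] [NormedSpace ℝ G] [FiniteDimensional ℝ G]
  {φ : OpenPartialHomeomorph M (Eucl q × G)}

omit [FiniteDimensional ℝ G] in
/-- Covariant derivatives of fields with constant transversal components in a flat chart have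
transversal components which are functions of the leaf. -/
theorem IsProjectable.exists_projection (hφ : IsSmoothChart (n := n) φ)
    (hV : ∀ y ∈ φ.source, ∀ v, v ∈ V y ↔ (mvfderiv (𝓡 n) φ y v).1 = 0)
    (hleaf : IsLeafFibration (q := q) V φ.source (fun y ↦ (φ y).1)) {D : Connection n M}
    (hD : IsProjectable.{u, 0} q D V) {v w : ∀ x : M, TangentSpace (𝓡 n) x}
    (hv : SmoothFieldOn φ.source v) (hw : SmoothFieldOn φ.source w) {a b : Eucl q}
    (hva : ∀ y ∈ φ.source, (mvfderiv (𝓡 n) φ y (v y)).1 = a)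
    (hwb : ∀ y ∈ φ.source, (mvfderiv (𝓡 n) φ y (w y)).1 = b) :
    ∃ ζ : Eucl q → Eucl q, ContDiff ℝ ∞ ζ ∧
      ∀ y ∈ φ.source, (mvfderiv (𝓡 n) φ y (D w y (v y))).1 = ζ (φ y).1 := by
  have hproj : ∀ {v : ∀ x : M, TangentSpace (𝓡 n) x} {a : Eucl q},
      (∀ y ∈ φ.source, (mvfderiv (𝓡 n) φ y (v y)).1 = a) →
      IsProjectableField.{u, 0} q V φ.source v := by
    intro v a hva S _ _ _ _ _ _ U pr hU hpr
    refine hpr.exists_projectsTo (F := Eucl q) finrank_euclideanSpace_fin fun x hx ↦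
      ⟨U, univ, fun y ↦ (φ y).1, fun _ ↦ a, hpr.bundle.isOpen, hx, subset_rfl, isOpen_univ,
        fun _ _ ↦ mem_univ _, ?_, ?_, contMDiffOn_const, ?_⟩
    · exact (contDiff_fst.contMDiff.comp_contMDiffOn hφ.smooth).mono hU
    · intro y hy v
      rw [mvfderiv_chart_fst hφ (hU hy), hV y (hU hy)]
    · intro y hy
      rw [mvfderiv_chart_fst hφ (hU hy), hva y (hU hy)]
  obtain ⟨ζ, hζ, hDζ⟩ := hD φ.source v w φ.open_source hv hw (hproj hva) (hproj hwb)
    (Eucl q) φ.source _ subset_rfl hleaf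
  refine ⟨fun z ↦ ζ z, ?_, fun y hy ↦ ?_⟩
  · exact contDiff_iff_contDiffAt.2 fun z ↦
      contMDiffAt_vectorSpace_iff_contDiffAt.1 (hζ.contMDiffAt Filter.univ_mem)
  · rw [← mvfderiv_chart_fst hφ hy]
    exact hDζ y hy

/-- Covariant derivatives of fields with constant transversal components along the leaves are
tangent to the leaves: multiplying a tangent field by a function which vanishes at a point of a
given leaf shows that their transversal component, being constant on the leaf, is zero. -/
theorem IsProjectable.covDeriv_coordField_mem (hφ : IsSmoothChart (n := n) φ)
    (htarget : φ.target = univ)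
    (hV : ∀ y ∈ φ.source, ∀ v, v ∈ V y ↔ (mvfderiv (𝓡 n) φ y v).1 = 0)
    (hleaf : IsLeafFibration (q := q) V φ.source (fun y ↦ (φ y).1)) {D : Connection n M}
    (hD : IsProjectable.{u, 0} q D V) {y : M} (hy : y ∈ φ.source) (b : Eucl q) (ν : G) :
    D (coordField φ (b, 0)) y (coordField φ (0, ν) y) ∈ V y := by
  -- the tangent field with the coordinates `s - s(y) + ν`, which is zero at the point of the leaf of
  -- `y` with the coordinates `s(y) - ν`
  have hsmooth : ContMDiffOn (𝓡 n) 𝓘(ℝ, Eucl q × G) ∞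
      (fun x ↦ ((0, (φ x).2 - ((φ y).2 - ν)) : Eucl q × G)) φ.source := by
    have h : ContDiff ℝ ∞ (fun z : Eucl q × G ↦ ((0, z.2 - ((φ y).2 - ν)) : Eucl q × G)) :=
      contDiff_const.prodMk (contDiff_snd.sub contDiff_const)
    exact h.contMDiff.comp_contMDiffOn hφ.smooth
  obtain ⟨ζ, -, hζ⟩ := hD.exists_projection hφ hV hleaf (a := 0) (b := b)
    (hφ.smoothFieldOn_of_coord φ.open_source subset_rfl hsmooth)
    (hφ.smoothFieldOn_coordField (b, 0))
    (fun x hx ↦ by rw [hφ.mvfderiv_coordField hx]) (fun x hx ↦ by rw [hφ.mvfderiv_coordField hx])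
  have ht : ∀ z, z ∈ φ.target := fun z ↦ htarget ▸ mem_univ z
  have h0 := hζ (φ.symm ((φ y).1, (φ y).2 - ν)) (φ.map_target (ht _))
  rw [φ.right_inv (ht _)] at h0
  have h1 := hζ y hy
  simp only [sub_self, sub_sub_cancel] at h0 h1
  have h2 : ∀ x : M, coordField (n := n) φ ((0, 0) : Eucl q × G) x = 0 := fun x ↦ by
    have h := map_zero (mfderiv (𝓡 n) 𝓘(ℝ, Eucl q × G) φ x).inverse
    exact h
  rw [h2, map_zero, map_zero] at h0
  rw [hV y hy, h1, ← h0]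
  rfl

end Projections

/-! ### Standard coordinates for a projectable Levi-Civita connection -/

section ChangeOfChart

theorem IsSmoothChart.mvfderiv_trans {n : ℕ} {M : Type u} [TopologicalSpace M]
    [ChartedSpace (Eucl n) M] {E E' : Type*} [NormedAddCommGroup E] [NormedSpace ℝ E]
    [NormedAddCommGroup E'] [NormedSpace ℝ E'] {φ : OpenPartialHomeomorph M E}
    (hφ : IsSmoothChart (n := n) φ) {ψ : OpenPartialHomeomorph E E'}
    (hψ : ContDiffOn ℝ ∞ ψ ψ.source) {y : M} (hy : y ∈ (φ.trans ψ).source)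
    (v : TangentSpace (𝓡 n) y) :
    mvfderiv (𝓡 n) (φ.trans ψ) y v = fderiv ℝ ψ (φ y) (mvfderiv (𝓡 n) φ y v) :=
  mvfderiv_fderiv_comp (h := ψ) ((hψ.contDiffAt (ψ.open_source.mem_nhds hy.2)).differentiableAt
    (by simp)) (hφ.mdifferentiableAt hy.1) v

end ChangeOfChart

section StandardCharts

variable {n q : ℕ} {M : Type u} [TopologicalSpace M] [ChartedSpace (Eucl n) M]
  [IsManifold (𝓡 n) ∞ M] {V : ∀ x : M, Submodule ℝ (TangentSpace (𝓡 n) x)}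
  {G : Type} [NormedAddCommGroup G] [NormedSpace ℝ G] [FiniteDimensional ℝ G]
  {φ : OpenPartialHomeomorph M (Eucl q × G)} {g : PseudoRiemannianMetric n M}

/-- The coefficients `g(∂_s, ∂_q)` of a metric in a chart `(q, s)`. -/
def mixedCoeff (g : PseudoRiemannianMetric n M) (φ : OpenPartialHomeomorph M (Eucl q × G))
    (z : Eucl q × G) : G →L[ℝ] Eucl q →L[ℝ] ℝ :=
  (metricCoeff g φ z).bilinearComp (ContinuousLinearMap.inr ℝ (Eucl q) G)
    (ContinuousLinearMap.inl ℝ (Eucl q) G)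

theorem mixedCoeff_apply (z : Eucl q × G) (ν : G) (b : Eucl q) :
    mixedCoeff g φ z ν b = metricCoeff g φ z (0, ν) (b, 0) := rfl

theorem IsSmoothChart.contDiff_mixedCoeff (hφ : IsSmoothChart (n := n) φ)
    (htarget : φ.target = univ) : ContDiff ℝ ∞ (mixedCoeff g φ) := by
  rw [← contDiffOn_univ]
  refine contDiffOn_clm_apply.2 fun ν ↦ contDiffOn_clm_apply.2 fun b ↦ ?_
  have h := hφ.contDiffOn_metricCoeff g
  rw [htarget] at h
  exact (h.clm_apply contDiffOn_const).clm_apply contDiffOn_const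

theorem IsSmoothChart.fderiv_mixedCoeff (hφ : IsSmoothChart (n := n) φ)
    (htarget : φ.target = univ) (z v : Eucl q × G) (ν : G) (b : Eucl q) :
    fderiv ℝ (mixedCoeff g φ) z v ν b = fderiv ℝ (metricCoeff g φ) z v (0, ν) (b, 0) := by
  have h1 : DifferentiableAt ℝ (mixedCoeff g φ) z :=
    (hφ.contDiff_mixedCoeff htarget).differentiable (by simp) z
  have h2 : DifferentiableAt ℝ (metricCoeff g φ) z :=
    ((hφ.contDiffOn_metricCoeff g).contDiffAt
      (φ.open_target.mem_nhds (htarget ▸ mem_univ z))).differentiableAt (by simp)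
  have h3 := ((h1.hasFDerivAt.clm_apply (hasFDerivAt_const ν z)).clm_apply (hasFDerivAt_const b z))
  have h4 := ((h2.hasFDerivAt.clm_apply (hasFDerivAt_const ((0, ν) : Eucl q × G) z)).clm_apply
    (hasFDerivAt_const ((b, 0) : Eucl q × G) z))
  have h5 := DFunLike.congr_fun (h3.unique h4) v
  simpa using h5

/-- The forms `g(∂_s, ∂_q) ds` on the leaves of a null distribution are closed if the Levi-Civita
connection is projectable: by the Koszul formula, their differential is given by
`g(D_{∂_s} ∂_q, ∂_s)`. -/
theorem IsLeviCivita.mixedCoeff_closed {D : Connection n M} (hLC : IsLeviCivita g D)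
    (hφ : IsSmoothChart (n := n) φ) (htarget : φ.target = univ)
    (hV : ∀ y ∈ φ.source, ∀ v, v ∈ V y ↔ (mvfderiv (𝓡 n) φ y v).1 = 0)
    (hleaf : IsLeafFibration (q := q) V φ.source (fun y ↦ (φ y).1)) (hnull : IsNull g V)
    (hD : IsProjectable.{u, 0} q D V) (z : Eucl q × G) (ν τ : G) :
    fderiv ℝ (mixedCoeff g φ) z (0, ν) τ = fderiv ℝ (mixedCoeff g φ) z (0, τ) ν := by
  ext b
  have hz : z ∈ φ.target := htarget ▸ mem_univ z
  have hy := φ.map_target hz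
  have hmem : ∀ y ∈ φ.source, ∀ ν : G, coordField (n := n) φ ((0, ν) : Eucl q × G) y ∈ V y :=
    fun y hy ν ↦ by rw [hV y hy, hφ.mvfderiv_coordField hy]
  have h := hLC.koszul hφ hy (0, ν) (b, 0) (0, τ)
  have h1 : (fun y ↦ g.form y (coordField φ ((0, ν) : Eucl q × G) y)
      (coordField φ ((0, τ) : Eucl q × G) y)) =ᶠ[𝓝 (φ.symm z)] fun _ ↦ 0 := by
    filter_upwards [φ.open_source.mem_nhds hy] with y hy
    exact hnull y _ (hmem y hy ν) _ (hmem y hy τ)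
  have h2 : (fun y ↦ g.form y (coordField φ ((b, 0) : Eucl q × G) y)
      (coordField φ ((0, τ) : Eucl q × G) y)) = fun y ↦ g.form y
        (coordField φ ((0, τ) : Eucl q × G) y) (coordField φ ((b, 0) : Eucl q × G) y) :=
    funext fun y ↦ g.symm y _ _
  rw [hnull _ _ (hD.covDeriv_coordField_mem hφ htarget hV hleaf hy b ν) _ (hmem _ hy τ),
    mvfderiv_congr_of_eventuallyEq h1, mvfderiv_const, h2, hφ.mvfderiv_metric_coordField g hy,
    hφ.mvfderiv_metric_coordField g hy, φ.right_inv hz] at h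
  rw [hφ.fderiv_mixedCoeff htarget, hφ.fderiv_mixedCoeff htarget]
  simp only [zero_apply] at h
  linarith

/-- The map `g(∂_s, ∂_q)` is injective: a vector tangent to the leaves is orthogonal to all of them,
and `g` is nondegenerate. -/
theorem IsNull.mixedCoeff_injective (hnull : IsNull g V) (hφ : IsSmoothChart (n := n) φ)
    (hV : ∀ y ∈ φ.source, ∀ v, v ∈ V y ↔ (mvfderiv (𝓡 n) φ y v).1 = 0) {z : Eucl q × G}
    (hz : z ∈ φ.target) : Function.Injective (mixedCoeff g φ z) := by
  have hy := φ.map_target hz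
  rw [injective_iff_map_eq_zero]
  intro ν hν
  have hmem : ∀ ν : G, coordField (n := n) φ ((0, ν) : Eucl q × G) (φ.symm z) ∈ V (φ.symm z) :=
    fun ν ↦ by rw [hV _ hy, hφ.mvfderiv_coordField hy]
  have h : coordField (n := n) φ ((0, ν) : Eucl q × G) (φ.symm z) = 0 := by
    refine g.nondegenerate _ _ fun w ↦ ?_
    obtain ⟨b, τ, hw⟩ : ∃ (b : Eucl q) (τ : G), w = coordField φ ((b, 0) : Eucl q × G) (φ.symm z)
        + coordField φ ((0, τ) : Eucl q × G) (φ.symm z) := by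
      refine ⟨(mvfderiv (𝓡 n) φ (φ.symm z) w).1, (mvfderiv (𝓡 n) φ (φ.symm z) w).2, ?_⟩
      rw [← Pi.add_apply, ← coordField_add, Prod.mk_add_mk, add_zero, zero_add, Prod.mk.eta,
        hφ.coordField_mvfderiv hy]
    rw [hw, map_add, hnull _ _ (hmem ν) _ (hmem τ), add_zero]
    exact DFunLike.congr_fun hν b
  have h1 := hφ.mvfderiv_coordField hy ((0, ν) : Eucl q × G)
  rw [h, map_zero] at h1
  exact (congrArg Prod.snd h1).symm

end StandardCharts

section StandardChart

variable {r n : ℕ} {M : Type u} [TopologicalSpace M] [ChartedSpace (Eucl n) M]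
  [IsManifold (𝓡 n) ∞ M] {V : ∀ x : M, Submodule ℝ (TangentSpace (𝓡 n) x)}
  {g : PseudoRiemannianMetric n M}

/-- Near every point there are coordinates `(q, p)` with `g(∂_p, ·) = dq`, the leaves of `V` being
the sets `q = const`: the differential of `p` along the leaves has to be the closed form
`g(∂_s, ∂_q) ds`. The domain of these coordinates may be chosen so that the leaves in it are
parametrized, by means of another chart `β`, by a whole vector space. -/
theorem IsLeviCivita.exists_standard_chart (hn : n = r + r) {D : Connection n M}
    (hLC : IsLeviCivita g D) (hV : IsDistribution r V) (hnull : IsNull g V) (hpar : IsParallel D V)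
    (hD : IsProjectable.{u, 0} r D V) (x₀ : M) :
    ∃ (β : OpenPartialHomeomorph M (Eucl r × Eucl r))
      (φ : OpenPartialHomeomorph M (Eucl r × (Eucl r →L[ℝ] ℝ))),
      IsSmoothChart (n := n) β ∧ β.target = univ ∧ IsSmoothChart (n := n) φ ∧
      φ.source = β.source ∧ x₀ ∈ φ.source ∧ (∀ y, (φ y).1 = (β y).1) ∧
      (∀ y ∈ φ.source, ∀ v, v ∈ V y ↔ (mvfderiv (𝓡 n) φ y v).1 = 0) ∧
      ∀ y ∈ φ.source, ∀ (η : Eucl r →L[ℝ] ℝ) (w : TangentSpace (𝓡 n) y),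
        g.form y (coordField φ (0, η) y) w = η (mvfderiv (𝓡 n) φ y w).1 := by
  obtain ⟨φ₁, hφ₁, hx₁, hV₁⟩ := hV.exists_flat_chart hn hLC.torsion_free hpar x₀
  obtain ⟨δ, hδ, hball⟩ := Metric.isOpen_iff.1 φ₁.open_target (φ₁ x₀) (φ₁.map_source hx₁)
  rw [← Prod.mk.eta (p := φ₁ x₀), ← ball_prod_same] at hball
  -- flat coordinates `(q, s)` onto the whole space, in which the form is defined everywhere
  obtain ⟨hφ₂, ht₂, hs₂, hV₂⟩ := hφ₁.trans_box hV₁ hδ hball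
  set φ₂ := φ₁.trans (box (φ₁ x₀).1 (φ₁ x₀).2 δ) with hφ₂def
  have hx₂ : x₀ ∈ φ₂.source := (hs₂ x₀).2
    ⟨hx₁, Metric.mem_ball_self hδ, Metric.mem_ball_self hδ⟩
  have h0₂ : φ₂ x₀ = 0 := Prod.ext (OpenPartialHomeomorph.univBall_symm_apply_center _ _)
    (OpenPartialHomeomorph.univBall_symm_apply_center _ _)
  have hleaf₂ := hφ₂.isLeafFibration ht₂ hV₂
  have hd : Module.finrank ℝ (Eucl r) = Module.finrank ℝ (Eucl r →L[ℝ] ℝ) := by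
    rw [← (LinearMap.toContinuousLinearMap (𝕜 := ℝ) (E := Eucl r) (F' := ℝ)).finrank_eq]
    exact Subspace.dual_finrank_eq.symm
  obtain ⟨ψ, h0ψ, hψ, hψ', hψ1, hψd⟩ := exists_potential_chart
    (hφ₂.contDiff_mixedCoeff (g := g) ht₂)
    (hLC.mixedCoeff_closed hφ₂ ht₂ hV₂ hleaf₂ hnull hD)
    (hnull.mixedCoeff_injective hφ₂ hV₂ (ht₂ ▸ mem_univ 0)) hd
  obtain ⟨ε, hε, hballψ⟩ := Metric.isOpen_iff.1 ψ.open_source 0 h0ψ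
  rw [← Prod.mk_zero_zero, ← ball_prod_same] at hballψ
  -- a box on which `(q, s) ↦ (q, p)` is a change of coordinates
  obtain ⟨hβ, htβ, hsβ, -⟩ := hφ₂.trans_box hV₂ hε (c := 0) (d := 0) (ht₂ ▸ subset_univ _)
  set β := φ₂.trans (box (0 : Eucl r) (0 : Eucl r) ε) with hβdef
  have hxβ : x₀ ∈ β.source := by
    rw [hsβ, h0₂]
    exact ⟨hx₂, Metric.mem_ball_self hε, Metric.mem_ball_self hε⟩
  -- the ball of the coordinates `q` is blown up to the whole space, which has to change `p` as well
  set f := (OpenPartialHomeomorph.univBall (0 : Eucl r) ε).symm with hfdef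
  have hfs : f.source = Metric.ball 0 ε := by
    simp [hfdef, OpenPartialHomeomorph.univBall_target _ hε]
  have hf : ContDiffOn ℝ ∞ f f.source := by
    rw [hfs]
    exact OpenPartialHomeomorph.contDiffOn_univBall_symm
  have hf' : ContDiffOn ℝ ∞ f.symm f.target := OpenPartialHomeomorph.contDiff_univBall.contDiffOn
  have hφ₃ := hφ₂.trans hψ hψ'
  set φ₃ := φ₂.trans ψ with hφ₃def
  have hφ₄ := (hφ₃.restrOpen β.open_source).trans (contDiffOn_cotangentLift (hf := hf) (hf' := hf'))
    contDiffOn_cotangentLift_symm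
  set φ := (φ₃.restrOpen β.source β.open_source).trans (cotangentLift f hf hf') with hφdef
  have hβ₃ : ∀ y ∈ β.source, y ∈ φ₂.source ∧ y ∈ φ₃.source ∧ (φ₃ y).1 ∈ f.source := by
    intro y hy
    obtain ⟨h1, h2⟩ := (hsβ y).1 hy
    refine ⟨h1, ⟨h1, hballψ h2⟩, ?_⟩
    rw [hfs]
    show (ψ (φ₂ y)).1 ∈ _
    rw [hψ1]
    exact h2.1
  have hsource : φ.source = β.source := by
    ext y
    constructor
    · rintro ⟨⟨-, hy⟩, -⟩
      exact hy
    · intro hy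
      exact ⟨⟨(hβ₃ y hy).2.1, hy⟩, (hβ₃ y hy).2.2, mem_univ _⟩
  have hd₃ : ∀ y ∈ φ₃.source, ∀ v, mvfderiv (𝓡 n) φ₃ y v =
      fderiv ℝ ψ (φ₂ y) (mvfderiv (𝓡 n) φ₂ y v) := fun y hy v ↦ hφ₂.mvfderiv_trans hψ hy v
  have hd₄ : ∀ y ∈ φ.source, ∀ v, mvfderiv (𝓡 n) φ y v =
      fderiv ℝ (cotangentLift f hf hf') (φ₃ y) (mvfderiv (𝓡 n) φ₃ y v) := fun y hy v ↦
    (hφ₃.restrOpen β.open_source).mvfderiv_trans contDiffOn_cotangentLift hy v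
  have h41 : ∀ y ∈ φ.source, ∀ v, (mvfderiv (𝓡 n) φ y v).1 =
      fderiv ℝ f (φ₃ y).1 (mvfderiv (𝓡 n) φ₂ y v).1 := by
    intro y hy v
    obtain ⟨-, hy₃, hyf⟩ := hβ₃ y (hsource ▸ hy)
    rw [hd₄ y hy, fderiv_cotangentLift_fst hyf, hd₃ y hy₃, (hψd (φ₂ y) hy₃.2).1]
  have hVφ : ∀ y ∈ φ.source, ∀ v, v ∈ V y ↔ (mvfderiv (𝓡 n) φ y v).1 = 0 := by
    intro y hy v
    obtain ⟨hy₂, hy₃, hyf⟩ := hβ₃ y (hsource ▸ hy)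
    rw [hV₂ y hy₂, h41 y hy]
    constructor
    · intro h
      rw [h, map_zero]
    · intro h
      have := fderiv_symm_fderiv hf hf' hyf (mvfderiv (𝓡 n) φ₂ y v).1
      rwa [h, map_zero, eq_comm] at this
  refine ⟨β, φ, hβ, htβ, hφ₄, hsource, hsource ▸ hxβ, ?_, hVφ, ?_⟩
  · intro y
    show f (ψ (φ₂ y)).1 = f (φ₂ y).1
    rw [hψ1]
  · intro y hy η w
    obtain ⟨hy₂, hy₃, hyf⟩ := hβ₃ y (hsource ▸ hy)
    set v := coordField (n := n) φ ((0, η) : Eucl r × (Eucl r →L[ℝ] ℝ)) y with hv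
    have hdv : mvfderiv (𝓡 n) φ y v = (0, η) := hφ₄.mvfderiv_coordField hy _
    have hvV : v ∈ V y := by rw [hVφ y hy, hdv]
    obtain ⟨ν, hν⟩ : ∃ ν, mvfderiv (𝓡 n) φ₂ y v = (0, ν) :=
      ⟨_, Prod.ext ((hV₂ y hy₂ v).1 hvV) rfl⟩
    have hη : η = (mixedCoeff g φ₂ (φ₂ y) ν).comp (fderiv ℝ f.symm (f (φ₃ y).1)) := by
      rw [hd₄ y hy, hd₃ y hy₃, hν, (hψd (φ₂ y) hy₃.2).2, fderiv_cotangentLift_vertical hyf] at hdv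
      exact (congrArg Prod.snd hdv).symm
    obtain ⟨b, τ, hw⟩ : ∃ (b : Eucl r) (τ : Eucl r), mvfderiv (𝓡 n) φ₂ y w = (b, τ) :=
      ⟨_, _, rfl⟩
    have hwb : w = coordField φ₂ ((b, 0) : Eucl r × Eucl r) y
        + coordField φ₂ ((0, τ) : Eucl r × Eucl r) y := by
      rw [← Pi.add_apply, ← coordField_add, Prod.mk_add_mk, add_zero, zero_add, ← hw,
        hφ₂.coordField_mvfderiv hy₂]
    have hτ : coordField (n := n) φ₂ ((0, τ) : Eucl r × Eucl r) y ∈ V y := by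
      rw [hV₂ y hy₂, hφ₂.mvfderiv_coordField hy₂]
    have hgv : g.form y v w = mixedCoeff g φ₂ (φ₂ y) ν b := by
      rw [hwb, map_add, hnull y v hvV _ hτ, add_zero, mixedCoeff_apply, metricCoeff_apply,
        φ₂.left_inv hy₂, ← hν, hφ₂.coordField_mvfderiv hy₂]
    rw [hgv, h41 y hy, hw, hη, ContinuousLinearMap.comp_apply, fderiv_symm_fderiv hf hf' hyf]

end StandardChart

/-! ### The metric in standard coordinates -/

section LeafSymbols

variable {r n : ℕ} {M : Type u} [TopologicalSpace M] [ChartedSpace (Eucl n) M]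
  [IsManifold (𝓡 n) ∞ M] {V : ∀ x : M, Submodule ℝ (TangentSpace (𝓡 n) x)}
  {g : PseudoRiemannianMetric n M} {φ : OpenPartialHomeomorph M (Eucl r × (Eucl r →L[ℝ] ℝ))}

/-- In standard coordinates `(q, p)`, the metric is determined by its coefficients
`g(∂_q, ∂_q)`. -/
theorem IsSmoothChart.metric_eq_of_standard (hφ : IsSmoothChart (n := n) φ)
    (hstd : ∀ y ∈ φ.source, ∀ (η : Eucl r →L[ℝ] ℝ) (w : TangentSpace (𝓡 n) y),
      g.form y (coordField φ (0, η) y) w = η (mvfderiv (𝓡 n) φ y w).1) {y : M}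
    (hy : y ∈ φ.source) (a b : Eucl r × (Eucl r →L[ℝ] ℝ)) :
    g.form y (coordField φ a y) (coordField φ b y) =
      g.form y (coordField φ ((a.1, 0) : Eucl r × (Eucl r →L[ℝ] ℝ)) y)
        (coordField φ ((b.1, 0) : Eucl r × (Eucl r →L[ℝ] ℝ)) y) + (a.2 b.1 + b.2 a.1) := by
  have h : ∀ a : Eucl r × (Eucl r →L[ℝ] ℝ), coordField (n := n) φ a y =
      coordField φ ((a.1, 0) : Eucl r × (Eucl r →L[ℝ] ℝ)) y
        + coordField φ ((0, a.2) : Eucl r × (Eucl r →L[ℝ] ℝ)) y := fun a ↦ by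
    rw [← Pi.add_apply, ← coordField_add, Prod.mk_add_mk, add_zero, zero_add]
  have e : ∀ c c' d d' : TangentSpace (𝓡 n) y, g.form y (c + c') (d + d') =
      g.form y c d + g.form y d' c + (g.form y c' d + g.form y c' d') := fun c c' d d' ↦ by
    rw [map_add (g.form y) c c', add_apply, map_add, map_add, g.symm y d' c]
  rw [h a, h b, e, hstd y hy, hstd y hy, hstd y hy,
    hφ.mvfderiv_coordField hy, hφ.mvfderiv_coordField hy, hφ.mvfderiv_coordField hy, map_zero]
  ring

/-- In standard coordinates `(q, p)`, projectability of the Levi-Civita connection provides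
Christoffel symbols `Γ(q)` on the leaf space. -/
theorem IsLeviCivita.exists_leaf_christoffel {D : Connection n M} (hLC : IsLeviCivita g D)
    (hφ : IsSmoothChart (n := n) φ)
    (hV : ∀ y ∈ φ.source, ∀ v, v ∈ V y ↔ (mvfderiv (𝓡 n) φ y v).1 = 0)
    (hstd : ∀ y ∈ φ.source, ∀ (η : Eucl r →L[ℝ] ℝ) (w : TangentSpace (𝓡 n) y),
      g.form y (coordField φ (0, η) y) w = η (mvfderiv (𝓡 n) φ y w).1)
    (hleaf : IsLeafFibration (q := r) V φ.source (fun y ↦ (φ y).1))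
    (hD : IsProjectable.{u, 0} r D V) :
    ∃ Γ : Eucl r → Eucl r →L[ℝ] Eucl r →L[ℝ] Eucl r, IsAdaptedChart g V φ univ Γ ∧
      ∀ z a b, Γ z a b = Γ z b a := by
  have hsurj : ∀ z, ∃ y ∈ φ.source, (φ y).1 = z := fun z ↦ by
    have := hleaf.bundle.surj ▸ mem_univ z
    exact this
  -- `Γ(q)` is read off at an arbitrary point `s(q)` of the leaf, as it does not depend on this point
  choose s hs hsz using hsurj
  let G : Eucl r → Eucl r → Eucl r → Eucl r := fun z a b ↦ (mvfderiv (𝓡 n) φ (s z)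
    (D (coordField φ ((b, 0) : Eucl r × (Eucl r →L[ℝ] ℝ))) (s z)
      (coordField φ ((a, 0) : Eucl r × (Eucl r →L[ℝ] ℝ)) (s z)))).1
  have hG : ∀ a b, ContDiff ℝ ∞ (fun z ↦ G z a b) ∧ ∀ y ∈ φ.source, (mvfderiv (𝓡 n) φ y
      (D (coordField φ ((b, 0) : Eucl r × (Eucl r →L[ℝ] ℝ))) y
        (coordField φ ((a, 0) : Eucl r × (Eucl r →L[ℝ] ℝ)) y))).1 = G (φ y).1 a b := by
    intro a b
    obtain ⟨ζ, hζ, hDζ⟩ := hD.exists_projection hφ hV hleaf (a := a) (b := b)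
      (hφ.smoothFieldOn_coordField (a, 0)) (hφ.smoothFieldOn_coordField (b, 0))
      (fun x hx ↦ by rw [hφ.mvfderiv_coordField hx]) (fun x hx ↦ by rw [hφ.mvfderiv_coordField hx])
    have h : ∀ z, G z a b = ζ z := fun z ↦ by
      simp only [G]
      rw [hDζ _ (hs z), hsz z]
    refine ⟨by rwa [funext h], fun y hy ↦ ?_⟩
    rw [h, hDζ y hy]
  have hbil : ∀ z, IsBilinearMap ℝ (G z) := fun z ↦ by
    have h := hφ.isBilinearMap D (hs z)
    have e1 : ∀ a a' : Eucl r, ((a + a', 0) : Eucl r × (Eucl r →L[ℝ] ℝ)) = (a, 0) + (a', 0) :=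
      fun a a' ↦ by simp
    have e2 : ∀ (t : ℝ) (a : Eucl r), ((t • a, 0) : Eucl r × (Eucl r →L[ℝ] ℝ)) = t • (a, 0) :=
      fun t a ↦ by simp
    constructor
    · intro a a' b
      simp only [G, e1]
      exact congrArg Prod.fst (h.add_left (a, 0) (a', 0) (b, 0))
    · intro t a b
      simp only [G, e2]
      exact congrArg Prod.fst (h.smul_left t (a, 0) (b, 0))
    · intro a b b'
      simp only [G, e1]
      exact congrArg Prod.fst (h.add_right (a, 0) (b, 0) (b', 0))
    · intro t a b
      simp only [G, e2]
      exact congrArg Prod.fst (h.smul_right t (a, 0) (b, 0))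
  refine ⟨fun z ↦ (hbil z).toContinuousBilinearMap, ⟨hφ, hV, hstd, isOpen_univ,
    fun _ _ ↦ mem_univ _, ?_, ?_⟩, ?_⟩
  · exact contDiffOn_clm_apply.2 fun a ↦ contDiffOn_clm_apply.2 fun b ↦ (hG a b).1.contDiffOn
  · intro y hy η a b
    have hconst : ∀ b : Eucl r × (Eucl r →L[ℝ] ℝ), mvfderiv (𝓡 n)
        (fun y ↦ g.form y (coordField φ b y) (coordField φ (0, η) y)) y = 0 := by
      intro b
      have h : (fun y ↦ g.form y (coordField φ b y) (coordField φ (0, η) y)) =ᶠ[𝓝 y]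
          fun _ ↦ η b.1 := by
        filter_upwards [φ.open_source.mem_nhds hy] with y hy
        rw [g.symm, hstd y hy, hφ.mvfderiv_coordField hy]
      rw [mvfderiv_congr_of_eventuallyEq h, mvfderiv_const]
    have h := hLC.koszul hφ hy (a.1, 0) (b.1, 0) (0, η)
    rw [hconst, hconst, g.symm, hstd y hy, (hG a.1 b.1).2 y hy] at h
    have h1 : (fun y ↦ g.form y (coordField φ a y) (coordField φ b y)) =ᶠ[𝓝 y]
        fun y ↦ g.form y (coordField φ ((a.1, 0) : Eucl r × (Eucl r →L[ℝ] ℝ)) y)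
          (coordField φ ((b.1, 0) : Eucl r × (Eucl r →L[ℝ] ℝ)) y) + (a.2 b.1 + b.2 a.1) := by
      filter_upwards [φ.open_source.mem_nhds hy] with y hy
      exact hφ.metric_eq_of_standard hstd hy a b
    rw [mvfderiv_congr_of_eventuallyEq h1, mvfderiv_fun_add (mdifferentiableAt_metric g
      (hφ.mdifferentiableAt_coordField hy _) (hφ.mdifferentiableAt_coordField hy _))
      mdifferentiableAt_const, mvfderiv_const, add_zero]
    simp only [zero_apply, add_zero, zero_sub] at h
    show _ = -2 * η (G (φ y).1 a.1 b.1)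
    linarith
  · intro z a b
    show G z a b = G z b a
    simp only [G]
    rw [Connection.coordField_symm hφ hLC.torsion_free (hs z)]

/-- The metric coefficients `g(∂_q, ∂_q)`, without the linear part in `p` which they have in an
adapted chart. -/
def constantCoeff (g : PseudoRiemannianMetric n M)
    (φ : OpenPartialHomeomorph M (Eucl r × (Eucl r →L[ℝ] ℝ)))
    (Γ : Eucl r → Eucl r →L[ℝ] Eucl r →L[ℝ] Eucl r) (z : Eucl r × (Eucl r →L[ℝ] ℝ)) :
    Eucl r →L[ℝ] Eucl r →L[ℝ] ℝ :=
  (metricCoeff g φ z).bilinearComp (ContinuousLinearMap.inl ℝ (Eucl r) (Eucl r →L[ℝ] ℝ))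
      (ContinuousLinearMap.inl ℝ (Eucl r) (Eucl r →L[ℝ] ℝ))
    + (2 : ℝ) • (ContinuousLinearMap.compL ℝ (Eucl r) (Eucl r) ℝ z.2).comp (Γ z.1)

theorem constantCoeff_apply (Γ : Eucl r → Eucl r →L[ℝ] Eucl r →L[ℝ] Eucl r)
    (z : Eucl r × (Eucl r →L[ℝ] ℝ)) (a b : Eucl r) :
    constantCoeff g φ Γ z a b = metricCoeff g φ z (a, 0) (b, 0) + 2 * z.2 (Γ z.1 a b) := rfl

variable {Γ : Eucl r → Eucl r →L[ℝ] Eucl r →L[ℝ] Eucl r}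

theorem IsAdaptedChart.contDiffOn_constantCoeff (hφ : IsAdaptedChart g V φ univ Γ) :
    ContDiffOn ℝ ∞ (constantCoeff g φ Γ) φ.target := by
  refine contDiffOn_clm_apply.2 fun a ↦ contDiffOn_clm_apply.2 fun b ↦ ?_
  refine (((hφ.chart.contDiffOn_metricCoeff g).clm_apply contDiffOn_const).clm_apply
    contDiffOn_const).add ?_
  have hΓd : ContDiff ℝ ∞ Γ := contDiffOn_univ.1 hφ.smooth
  exact (contDiff_const.mul (contDiff_snd.clm_apply (((hΓd.comp contDiff_fst).clm_apply
    contDiff_const).clm_apply contDiff_const))).contDiffOn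

theorem IsAdaptedChart.fderiv_constantCoeff (hφ : IsAdaptedChart g V φ univ Γ)
    {z : Eucl r × (Eucl r →L[ℝ] ℝ)} (hz : z ∈ φ.target) (a b : Eucl r) (η : Eucl r →L[ℝ] ℝ) :
    fderiv ℝ (fun z ↦ constantCoeff g φ Γ z a b) z (0, η) = 0 := by
  have hz' := φ.open_target.mem_nhds hz
  have hm := (((((hφ.chart.contDiffOn_metricCoeff g).clm_apply contDiffOn_const).clm_apply
    contDiffOn_const).contDiffAt hz').differentiableAt (show (∞ : ℕ∞ω) ≠ 0 by simp) :
    DifferentiableAt ℝ (fun z ↦ metricCoeff g φ z (a, 0) (b, 0)) z).hasFDerivAt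
  have hK := ((((hφ.contDiffOn_constantCoeff.clm_apply contDiffOn_const).clm_apply
    contDiffOn_const).contDiffAt hz').differentiableAt (show (∞ : ℕ∞ω) ≠ 0 by simp) :
    DifferentiableAt ℝ (fun z ↦ constantCoeff g φ Γ z a b) z).hasFDerivAt
  have hi := hasFDerivAt_prodMk_right (𝕜 := ℝ) z.1 z.2
  have h1 : HasFDerivAt (fun p ↦ constantCoeff g φ Γ (z.1, p) a b) _ z.2 :=
    HasFDerivAt.comp (g := fun z ↦ constantCoeff g φ Γ z a b) (f := fun p ↦ (z.1, p)) z.2 hK hi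
  have h2 : HasFDerivAt (fun p : Eucl r →L[ℝ] ℝ ↦ metricCoeff g φ (z.1, p) (a, 0) (b, 0)) _ z.2 :=
    HasFDerivAt.comp (g := fun z ↦ metricCoeff g φ z (a, 0) (b, 0)) (f := fun p ↦ (z.1, p)) z.2 hm hi
  have h3 : HasFDerivAt (fun p : Eucl r →L[ℝ] ℝ ↦ p (Γ z.1 a b)) _ z.2 :=
    (ContinuousLinearMap.apply ℝ ℝ (Γ z.1 a b)).hasFDerivAt
  have h4 := DFunLike.congr_fun (h1.unique (h2.add (h3.const_mul 2))) η
  have h5 := hφ.deriv (φ.symm z) (φ.map_target hz) η (a, 0) (b, 0)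
  rw [(hφ.chart.mvfderiv_apply_coordField (φ.map_target hz) (mdifferentiableAt_metric g
    (hφ.chart.mdifferentiableAt_coordField (φ.map_target hz) _)
    (hφ.chart.mdifferentiableAt_coordField (φ.map_target hz) _)) _).2, φ.right_inv hz] at h5
  have h6 : fderiv ℝ (fun z ↦ metricCoeff g φ z (a, 0) (b, 0)) z (0, η) =
    -2 * η (Γ z.1 a b) := h5
  refine h4.trans ?_
  have h7 : (fderiv ℝ (fun z ↦ metricCoeff g φ z (a, 0) (b, 0)) z (0, η)) + 2 * η (Γ z.1 a b) = 0 := by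
    rw [h6]; ring
  exact h7

/-- The metric coefficients `g(∂_q, ∂_q)` in an adapted chart are affine functions of `p`, with the
linear part `-2p(Γ(q))`. The chart `β` shows that the leaves in the domain are connected, and
provides a smooth section `s = 0` of the projection onto the leaf space, at which the constant part
can be evaluated. -/
theorem IsAdaptedChart.exists_metric_eq (hφ : IsAdaptedChart g V φ univ Γ)
    (hΓ : ∀ z a b, Γ z a b = Γ z b a)
    {β : OpenPartialHomeomorph M (Eucl r × Eucl r)} (hβ : IsSmoothChart (n := n) β)
    (htβ : β.target = univ) (hs : φ.source = β.source) (hβφ : ∀ y, (φ y).1 = (β y).1) :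
    ∃ h₀ : Eucl r → Eucl r →L[ℝ] Eucl r →L[ℝ] ℝ, ContDiff ℝ ∞ h₀ ∧ (∀ z a b, h₀ z a b = h₀ z b a) ∧
      ∀ y ∈ φ.source, ∀ a b : Eucl r × (Eucl r →L[ℝ] ℝ),
        g.form y (coordField φ a y) (coordField φ b y) =
          a.2 b.1 + b.2 a.1 + h₀ (φ y).1 a.1 b.1 - 2 * (φ y).2 (Γ (φ y).1 a.1 b.1) := by
  have ht : ∀ z, z ∈ β.target := fun z ↦ htβ ▸ mem_univ z
  have hφβ : ∀ z, β.symm z ∈ φ.source := fun z ↦ hs ▸ β.map_target (ht z)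
  have hφβ1 : ∀ z, (φ (β.symm z)).1 = z.1 := fun z ↦ by rw [hβφ, β.right_inv (ht z)]
  have hT : ContDiff ℝ ∞ (fun z ↦ φ (β.symm z)) := by
    rw [← contDiffOn_univ, ← htβ]
    exact (hφ.chart.smooth.comp hβ.smooth_symm fun z _ ↦ hφβ z).contDiffOn
  have hK : ContDiff ℝ ∞ (fun z ↦ constantCoeff g φ Γ (φ (β.symm z))) := by
    rw [← contDiffOn_univ]
    exact hφ.contDiffOn_constantCoeff.comp hT.contDiffOn fun z _ ↦ φ.map_source (hφβ z)
  have hconst : ∀ y ∈ φ.source, ∀ a b, constantCoeff g φ Γ (φ y) a b =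
      constantCoeff g φ Γ (φ (β.symm ((φ y).1, 0))) a b := by
    intro y hy a b
    have hyβ : y ∈ β.source := hs ▸ hy
    have hd : ∀ ν, HasFDerivAt (fun ν : Eucl r ↦ constantCoeff g φ Γ (φ (β.symm ((φ y).1, ν))) a b)
        (0 : Eucl r →L[ℝ] ℝ) ν := by
      intro ν
      set z := φ (β.symm ((φ y).1, ν))
      have hz : z ∈ φ.target := φ.map_source (hφβ ((φ y).1, ν))
      have hKz := ((((hφ.contDiffOn_constantCoeff.clm_apply contDiffOn_const).clm_apply
        contDiffOn_const).contDiffAt (φ.open_target.mem_nhds hz)).differentiableAt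
        (show (∞ : ℕ∞ω) ≠ 0 by simp) :
        DifferentiableAt ℝ (fun z ↦ constantCoeff g φ Γ z a b) z).hasFDerivAt
      set A : Eucl r →L[ℝ] Eucl r × (Eucl r →L[ℝ] ℝ) :=
        (fderiv ℝ (fun z ↦ φ (β.symm z)) ((φ y).1, ν)).comp
          (ContinuousLinearMap.inr ℝ (Eucl r) (Eucl r)) with hA
      have h1 : HasFDerivAt (fun ν : Eucl r ↦ φ (β.symm ((φ y).1, ν))) A ν :=
        HasFDerivAt.comp (g := fun z ↦ φ (β.symm z)) (f := fun ν : Eucl r ↦ ((φ y).1, ν)) ν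
          (hT.differentiable (by simp) _).hasFDerivAt (hasFDerivAt_prodMk_right _ ν)
      have h2 := HasFDerivAt.comp (g := fun z ↦ constantCoeff g φ Γ z a b) ν hKz h1
      refine h2.congr_fderiv ?_
      ext τ
      have h3 : HasFDerivAt (fun ν : Eucl r ↦ (φ (β.symm ((φ y).1, ν))).1) _ ν :=
        HasFDerivAt.comp (g := Prod.fst) ν hasFDerivAt_fst h1
      have h4 : HasFDerivAt (fun ν : Eucl r ↦ (φ (β.symm ((φ y).1, ν))).1)
          (0 : Eucl r →L[ℝ] Eucl r) ν := by
        simp only [hφβ1]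
        exact hasFDerivAt_const _ _
      have h5 : (A τ).1 = 0 := DFunLike.congr_fun (h3.unique h4) τ
      rw [ContinuousLinearMap.comp_apply, show A τ = (0, (A τ).2) from Prod.ext h5 rfl]
      exact hφ.fderiv_constantCoeff hz a b _
    have h := is_const_of_fderiv_eq_zero (𝕜 := ℝ) (fun ν ↦ (hd ν).differentiableAt)
      (fun ν ↦ (hd ν).fderiv) (β y).2 0
    rw [hβφ y, Prod.mk.eta, β.left_inv hyβ] at h
    rw [h, hβφ y]
  refine ⟨fun q ↦ constantCoeff g φ Γ (φ (β.symm (q, 0))), hK.comp (contDiff_prodMk_left 0),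
    fun z a b ↦ ?_, fun y hy a b ↦ ?_⟩
  · rw [constantCoeff_apply, constantCoeff_apply, metricCoeff_apply, metricCoeff_apply, hΓ, g.symm]
  · rw [hφ.chart.metric_eq_of_standard hφ.standard hy, ← hconst y hy, constantCoeff_apply,
      metricCoeff_apply, φ.left_inv hy]
    ring

end LeafSymbols

/-! ### Connections on a vector space -/

section VectorSpace

variable {n : ℕ}

theorem mem_chartAt_source_self (x y : Eucl n) : y ∈ (chartAt (Eucl n) x).source := by
  rw [chartAt_self_eq]
  exact mem_univ y

/-- Smoothness of a field of bilinear forms on a vector space. -/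
theorem contMDiff_bilinearForm {A : Eucl n → Eucl n →L[ℝ] Eucl n →L[ℝ] ℝ} (hA : ContDiff ℝ ∞ A) :
    ContMDiff (𝓡 n) ((𝓡 n).prod 𝓘(ℝ, Eucl n →L[ℝ] Eucl n →L[ℝ] ℝ)) ∞
      (fun x ↦ TotalSpace.mk' (Eucl n →L[ℝ] Eucl n →L[ℝ] ℝ)
        (E := fun x : Eucl n ↦ TangentSpace (𝓡 n) x →L[ℝ] TangentSpace (𝓡 n) x →L[ℝ] ℝ)
        x (A x)) := by
  intro x
  rw [contMDiffAt_hom_bundle]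
  refine ⟨contMDiffAt_id, ?_⟩
  refine (hA.contMDiff x).congr_of_eventuallyEq (Filter.Eventually.of_forall fun y ↦ ?_)
  ext a b
  have h : ∀ ξ : TangentSpace (𝓡 n) y →L[ℝ] ℝ, Trivialization.linearMapAt ℝ (trivializationAt
      (Eucl n →L[ℝ] ℝ) (fun b : Eucl n ↦ TangentSpace (𝓡 n) b →L[ℝ] ℝ) x) y ξ b = ξ b := by
    intro ξ
    rw [Trivialization.coe_linearMapAt_of_mem _ (by simpa using mem_chartAt_source_self x y)]
    simp only [hom_trivializationAt_apply]
    simp [ContinuousLinearMap.inCoordinates]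
    rfl
  simp [ContinuousLinearMap.inCoordinates]
  refine (h _).trans ?_
  rfl

theorem contMDiffOn_endomorphism {A : Eucl n → Eucl n →L[ℝ] Eucl n} {s : Set (Eucl n)}
    (hA : ContDiffOn ℝ ∞ A s) : ContMDiffOn (𝓡 n) ((𝓡 n).prod 𝓘(ℝ, Eucl n →L[ℝ] Eucl n)) ∞
    (fun x ↦ TotalSpace.mk' (Eucl n →L[ℝ] Eucl n)
      (E := fun x : Eucl n ↦ TangentSpace (𝓡 n) x →L[ℝ] TangentSpace (𝓡 n) x) x (A x)) s := by
  intro x hx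
  rw [contMDiffWithinAt_hom_bundle]
  refine ⟨contMDiffWithinAt_id, ?_⟩
  have h : ∀ y, ContinuousLinearMap.inCoordinates (Eucl n) (TangentSpace (𝓡 n)) (Eucl n)
      (TangentSpace (𝓡 n)) x y x y (A y) = A y := fun y ↦ by
    ext a b
    simp [ContinuousLinearMap.inCoordinates]
    rfl
  exact (hA.contMDiffOn x hx).congr (fun y _ ↦ h y) (h x)

theorem mdifferentiableAt_vectorField_iff {w : ∀ x : Eucl n, TangentSpace (𝓡 n) x} {x : Eucl n} :
    MDifferentiableAt (𝓡 n) (𝓡 n).tangent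
      (fun y ↦ (⟨y, w y⟩ : TangentBundle (𝓡 n) (Eucl n))) x ↔
      DifferentiableAt ℝ (fun y ↦ (w y : Eucl n)) x := by
  rw [mdifferentiableAt_totalSpace]
  simp
  exact (and_iff_right mdifferentiableAt_id).trans
    (mdifferentiableAt_iff_differentiableAt (𝕜 := ℝ) (E := Eucl n) (E' := Eucl n) (f := w))

theorem mvfderiv_vectorSpace {E : Type*} [NormedAddCommGroup E] [NormedSpace ℝ E] {f : Eucl n → E}
    {x : Eucl n} (v : Eucl n) : mvfderiv (𝓡 n) f x v = fderiv ℝ f x v := by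
  simp only [mvfderiv, mfderiv_eq_fderiv]
  rfl

theorem isSmoothChart_refl : IsSmoothChart (n := n) (OpenPartialHomeomorph.refl (Eucl n)) :=
  ⟨contMDiffOn_id, contMDiffOn_id⟩

theorem coordField_refl (a : Eucl n) :
    coordField (n := n) (OpenPartialHomeomorph.refl (Eucl n)) a = fun _ ↦ a := by
  funext x
  refine (isSmoothChart_refl.bijective (mem_univ x)).1 ?_
  rw [isSmoothChart_refl.mvfderiv_coordField (mem_univ x), mvfderiv_vectorSpace]
  exact (DFunLike.congr_fun (fderiv_id (𝕜 := ℝ) (x := x)) a).symm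

theorem cotangentTrivialization_vectorSpace (y₀ : Eucl n) (p : CotangentBundle n (Eucl n)) :
    cotangentTrivialization (r := n) y₀ p = (p.1, p.2) := by
  have hp : p.1 ∈ (chartAt (Eucl n) y₀).source := mem_chartAt_source_self _ _
  refine Prod.ext ((cotangentTrivialization (r := n) y₀).coe_fst ?_) ?_
  · rw [Trivialization.mem_source, cotangentTrivialization_baseSet]
    exact hp
  · ext1 a
    refine (cotangentTrivialization_apply hp p.2 a).trans ?_
    have h : coordField (n := n) (chartAt (Eucl n) y₀) a p.1 = a :=
      congrFun (coordField_refl a) p.1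
    rw [h]
    rfl

/-- The second component of a point of the cotangent bundle of a vector space, as a covector on the
vector space itself. -/
def cotangentSnd (p : CotangentBundle n (Eucl n)) : Eucl n →L[ℝ] ℝ := p.2

theorem contMDiff_cotangentSnd :
    ContMDiff ((𝓡 n).prod 𝓘(ℝ, Eucl n →L[ℝ] ℝ)) 𝓘(ℝ, Eucl n →L[ℝ] ℝ) ∞
      (cotangentSnd (n := n)) := by
  have h := contMDiffOn_cotangentTrivialization (r := n) (S := Eucl n) 0
  have h1 : (TotalSpace.proj ⁻¹' (chartAt (Eucl n) (0 : Eucl n)).source :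
      Set (CotangentBundle n (Eucl n))) = univ :=
    eq_univ_of_forall fun p ↦ mem_chartAt_source_self (n := n) 0 p.1
  rw [h1, contMDiffOn_univ] at h
  refine (contMDiff_snd.comp h).congr fun p ↦ ?_
  rw [Function.comp, cotangentTrivialization_vectorSpace]
  rfl

theorem contMDiffOn_cotangent_mk {n' : ℕ} {N : Type*} [TopologicalSpace N]
    [ChartedSpace (Eucl n') N]
    {f : N → Eucl n} {η : N → Eucl n →L[ℝ] ℝ} {s : Set N} (hf : ContMDiffOn (𝓡 n') (𝓡 n) ∞ f s)
    (hη : ContMDiffOn (𝓡 n') 𝓘(ℝ, Eucl n →L[ℝ] ℝ) ∞ η s) :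
    ContMDiffOn (𝓡 n') ((𝓡 n).prod 𝓘(ℝ, Eucl n →L[ℝ] ℝ)) ∞
      (fun x ↦ (⟨f x, η x⟩ : CotangentBundle n (Eucl n))) s := by
  have h := contMDiffOn_cotangentTrivialization_symm (r := n) (S := Eucl n) 0
  refine (h.comp (hf.prodMk hη) fun x _ ↦ ⟨mem_chartAt_source_self _ _, mem_univ _⟩).congr fun x hx ↦ ?_
  have hs : (⟨f x, η x⟩ : CotangentBundle n (Eucl n)) ∈
      (cotangentTrivialization (r := n) (S := Eucl n) 0).source := by
    rw [Trivialization.mem_source, cotangentTrivialization_baseSet]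
    exact mem_chartAt_source_self _ _
  refine ((cotangentTrivialization (r := n) (S := Eucl n) 0).symm_apply_apply hs).symm.trans ?_
  rw [cotangentTrivialization_vectorSpace]
  rfl

theorem SmoothForm.contDiff {θ : ∀ y : Eucl n, Cotangent n y} (hθ : SmoothForm θ) :
    ContDiff (E := Eucl n) (F := Eucl n →L[ℝ] ℝ) ℝ ∞ θ :=
  (contMDiff_cotangentSnd.comp hθ).contDiff

end VectorSpace

section ModelConnection

variable {n : ℕ}

/-- The covariant derivative with given Christoffel symbols in a vector space. -/
def modelDeriv (Γ : Eucl n → Eucl n →L[ℝ] Eucl n →L[ℝ] Eucl n) (w : Eucl n → Eucl n) (x : Eucl n) :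
    Eucl n →L[ℝ] Eucl n :=
  fderiv ℝ w x + (Γ x).flip (w x)

variable {Γ : Eucl n → Eucl n →L[ℝ] Eucl n →L[ℝ] Eucl n}

theorem modelDeriv_add {w w' : Eucl n → Eucl n} {x : Eucl n} (hw : DifferentiableAt ℝ w x)
    (hw' : DifferentiableAt ℝ w' x) :
    modelDeriv Γ (w + w') x = modelDeriv Γ w x + modelDeriv Γ w' x := by
  rw [modelDeriv, fderiv_add hw hw', Pi.add_apply, map_add, modelDeriv, modelDeriv]
  abel

theorem modelDeriv_smul {w : Eucl n → Eucl n} {f : Eucl n → ℝ} {x : Eucl n}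
    (hw : DifferentiableAt ℝ w x) (hf : DifferentiableAt ℝ f x) :
    modelDeriv Γ (f • w) x = f x • modelDeriv Γ w x + (fderiv ℝ f x).smulRight (w x) := by
  rw [modelDeriv, fderiv_smul hf hw, Pi.smul_apply', map_smul, modelDeriv, smul_add]
  abel

theorem modelDeriv_const (b x u : Eucl n) : modelDeriv Γ (fun _ ↦ b) x u = Γ x u b := by
  simp [modelDeriv]

theorem contDiff_modelDeriv (hΓ : ContDiff ℝ ∞ Γ) {w : Eucl n → Eucl n} (hw : ContDiff ℝ ∞ w) :
    ContDiff ℝ ∞ (modelDeriv Γ w) := by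
  refine (hw.fderiv_right (m := ∞) (by simp)).add ?_
  refine contDiff_clm_apply_iff.2 fun u ↦ ?_
  exact (hΓ.clm_apply contDiff_const).clm_apply hw

/-- The connection in a vector space with given Christoffel symbols. -/
def modelConnection (Γ : Eucl n → Eucl n →L[ℝ] Eucl n →L[ℝ] Eucl n) : Connection n (Eucl n) where
  toFun w x := modelDeriv Γ w x
  isCovariantDerivativeOnUniv :=
    { add := fun hw hw' _ ↦ modelDeriv_add (mdifferentiableAt_vectorField_iff.1 hw)
        (mdifferentiableAt_vectorField_iff.1 hw')
      leibniz := fun {w f x} hw hf _ ↦ by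
        refine (modelDeriv_smul (mdifferentiableAt_vectorField_iff.1 hw) hf.differentiableAt).trans ?_
        have h : fderiv ℝ f x = mvfderiv (𝓡 n) f x := by
          ext v
          exact (mvfderiv_vectorSpace v).symm
        rw [h]
        rfl }

theorem modelConnection_const (b x u : Eucl n) :
    modelConnection Γ (fun _ : Eucl n ↦ b) x u = Γ x u b :=
  modelDeriv_const b x u

theorem isTorsionFreeConnection_modelConnection (hΓ : ContDiff ℝ ∞ Γ)
    (hsymm : ∀ z a b, Γ z a b = Γ z b a) : IsTorsionFreeConnection (modelConnection Γ) where
  smooth := ⟨⟨fun {w} hw ↦ by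
    have hw' : ContDiff (E := Eucl n) (F := Eucl n) ℝ ∞ w :=
      (contDiffOn_univ.1 (contMDiffOn_vectorSpace_iff_contDiffOn.1 hw)).of_le (by simp)
    exact contMDiffOn_endomorphism (contDiff_modelDeriv hΓ hw').contDiffOn⟩⟩
  torsion_free := by
    refine (modelConnection Γ).torsion_eq_zero_iff.2 fun {X Y x} hX hY ↦ ?_
    have h : VectorField.mlieBracket (𝓡 n) X Y x =
        fderiv (E := Eucl n) (F := Eucl n) ℝ Y x (X x)
          - fderiv (E := Eucl n) (F := Eucl n) ℝ X x (Y x) := by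
      rw [← VectorField.mlieBracketWithin_univ, VectorField.mlieBracketWithin_eq_lieBracketWithin]
      exact congrFun (VectorField.lieBracketWithin_univ (𝕜 := ℝ) (E := Eucl n) (V := X) (W := Y)) x
    rw [h]
    have e : ∀ A B C D : Eucl n, C = D → A + C - (B + D) = A - B := fun A B C D h ↦ by
      rw [h, add_sub_add_right_eq_sub]
    exact e _ _ _ _ (hsymm x (X x) (Y x))

end ModelConnection

/-! ### The model Riemann extension metric -/

section ModelSpace

variable {r : ℕ}

/-- An identification of `ℝ^{2r}` with the cotangent bundle of `ℝ^r`: any linear isomorphism does. -/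
def modelEquiv (r : ℕ) : Eucl (2 * r) ≃L[ℝ] Eucl r × (Eucl r →L[ℝ] ℝ) :=
  ContinuousLinearEquiv.ofFinrankEq (by
    rw [finrank_prod_dual, finrank_euclideanSpace_fin, finrank_euclideanSpace_fin])

/-- The base point of a covector on `ℝ^r`. -/
def base (r : ℕ) : Eucl (2 * r) →L[ℝ] Eucl r :=
  (ContinuousLinearMap.fst ℝ _ _).comp (modelEquiv r).toContinuousLinearMap

/-- The fibre component of a covector on `ℝ^r`. -/
def momentum (r : ℕ) : Eucl (2 * r) →L[ℝ] Eucl r →L[ℝ] ℝ :=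
  (ContinuousLinearMap.snd ℝ _ _).comp (modelEquiv r).toContinuousLinearMap

/-- The covector at the origin with a given fibre component. -/
def ofMomentum (r : ℕ) : (Eucl r →L[ℝ] ℝ) →L[ℝ] Eucl (2 * r) :=
  (modelEquiv r).symm.toContinuousLinearMap.comp (ContinuousLinearMap.inr ℝ _ _)

/-- The zero covector at a given point. -/
def ofBase (r : ℕ) : Eucl r →L[ℝ] Eucl (2 * r) :=
  (modelEquiv r).symm.toContinuousLinearMap.comp (ContinuousLinearMap.inl ℝ _ _)

@[simp]
theorem base_ofMomentum (η : Eucl r →L[ℝ] ℝ) : base r (ofMomentum r η) = 0 := by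
  simp [base, ofMomentum]

@[simp]
theorem base_ofBase (y : Eucl r) : base r (ofBase r y) = y := by
  simp [base, ofBase]

@[simp]
theorem momentum_ofMomentum (η : Eucl r →L[ℝ] ℝ) : momentum r (ofMomentum r η) = η := by
  simp [momentum, ofMomentum]

@[simp]
theorem momentum_ofBase (y : Eucl r) : momentum r (ofBase r y) = 0 := by
  simp [momentum, ofBase]

theorem model_ext {x x' : Eucl (2 * r)} (h : base r x = base r x')
    (h' : momentum r x = momentum r x') : x = x' :=
  (modelEquiv r).injective (Prod.ext h h')

/-- The bilinear form `2 dp dq + (h₀(q) - 2p(Γ(q))) dq dq` on the cotangent bundle of `ℝ^r`. -/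
def modelForm (h₀ : Eucl r → Eucl r →L[ℝ] Eucl r →L[ℝ] ℝ)
    (Γ : Eucl r → Eucl r →L[ℝ] Eucl r →L[ℝ] Eucl r) (x : Eucl (2 * r)) :
    Eucl (2 * r) →L[ℝ] Eucl (2 * r) →L[ℝ] ℝ :=
  (ContinuousLinearMap.id ℝ (Eucl r →L[ℝ] ℝ)).bilinearComp (momentum r) (base r)
    + ((ContinuousLinearMap.id ℝ (Eucl r →L[ℝ] ℝ)).bilinearComp (momentum r) (base r)).flip
    + (h₀ (base r x) - (2 : ℝ) • (ContinuousLinearMap.compL ℝ (Eucl r) (Eucl r) ℝ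
        (momentum r x)).comp (Γ (base r x))).bilinearComp (base r) (base r)

variable {h₀ : Eucl r → Eucl r →L[ℝ] Eucl r →L[ℝ] ℝ}
  {Γ : Eucl r → Eucl r →L[ℝ] Eucl r →L[ℝ] Eucl r}

theorem modelForm_apply (x a b : Eucl (2 * r)) : modelForm h₀ Γ x a b =
    momentum r a (base r b) + momentum r b (base r a)
      + (h₀ (base r x) (base r a) (base r b)
        - 2 * momentum r x (Γ (base r x) (base r a) (base r b))) := rfl

theorem contDiff_modelForm (hh : ContDiff ℝ ∞ h₀) (hΓ : ContDiff ℝ ∞ Γ) :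
    ContDiff ℝ ∞ (modelForm h₀ Γ) := by
  refine contDiff_clm_apply_iff.2 fun a ↦ contDiff_clm_apply_iff.2 fun b ↦ ?_
  refine contDiff_const.add (ContDiff.sub ?_ ?_)
  · exact ((hh.comp (base r).contDiff).clm_apply contDiff_const).clm_apply contDiff_const
  · exact contDiff_const.mul ((momentum r).contDiff.clm_apply
      (((hΓ.comp (base r).contDiff).clm_apply contDiff_const).clm_apply contDiff_const))

theorem modelForm_symm (hh : ∀ z a b, h₀ z a b = h₀ z b a) (hΓ : ∀ z a b, Γ z a b = Γ z b a)
    (x a b : Eucl (2 * r)) : modelForm h₀ Γ x a b = modelForm h₀ Γ x b a := by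
  rw [modelForm_apply, modelForm_apply, hh, hΓ]
  ring

theorem modelForm_nondegenerate (x a : Eucl (2 * r)) (h : ∀ b, modelForm h₀ Γ x a b = 0) :
    a = 0 := by
  have h1 : base r a = 0 := (SeparatingDual.eq_zero_iff_forall_dual_eq_zero (R := ℝ) _).2 fun η ↦ by
    have := h (ofMomentum r η)
    simpa [modelForm_apply] using this
  refine model_ext (h1.trans (map_zero _).symm) ?_
  ext1 b
  have := h (ofBase r b)
  rw [modelForm_apply, h1] at this
  simpa using this

/-- The metric `2 dp dq + (h₀(q) - 2p(Γ(q))) dq dq` on the cotangent bundle of `ℝ^r`. -/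
def modelMetric (hh : ContDiff ℝ ∞ h₀) (hΓ : ContDiff ℝ ∞ Γ)
    (hh' : ∀ z a b, h₀ z a b = h₀ z b a) (hΓ' : ∀ z a b, Γ z a b = Γ z b a) :
    PseudoRiemannianMetric (2 * r) (Eucl (2 * r)) where
  form x := modelForm h₀ Γ x
  symm := modelForm_symm hh' hΓ'
  nondegenerate := modelForm_nondegenerate
  smooth := contMDiff_bilinearForm (contDiff_modelForm hh hΓ)

end ModelSpace

section ModelBundle

variable {r : ℕ}

/-- The action of the covectors by translations in a fibre of the cotangent bundle of `ℝ^r`. -/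
instance modelTorsor (y : Eucl r) : AddTorsor (Cotangent r y) (base r ⁻¹' {y}) where
  vadd ξ x := ⟨x + ofMomentum r ξ, by
    have h : ∀ ξ : Eucl r →L[ℝ] ℝ, base r (x.1 + ofMomentum r ξ) = y := fun ξ ↦ by
      rw [map_add, base_ofMomentum, add_zero]
      exact x.2
    exact h ξ⟩
  zero_vadd x := Subtype.ext <|
    (congrArg (x.1 + ·) (map_zero (ofMomentum r))).trans (add_zero x.1)
  add_vadd ξ η x := Subtype.ext <| by
    have h : ∀ ξ η : Eucl r →L[ℝ] ℝ, x.1 + ofMomentum r (ξ + η) =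
        x.1 + ofMomentum r η + ofMomentum r ξ := fun ξ η ↦ by
      rw [map_add, add_assoc, add_comm (ofMomentum r η)]
    exact h ξ η
  vsub x x' := momentum r x - momentum r x'
  nonempty := ⟨⟨ofBase r y, base_ofBase y⟩⟩
  vsub_vadd' x x' := Subtype.ext <| by
    have h : x'.1 + ofMomentum r (momentum r x.1 - momentum r x'.1) = x.1 := by
      refine model_ext ?_ ?_
      · rw [map_add, base_ofMomentum, add_zero]
        exact x'.2.trans x.2.symm
      · rw [map_add, momentum_ofMomentum, add_sub_cancel]
    exact h
  vadd_vsub' ξ x := by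
    have h : ∀ ξ : Eucl r →L[ℝ] ℝ, momentum r (x.1 + ofMomentum r ξ) - momentum r x.1 = ξ :=
      fun ξ ↦ by rw [map_add, momentum_ofMomentum, add_sub_cancel_left]
    exact h ξ

/-- The cotangent bundle of `ℝ^r`, as a cotangent affine bundle with the total space `ℝ^{2r}`. -/
def modelBundle (r : ℕ) : CotangentAffineBundle r (Eucl r) (Eucl (2 * r)) where
  proj x := base r x
  affine := modelTorsor
  locally_trivial y₀ := by
    refine ⟨univ, isOpen_univ, mem_univ _, fun y ↦ ⟨ofBase r y, base_ofBase y⟩, ?_, ?_⟩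
    · have h1 : ContMDiff ((𝓡 r).prod 𝓘(ℝ, Eucl r →L[ℝ] ℝ)) (𝓡 (2 * r)) ∞
          (fun p : CotangentBundle r (Eucl r) ↦ ofBase r p.1 + ofMomentum r (cotangentSnd p)) :=
        ((ofBase r).contDiff.contMDiff.comp
          (contMDiff_proj (fun y : Eucl r ↦ TangentSpace (𝓡 r) y →L[ℝ] ℝ))).add
          ((ofMomentum r).contDiff.contMDiff.comp contMDiff_cotangentSnd)
      exact h1.contMDiffOn
    · have h := contMDiffOn_cotangent_mk (n := r) (s := univ)
        (base r).contDiff.contMDiff.contMDiffOn (momentum r).contDiff.contMDiff.contMDiffOn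
      refine (h.mono (subset_univ _)).congr fun x _ ↦ ?_
      have h1 : momentum r x - momentum r (ofBase r (base r x)) = momentum r x := by
        rw [momentum_ofBase, sub_zero]
      exact congrArg (fun η : Eucl r →L[ℝ] ℝ ↦ (⟨base r x, η⟩ : CotangentBundle r (Eucl r))) h1

theorem mfderiv_modelBundle_proj (x v : Eucl (2 * r)) :
    (mfderiv (𝓡 (2 * r)) (𝓡 r) (modelBundle r).proj x v : Eucl r) = base r v := by
  have h := ((base r).hasFDerivAt (x := x)).hasMFDerivAt.mfderiv
  exact DFunLike.congr_fun h v

theorem modelBundle_verticalVector (x : Eucl (2 * r)) (ξ : Eucl r →L[ℝ] ℝ) :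
    ((modelBundle r).verticalVector x ξ : Eucl (2 * r)) = ofMomentum r ξ := by
  have h1 : HasFDerivAt (fun t : ℝ ↦ x + ofMomentum r (t • ξ))
      (ContinuousLinearMap.toSpanSingleton ℝ (ofMomentum r ξ)) 0 := by
    simp only [map_smul]
    exact (((hasDerivAt_id (0 : ℝ)).smul_const _).const_add x).hasFDerivAt.congr_fderiv
      (by ext1; simp)
  have h2 := DFunLike.congr_fun h1.hasMFDerivAt.mfderiv (1 : ℝ)
  exact h2.trans (one_smul ℝ _)

variable {h₀ : Eucl r → Eucl r →L[ℝ] Eucl r →L[ℝ] ℝ}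
  {Γ : Eucl r → Eucl r →L[ℝ] Eucl r →L[ℝ] Eucl r}

theorem covDerivForm_modelConnection {θ : ∀ y : Eucl r, Cotangent r y} (hθ : SmoothForm θ)
    (y u w : Eucl r) : covDerivForm (modelConnection Γ) θ y u w =
      fderiv (E := Eucl r) (F := Eucl r →L[ℝ] ℝ) ℝ θ y u w - θ y (Γ y u w) := by
  have hc : MDifferentiableAt (𝓡 r) (𝓡 r).tangent
      (fun z ↦ (⟨z, w⟩ : TangentBundle (𝓡 r) (Eucl r))) y :=
    mdifferentiableAt_vectorField_iff.2 (differentiableAt_const _)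
  refine (covDerivForm_apply (modelConnection Γ) θ hθ y u (fun _ ↦ w) hc).trans ?_
  have hd : HasFDerivAt (E := Eucl r) (F := Eucl r →L[ℝ] ℝ) (𝕜 := ℝ) θ (fderiv ℝ θ y) y :=
    (hθ.contDiff.differentiable (by simp) y).hasFDerivAt
  have h1 : fderiv ℝ (fun z : Eucl r ↦ θ z w) y u =
      fderiv (E := Eucl r) (F := Eucl r →L[ℝ] ℝ) ℝ θ y u w := by
    have h2 := (hd.clm_apply (hasFDerivAt_const w y)).fderiv
    refine (DFunLike.congr_fun h2 u).trans ?_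
    have h3 : ∀ A : Eucl r →L[ℝ] ℝ, A 0 + fderiv (E := Eucl r) (F := Eucl r →L[ℝ] ℝ) ℝ θ y u w =
        fderiv (E := Eucl r) (F := Eucl r →L[ℝ] ℝ) ℝ θ y u w := fun A ↦ by
      rw [map_zero, zero_add]
    exact h3 (θ y)
  have h3 := congrArg (θ y) (modelConnection_const (Γ := Γ) w y u)
  have h4 := (mvfderiv_vectorSpace (f := fun z : Eucl r ↦ θ z w) (x := y) u).trans h1
  exact congrArg₂ (· - ·) h4 h3

/-- The model metric is a Riemann extension metric: a translation by a form `θ` adds `dθ` to `dp`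
and `-2θ(Γ)` to the coefficients. -/
theorem isRiemannExtension_modelMetric (hh : ContDiff ℝ ∞ h₀) (hΓ : ContDiff ℝ ∞ Γ)
    (hh' : ∀ z a b, h₀ z a b = h₀ z b a) (hΓ' : ∀ z a b, Γ z a b = Γ z b a) :
    (modelBundle r).IsRiemannExtension (modelConnection Γ) (modelMetric hh hΓ hh' hΓ') where
  standard := by
    intro x ξ w
    have h1 : ∀ (ξ : Eucl r →L[ℝ] ℝ) (w : Eucl (2 * r)),
        modelForm h₀ Γ x (ofMomentum r ξ) w = ξ (base r w) := fun ξ w ↦ by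
      simp [modelForm_apply]
    have h2 := congrArg (fun v : Eucl (2 * r) ↦ modelForm h₀ Γ x v w)
      (modelBundle_verticalVector x ξ)
    have h3 := congrArg (fun v : Eucl r ↦ (ξ : Eucl r →L[ℝ] ℝ) v) (mfderiv_modelBundle_proj x w)
    exact (h2.trans (h1 ξ w)).trans h3.symm
  shift_rule := by
    intro θ hθ x v w
    let Θ : Eucl r → Eucl r →L[ℝ] ℝ := θ
    have hΘ : HasFDerivAt Θ (fderiv ℝ Θ (base r x)) (base r x) :=
      (hθ.contDiff.differentiable (by simp) _).hasFDerivAt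
    have h1 : HasFDerivAt (fun x ↦ x + ofMomentum r (Θ (base r x)))
        (ContinuousLinearMap.id ℝ _ + (ofMomentum r).comp
          ((fderiv ℝ Θ (base r x)).comp (base r))) x :=
      (hasFDerivAt_id x).add ((ofMomentum r).hasFDerivAt.comp x
        (HasFDerivAt.comp x hΘ (base r).hasFDerivAt))
    have h2 : ∀ v : Eucl (2 * r), (mfderiv (𝓡 (2 * r)) (𝓡 (2 * r)) ((modelBundle r).shift θ) x v :
        Eucl (2 * r)) = v + ofMomentum r (fderiv ℝ Θ (base r x) (base r v)) := fun v ↦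
      DFunLike.congr_fun h1.hasMFDerivAt.mfderiv v
    have h3 : ∀ v w : Eucl (2 * r), modelForm h₀ Γ (x + ofMomentum r (Θ (base r x)))
        (v + ofMomentum r (fderiv ℝ Θ (base r x) (base r v)))
        (w + ofMomentum r (fderiv ℝ Θ (base r x) (base r w))) = modelForm h₀ Γ x v w
        + ((fderiv ℝ Θ (base r x) (base r v) (base r w)
            - Θ (base r x) (Γ (base r x) (base r v) (base r w)))
          + (fderiv ℝ Θ (base r x) (base r w) (base r v)
            - Θ (base r x) (Γ (base r x) (base r w) (base r v)))) := by
      intro v w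
      rw [modelForm_apply, modelForm_apply, hΓ' _ (base r w)]
      simp
      ring
    have h4 : ∀ y u w : Eucl r, killing (modelConnection Γ) θ y u w =
        (fderiv ℝ Θ y u w - Θ y (Γ y u w)) + (fderiv ℝ Θ y w u - Θ y (Γ y w u)) := fun y u w ↦
      congrArg₂ (· + ·) (covDerivForm_modelConnection hθ y u w)
        (covDerivForm_modelConnection hθ y w u)
    have h5 := congrArg₂ (fun v w : Eucl (2 * r) ↦
      modelForm h₀ Γ (x + ofMomentum r (Θ (base r x))) v w) (h2 v) (h2 w)
    have h6 := congrArg₂ (fun u w : Eucl r ↦ killing (modelConnection Γ) θ (base r x) u w)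
      (mfderiv_modelBundle_proj x v) (mfderiv_modelBundle_proj x w)
    have h7 := h6.trans (h4 (base r x) (base r v) (base r w))
    exact (h5.trans (h3 v w)).trans (congrArg (modelForm h₀ Γ x v w + ·) h7.symm)

end ModelBundle

/-! ### Isometry with the model -/

section LocalModel

variable {r : ℕ} {M : Type u} [TopologicalSpace M] [ChartedSpace (Eucl (2 * r)) M]
  [IsManifold (𝓡 (2 * r)) ∞ M] {V : ∀ x : M, Submodule ℝ (TangentSpace (𝓡 (2 * r)) x)}
  {g : PseudoRiemannianMetric (2 * r) M}

/-- Around every point, a metric whose Levi-Civita connection is projectable along a null parallel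
distribution of half the dimension is isometric to a Riemann extension metric. -/
theorem IsLeviCivita.exists_riemannExtension {nabla : Connection (2 * r) M}
    (hLC : IsLeviCivita g nabla) (hV : IsDistribution r V) (hnull : IsNull g V)
    (hpar : IsParallel nabla V) (hproj : IsProjectable.{u, 0} r nabla V) (x : M) :
    ∃ (D : Connection r (Eucl r)) (gN : PseudoRiemannianMetric (2 * r) (Eucl (2 * r)))
      (φ : OpenPartialHomeomorph M (Eucl (2 * r))),
      IsTorsionFreeConnection D ∧ (modelBundle r).IsRiemannExtension D gN ∧ x ∈ φ.source ∧
      ContMDiffOn (𝓡 (2 * r)) (𝓡 (2 * r)) ∞ φ φ.source ∧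
      ContMDiffOn (𝓡 (2 * r)) (𝓡 (2 * r)) ∞ φ.symm φ.target ∧
      (∀ z ∈ φ.source, ∀ v w : TangentSpace (𝓡 (2 * r)) z,
        g.form z v w = gN.form (φ z) (mfderiv (𝓡 (2 * r)) (𝓡 (2 * r)) φ z v)
          (mfderiv (𝓡 (2 * r)) (𝓡 (2 * r)) φ z w)) ∧
      (∀ z ∈ φ.source, (V z).map (mfderiv (𝓡 (2 * r)) (𝓡 (2 * r)) φ z).toLinearMap
        = (modelBundle r).vertical (φ z)) ∧
      IsProjectedConnection nabla V φ.source (fun z ↦ (modelBundle r).proj (φ z)) D := by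
  obtain ⟨β, φ, hβ, htβ, hφ, hs, hx, hβφ, hVφ, hstd⟩ :=
    hLC.exists_standard_chart (two_mul r) hV hnull hpar hproj x
  have hVβ : ∀ y ∈ β.source, ∀ v, v ∈ V y ↔ (mvfderiv (𝓡 (2 * r)) β y v).1 = 0 := by
    intro y hy v
    have hyφ : y ∈ φ.source := hs ▸ hy
    rw [hVφ y hyφ, ← mvfderiv_chart_fst hφ hyφ, ← mvfderiv_chart_fst hβ hy]
    simp only [hβφ]
  have hleaf : IsLeafFibration (q := r) V φ.source (fun y ↦ (φ y).1) := by
    have h := hβ.isLeafFibration htβ hVβ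
    rw [← hs] at h
    simpa only [hβφ] using h
  obtain ⟨Γ, hΓ, hΓs⟩ := hLC.exists_leaf_christoffel hφ hVφ hstd hleaf hproj
  obtain ⟨h₀, hh, hhs, hg⟩ := hΓ.exists_metric_eq hΓs hβ htβ hs hβφ
  have hΓd : ContDiff ℝ ∞ Γ := contDiffOn_univ.1 hΓ.smooth
  set L := modelEquiv r with hL
  let ψ := φ.trans L.symm.toHomeomorph.toOpenPartialHomeomorph
  have hψs : ψ.source = φ.source := by
    rw [OpenPartialHomeomorph.trans_source]
    exact inter_univ _
  have hψ : IsSmoothChart (n := 2 * r) ψ :=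
    hφ.trans L.symm.contDiff.contDiffOn L.contDiff.contDiffOn
  have hbase : ∀ y, base r (ψ y) = (φ y).1 := fun y ↦
    congrArg Prod.fst (L.apply_symm_apply (φ y))
  have hmom : ∀ y, momentum r (ψ y) = (φ y).2 := fun y ↦
    congrArg Prod.snd (L.apply_symm_apply (φ y))
  have hdψ : ∀ y ∈ φ.source, ∀ v, mvfderiv (𝓡 (2 * r)) ψ y v =
      L.symm (mvfderiv (𝓡 (2 * r)) φ y v) := fun y hy v ↦
    (mvfderiv_fderiv_comp (h := L.symm) L.symm.differentiableAt (hφ.mdifferentiableAt hy) v).trans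
      (by rw [ContinuousLinearEquiv.fderiv]; rfl)
  have hdbase : ∀ y ∈ φ.source, ∀ v, base r (mvfderiv (𝓡 (2 * r)) ψ y v) =
      (mvfderiv (𝓡 (2 * r)) φ y v).1 := fun y hy v ↦ by
    rw [hdψ y hy]
    exact congrArg Prod.fst (L.apply_symm_apply _)
  have hdmom : ∀ y ∈ φ.source, ∀ v, momentum r (mvfderiv (𝓡 (2 * r)) ψ y v) =
      (mvfderiv (𝓡 (2 * r)) φ y v).2 := fun y hy v ↦ by
    rw [hdψ y hy]
    exact congrArg Prod.snd (L.apply_symm_apply _)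
  refine ⟨modelConnection Γ, modelMetric hh hΓd hhs hΓs, ψ,
    isTorsionFreeConnection_modelConnection hΓd hΓs, isRiemannExtension_modelMetric hh hΓd hhs hΓs,
    hψs ▸ hx, hψ.smooth, hψ.smooth_symm, ?_, ?_, ?_⟩
  · intro z hz v w
    rw [hψs] at hz
    have h : g.form z v w = modelForm h₀ Γ (ψ z) (mvfderiv (𝓡 (2 * r)) ψ z v)
        (mvfderiv (𝓡 (2 * r)) ψ z w) := by
      rw [modelForm_apply, hdbase z hz, hdbase z hz, hdmom z hz, hdmom z hz, hbase, hmom]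
      have h1 := hg z hz (mvfderiv (𝓡 (2 * r)) φ z v) (mvfderiv (𝓡 (2 * r)) φ z w)
      rw [hφ.coordField_mvfderiv hz, hφ.coordField_mvfderiv hz] at h1
      rw [h1]
      ring
    exact h
  · intro z hz
    have hz' : z ∈ φ.source := hψs ▸ hz
    ext u
    have hmem : ∀ u : Eucl (2 * r), u ∈ (modelBundle r).vertical (ψ z) ↔ base r u = 0 := fun u ↦ by
      have h := mfderiv_modelBundle_proj (ψ z) u
      exact ⟨fun hu ↦ h.symm.trans hu, fun hu ↦ h.trans hu⟩
    refine Iff.trans ?_ (hmem u).symm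
    rw [Submodule.mem_map]
    constructor
    · rintro ⟨v, hv, rfl⟩
      exact (hdbase z hz' v).trans ((hVφ z hz' v).1 hv)
    · intro hu
      obtain ⟨v, hv⟩ := (hψ.bijective hz).2 u
      refine ⟨v, (hVφ z hz' v).2 ?_, hv⟩
      rw [← hdbase z hz', hv]
      exact hu
  · have hpr : (fun z ↦ (modelBundle r).proj (ψ z)) = fun z ↦ (φ z).1 := funext hbase
    rw [hψs, hpr]
    refine IsAdaptedChart.isProjectedConnection hLC hleaf fun y hy ↦
      ⟨φ, univ, Γ, OpenPartialHomeomorph.refl _, hy, hΓ, isSmoothChart_refl, mem_univ _,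
        Filter.Eventually.of_forall fun _ ↦ rfl, fun b u ↦ ?_⟩
    have h : ∀ z v : Eucl r,
        mvfderiv (𝓡 r) (OpenPartialHomeomorph.refl (Eucl r)) z v = v := fun z v ↦
      (mvfderiv_vectorSpace v).trans
        (DFunLike.congr_fun (fderiv_id (𝕜 := ℝ) (x := z)) v)
    rw [coordField_refl]
    exact (h _ _).trans ((modelConnection_const b _ u).trans
      (congrArg (fun t ↦ Γ (φ y).1 t b) (h _ u).symm))

end LocalModel

end RiemannExtension

end

theorem theorem5p2 :
    (∀ (r : ℕ) (S : Type v) [TopologicalSpace S] [ChartedSpace (Eucl r) S]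
      [IsManifold (𝓡 r) ∞ S] [T2Space S] [SecondCountableTopology S] [ConnectedSpace S]
      (N : Type u) [TopologicalSpace N] [ChartedSpace (Eucl (2 * r)) N]
      [IsManifold (𝓡 (2 * r)) ∞ N] [T2Space N] [SecondCountableTopology N] [ConnectedSpace N]
      (D : Connection r S) (B : CotangentAffineBundle r S N)
      (g : PseudoRiemannianMetric (2 * r) N) (nabla : Connection (2 * r) N),
      IsTorsionFreeConnection D → B.IsRiemannExtension D g → IsLeviCivita g nabla →
        IsNull g B.vertical ∧ IsParallel nabla B.vertical ∧
        IsProjectable.{u, v} r nabla B.vertical ∧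
        IsProjectedConnection nabla B.vertical univ B.proj D) ∧
    (∀ (r : ℕ) (M : Type u) [TopologicalSpace M] [ChartedSpace (Eucl (2 * r)) M]
      [IsManifold (𝓡 (2 * r)) ∞ M] [T2Space M] [SecondCountableTopology M] [ConnectedSpace M]
      (g : PseudoRiemannianMetric (2 * r) M) (nabla : Connection (2 * r) M)
      (V : ∀ x : M, Submodule ℝ (TangentSpace (𝓡 (2 * r)) x)),
      IsLeviCivita g nabla → IsDistribution r V → IsNull g V → IsParallel nabla V →
      IsProjectable.{u, 0} r nabla V →
      ∀ x : M, ∃ (S : Type) (_ : TopologicalSpace S) (_ : ChartedSpace (Eucl r) S)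
        (_ : IsManifold (𝓡 r) ∞ S) (_ : T2Space S) (_ : SecondCountableTopology S)
        (_ : ConnectedSpace S) (D : Connection r S)
        (N : Type) (_ : TopologicalSpace N) (_ : ChartedSpace (Eucl (2 * r)) N)
        (_ : IsManifold (𝓡 (2 * r)) ∞ N) (_ : T2Space N) (_ : SecondCountableTopology N)
        (_ : ConnectedSpace N) (B : CotangentAffineBundle r S N)
        (gN : PseudoRiemannianMetric (2 * r) N) (φ : OpenPartialHomeomorph M N),
        IsTorsionFreeConnection D ∧ B.IsRiemannExtension D gN ∧
        x ∈ φ.source ∧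
        ContMDiffOn (𝓡 (2 * r)) (𝓡 (2 * r)) ∞ φ φ.source ∧
        ContMDiffOn (𝓡 (2 * r)) (𝓡 (2 * r)) ∞ φ.symm φ.target ∧
        (∀ z ∈ φ.source, ∀ v w : TangentSpace (𝓡 (2 * r)) z,
          g.form z v w = gN.form (φ z) (mfderiv (𝓡 (2 * r)) (𝓡 (2 * r)) φ z v)
            (mfderiv (𝓡 (2 * r)) (𝓡 (2 * r)) φ z w)) ∧
        (∀ z ∈ φ.source, (V z).map (mfderiv (𝓡 (2 * r)) (𝓡 (2 * r)) φ z).toLinearMap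
          = B.vertical (φ z)) ∧
        IsProjectedConnection nabla V φ.source (fun z ↦ B.proj (φ z)) D) := by
  refine ⟨fun r S _ _ _ _ _ _ N _ _ _ _ _ _ D B g nabla hD hg hn ↦ hg.properties hD hn,
    fun r M _ _ _ _ _ _ g nabla V hLC hV hnull hpar hproj x ↦ ?_⟩
  obtain ⟨D, gN, φ, h⟩ := hLC.exists_riemannExtension hV hnull hpar hproj x
  exact ⟨Eucl r, inferInstance, inferInstance, inferInstance, inferInstance, inferInstance,
    inferInstance, D, Eucl (2 * r), inferInstance, inferInstance, inferInstance, inferInstance,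
    inferInstance, inferInstance, modelBundle r, gN, φ, h⟩
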